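/- Let $E$ be a metric space (with its Borel $\sigma$-algebra) in which every closed ball is compact. Let $X=(X(t))_{t\ge 0}$ be a conservative standard Markov process on $E$ with laws $(\mathbb P^x)_{x\in E}$: $X$ has càdlàg paths, is adapted to a right-continuous filtration, and is strong Markov and quasi-left-continuous with respect to it. (The filtration may be complete; completeness is not needed.) Assume that $X$ is weakly Feller: for all $t\ge 0$, $P_th(x)=\mathbb E^x\{h(X(t))\}$ maps the space of continuous functions vanishing at infinity into itself. Let $\mathcal O\subseteq E$ be open, $\tau_{\mathcal O}=\inf\{t\ge 0: X(t)\notin\mathcal O\}$ and $\alpha>0$. Let $f,F:[0,\infty)\times E\to\mathbb R$ be bounded measurable functions that are continuous in $s$ uniformly in $x$ from compact sets, and let $F$ be continuous on $[0,\infty)\times\mathcal O$ ($F$ may be discontinuous in $x$ outside $\mathcal O$). For stopping times $\tau$ with values in $[0,\infty]$ put $$J(s,x,\tau)=\mathbb E^x\Big\{\int_0^{\tau\wedge\tau_{\mathcal O}}e^{-\alpha u}f(s+u,X(u))\,du+e^{-\alpha(\tau\wedge\tau_{\mathcal O})}F\big(s+\tau\wedge\tau_{\mathcal O},X(\tau\wedge\tau_{\mathcal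 O})\big)\Big\},\qquad w(s,x)=\sup_\tau J(s,x,\tau),$$ where the second term is $0$ on $\{\tau\wedge\tau_{\mathcal O}=\infty\}$. Assume (A1) for every $t>0$ and every continuous bounded $h:E\to\mathbb R$, the function $x\mapsto\mathbb E^x\{1_{\{t<\tau_{\mathcal O}\}}h(X(t))\}$ is continuous on $E$; (A3) for every $t>0$ and every bounded measurable $h:E\to\mathbb R$, the function $x\mapsto\mathbb E^x\{h(X(t))\}$ is continuous on $E$. Then for every $\beta>0$ there is exactly one bounded measurable function $w^\beta:[0,\infty)\times E\to\mathbb R$ satisfying, for all $(s,x)$, $$w^\beta(s,x)=\mathbb E^x\Big\{\int_0^{\tau_{\mathcal O}}e^{-\alpha u}\big[f+\beta(F-w^\beta)^+\big](s+u,X(u))\,du+e^{-\alpha\tau_{\mathcal O}}F\big(s+\tau_{\mathcal O},X(\tau_{\mathcal O})\big)\Big\}$$ (again with the last term $0$ on $\{\tau_{\mathcal O}=\infty\}$). Each $w^\beta$ is continuous on $[0,\infty)\times\mathcal O$; for every $(s,x)$ the map $\beta\mapsto w^\beta(s,x)$ is non-decreasing on $(0,\infty)$; and as $\beta\to\infty$,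 $w^\beta$ converges to $w$ pointwise on $[0,\infty)\times E$ and uniformly on every compact subset of $[0,\infty)\times\mathcal O$. -/

import Mathlib

open MeasureTheory ProbabilityTheory Filter Topology Set
open scoped NNReal ENNReal ZeroAtInfty

noncomputable section

/-- A (conservative, time-homogeneous) standard Markov process with state space `E`, realised on
`Ω`: a family of laws `P x` under which `X` starts from `x`, a right-continuous filtration to which
`X` is adapted, càdlàg paths, the strong Markov property and quasi-left-continuity.
The filtration is allowed, but not required, to be complete. Stopping times take values in
`[0, ∞] = WithTop ℝ≥0`. -/
structure StandardMarkovProcess (E Ω : Type*) [TopologicalSpace E] [MeasurableSpace E]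
    [mΩ : MeasurableSpace Ω] where
  /-- the filtration -/
  filtration : Filtration ℝ≥0 mΩ
  /-- the process -/
  X : ℝ≥0 → Ω → E
  /-- the law of the process started from a given point -/
  P : E → Measure Ω
  rightContinuous_filtration : filtration.IsRightContinuous
  isProbabilityMeasure : ∀ x, IsProbabilityMeasure (P x)
  adapted : ∀ t, Measurable[filtration t] (X t)
  start : ∀ x, ∀ᵐ ω ∂(P x), X 0 ω = x
  /-- the transition probabilities are Borel measurable in the starting point -/
  measurable_transition : ∀ (t : ℝ≥0) (B : Set E), MeasurableSet B →
    Measurable fun x => P x {ω | X t ω ∈ B}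
  right_continuous : ∀ (ω : Ω) (t : ℝ≥0), Tendsto (fun u => X u ω) (𝓝[>] t) (𝓝 (X t ω))
  left_limits : ∀ (ω : Ω) (t : ℝ≥0), ∃ y : E, Tendsto (fun u => X u ω) (𝓝[<] t) (𝓝 y)
  /-- `P^x(X(τ + t) ∈ B | 𝓕_τ) = P^{X(τ)}(X(t) ∈ B)` on `{τ < ∞}` -/
  strong_markov : ∀ (τ : Ω → WithTop ℝ≥0) (hτ : IsStoppingTime filtration τ) (x : E) (t : ℝ≥0)
    (A : Set Ω) (B : Set E), MeasurableSet[hτ.measurableSpace] A → MeasurableSet B →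
    P x (A ∩ {ω | τ ω ≠ ⊤} ∩ {ω | X ((τ ω).untopD 0 + t) ω ∈ B}) =
      ∫⁻ ω in A ∩ {ω | τ ω ≠ ⊤}, P (X ((τ ω).untopD 0) ω) {ω' | X t ω' ∈ B} ∂(P x)
  /-- if `τ n ↑ σ` are stopping times then `X(τ n) → X(σ)` almost surely on `{σ < ∞}` -/
  quasi_left_continuous : ∀ (τ : ℕ → Ω → WithTop ℝ≥0) (σ : Ω → WithTop ℝ≥0),
    (∀ n, IsStoppingTime filtration (τ n)) → (∀ ω, Monotone fun n => τ n ω) →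
    (∀ ω, IsLUB (range fun n => τ n ω) (σ ω)) →
    ∀ x, ∀ᵐ ω ∂(P x), σ ω ≠ ⊤ →
      Tendsto (fun n => X ((τ n ω).untopD 0) ω) atTop (𝓝 (X ((σ ω).untopD 0) ω))

/-- `g(s, x)` is continuous in `s`, uniformly in `x` from compact sets. -/
def ContinuousInTimeUniformlyOnCompacts {E : Type*} [TopologicalSpace E]
    (g : ℝ≥0 × E → ℝ) : Prop :=
  ∀ K : Set E, IsCompact K → ∀ s : ℝ≥0,
    TendstoUniformlyOn (fun r x => g (r, x)) (fun x => g (s, x)) (𝓝 s) K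

/-- `g` is bounded. -/
def IsBoundedFunction {S : Type*} (g : S → ℝ) : Prop := ∃ C : ℝ, ∀ p, |g p| ≤ C

namespace StandardMarkovProcess

section Definitions

variable {E Ω : Type*} [TopologicalSpace E] [MeasurableSpace E] [MeasurableSpace Ω]

/-- The weak Feller property `P_t C₀ ⊆ C₀`. -/
def WeakFeller (M : StandardMarkovProcess E Ω) : Prop :=
  ∀ (t : ℝ≥0) (h : C₀(E, ℝ)), ∃ g : C₀(E, ℝ), ∀ x, g x = ∫ ω, h (M.X t ω) ∂(M.P x)

/-- The strong Feller property. -/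
def StrongFeller (M : StandardMarkovProcess E Ω) : Prop :=
  ∀ (t : ℝ≥0), 0 < t → ∀ h : E → ℝ, Measurable h → IsBoundedFunction h →
    Continuous fun x => ∫ ω, h (M.X t ω) ∂(M.P x)

/-- The first exit time `τ_O = inf {t ≥ 0 : X(t) ∉ O}`, with `inf ∅ = ∞`. -/
def exitTime (M : StandardMarkovProcess E Ω) (O : Set E) : Ω → WithTop ℝ≥0 :=
  hittingAfter M.X Oᶜ 0

open scoped Classical in
/-- For `t > 0`, `P_t^{τ_O} h (x) = E^x {1_{t < τ_O} h(X(t))}` is continuous in `x` for every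
continuous bounded `h`. -/
def StoppedFeller (M : StandardMarkovProcess E Ω) (O : Set E) : Prop :=
  ∀ (t : ℝ≥0), 0 < t → ∀ h : E → ℝ, Continuous h → IsBoundedFunction h →
    Continuous fun x =>
      ∫ ω, (if (t : WithTop ℝ≥0) < M.exitTime O ω then h (M.X t ω) else 0) ∂(M.P x)

/-- `∫_0^T e^{-α u} g(s + u, X(u)) du` along the path `ω`, for `T ∈ [0, ∞]`. -/
def runningReward (M : StandardMarkovProcess E Ω) (α : ℝ) (g : ℝ≥0 × E → ℝ) (s : ℝ≥0)
    (T : WithTop ℝ≥0) (ω : Ω) : ℝ :=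
  ∫ u in {u : ℝ | 0 ≤ u ∧ ((u.toNNReal : ℝ≥0) : WithTop ℝ≥0) < T},
    Real.exp (-α * u) * g (s + u.toNNReal, M.X u.toNNReal ω)

open scoped Classical in
/-- `e^{-α T} g(s + T, X(T))` along the path `ω`, which is `0` for `T = ∞`. -/
def terminalReward (M : StandardMarkovProcess E Ω) (α : ℝ) (g : ℝ≥0 × E → ℝ) (s : ℝ≥0)
    (T : WithTop ℝ≥0) (ω : Ω) : ℝ :=
  if T = ⊤ then 0
  else Real.exp (-α * (T.untopD 0 : ℝ≥0)) * g (s + T.untopD 0, M.X (T.untopD 0) ω)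

/-- The functional `J(s, x, τ)`: running reward `f`, payoff `F`, stopping at `τ ∧ τ_O`. -/
def functional (M : StandardMarkovProcess E Ω) (O : Set E) (α : ℝ) (f F : ℝ≥0 × E → ℝ)
    (p : ℝ≥0 × E) (τ : Ω → WithTop ℝ≥0) : ℝ :=
  ∫ ω, (M.runningReward α f p.1 (min (τ ω) (M.exitTime O ω)) ω +
    M.terminalReward α F p.1 (min (τ ω) (M.exitTime O ω)) ω) ∂(M.P p.2)

/-- The value function `w(s, x) = sup_τ J(s, x, τ)`, over all stopping times of the filtration. -/
def valueFunction (M : StandardMarkovProcess E Ω) (O : Set E) (α : ℝ) (f F : ℝ≥0 × E → ℝ)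
    (p : ℝ≥0 × E) : ℝ :=
  ⨆ τ : {τ : Ω → WithTop ℝ≥0 // IsStoppingTime M.filtration τ}, M.functional O α f F p τ.1

/-- `w` is a bounded measurable solution of the penalized equation with parameter `β`. -/
def IsPenalizedSolution (M : StandardMarkovProcess E Ω) (O : Set E) (α : ℝ)
    (f F : ℝ≥0 × E → ℝ) (β : ℝ) (w : ℝ≥0 × E → ℝ) : Prop :=
  Measurable w ∧ IsBoundedFunction w ∧
    ∀ (s : ℝ≥0) (x : E), w (s, x) =
      ∫ ω, (M.runningReward α (fun q => f q + β * max (F q - w q) 0) s (M.exitTime O ω) ω +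
        M.terminalReward α F s (M.exitTime O ω) ω) ∂(M.P x)

end Definitions

end StandardMarkovProcess

end

/-! Write V_γ g for the expected reward, discounted at rate γ, with running rate g and payoff F, up
to the exit from O (`value`). The strong Markov property gives the resolvent equation V_α g =
V_{α+β}(g + β V_α g) (`value_resolvent`). For g = f + β(F - w)^+ it turns the penalized equation w =
V_α g into w = V_{α+β}(f + β max(F, w)) (`penalized_iff`). The right side is a sup-norm contraction
in w with constant β/(α+β), whence existence, uniqueness and monotonicity in β.

Pointwise convergence. Replacing max(F, w^β) by F shows w^β ≥ V_{α+β}(f + βF). The latter averages F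
along the path over times of order 1/β, so (F - w^β)^+ tends to 0 boundedly (`tendsto_penalty`). The
penalized equation, stopped at τ, bounds J(τ) by w^β plus the expected discounted value of (F -
w^β)^+ at the stopping time (`functional_le`), which gives the lower bound in the limit. Conversely,
until F first exceeds w^β no penalty is paid, and at that time w^β ≤ F, so w^β ≤ w
(`le_valueFunction`).

Continuity. V_γ g differs from the discounted P_ε V_γ g, which is continuous in x by the strong
Feller property, by at most Cε + 2D P^x(exit ≤ ε). It therefore suffices that quick exits are
improbable uniformly near each point of O (`NoQuickExit`, `continuousOn_value`). For O = E there is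
no exit at all, and this case is bootstrapped to open U in `noQuickExit`. There one solves the
penalized problem on all of E with obstacle 1 - k, where k is a compactly supported bump equal to 1
at x₀ and 0 off U. A large discount rate makes the solution small at x₀, hence near x₀ by
continuity. A large β makes it at least 1/2 wherever the path leaves U, at times up to 1. A quick
exit from U must then be improbable. The weak Feller property controls the resolvent at infinity and
makes this domination uniform in space.

Uniform convergence. Running the comparison only until the first of the obstacle time, the exit from
a small ball and a short time ε bounds w - w^β by a small constant, a quick-exit probability, and
P_ε applied to the difference at time s + ε (`valueFunction_sub_le`). Along a sequence, that
difference is dominated by a tail supremum, which is bounded, measurable and pointwise vanishing.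
P_ε makes it continuous in x, so pointwise convergence becomes convergence along (β_n, q_n) → (∞,
q₀) (`tendsto_sub_seq`), and this is uniformity on compacts.

Measurability. Without completeness, the exit time is replaced by the supremum of the entrance times
into shrinking open neighbourhoods of the complement. These are stopping times by right-continuity
of the filtration, and quasi-left-continuity shows that the supremum is almost surely the exit time
(`ae_exitTime_eq`). -/

noncomputable section

/-! ### Measurability of right-continuous processes -/

section RightContinuousProcesses

lemma WithTop.eq_of_forall_coe_lt_iff {a b : WithTop ℝ≥0}
    (h : ∀ i : ℝ≥0, a < i ↔ b < i) : a = b := by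
  refine le_antisymm (le_of_forall_gt fun c hc => ?_) (le_of_forall_gt fun c hc => ?_)
  · obtain ⟨d, hd, hdc⟩ := exists_between hc
    lift d to ℝ≥0 using (ne_top_of_lt hdc)
    exact ((h d).2 hd).trans hdc
  · obtain ⟨d, hd, hdc⟩ := exists_between hc
    lift d to ℝ≥0 using (ne_top_of_lt hdc)
    exact ((h d).1 hd).trans hdc

/-- The smallest multiple of `1 / (n + 1)` which is strictly larger than `t`. -/
def dyadicCeil (n : ℕ) (t : ℝ≥0) : ℝ≥0 := ((⌊t * (n + 1)⌋₊ : ℝ≥0) + 1) / (n + 1)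

lemma lt_dyadicCeil (n : ℕ) (t : ℝ≥0) : t < dyadicCeil n t := by
  rw [dyadicCeil, lt_div_iff₀ (by positivity)]
  exact Nat.lt_floor_add_one _

lemma dyadicCeil_le (n : ℕ) (t : ℝ≥0) : dyadicCeil n t ≤ t + 1 / (n + 1) := by
  rw [dyadicCeil, add_div]
  gcongr
  rw [div_le_iff₀ (by positivity)]
  exact Nat.floor_le (by positivity)

lemma tendsto_dyadicCeil (t : ℝ≥0) : Tendsto (fun n => dyadicCeil n t) atTop (𝓝[>] t) := by
  refine tendsto_nhdsWithin_iff.2 ⟨?_, Eventually.of_forall fun n => lt_dyadicCeil n t⟩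
  refine tendsto_of_tendsto_of_tendsto_of_le_of_le tendsto_const_nhds ?_
    (fun n => (lt_dyadicCeil n t).le) (fun n => dyadicCeil_le n t)
  simpa using (tendsto_const_nhds (x := t)).add
    (tendsto_one_div_add_atTop_nhds_zero_nat (𝕜 := ℝ≥0))

lemma measurable_comp_of_nat {A B : Type*} {mA : MeasurableSpace A} [MeasurableSpace B]
    {X : ℝ≥0 → A → B} {g : ℕ → ℝ≥0} (hX : ∀ k, Measurable (X (g k))) {k : A → ℕ}
    (hk : Measurable k) : Measurable fun a => X (g (k a)) a :=
  (measurable_from_prod_countable_right (f := fun q : ℕ × A => X (g q.1) q.2) hX).comp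
    (hk.prodMk measurable_id)

variable {E Ω : Type*} [TopologicalSpace E] [TopologicalSpace.PseudoMetrizableSpace E]
  [MeasurableSpace E] [BorelSpace E]

/-- Rounding `u` up to a grid leaves countably many values, and right-continuity passes to the
limit. The cap at `i` ensures that only `X t` with `t ≤ i` enters, as progressive measurability
requires; where `u = i` the capped sequence is constant. -/
lemma measurable_comp_of_rightContinuous_of_le {A : Type*} {mA : MeasurableSpace A}
    {X : ℝ≥0 → A → E} (hX : ∀ a t, Tendsto (fun u => X u a) (𝓝[>] t) (𝓝 (X t a)))
    {i : ℝ≥0} (hm : ∀ t ≤ i, Measurable (X t)) {u : A → ℝ≥0} (hu : Measurable u)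
    (hui : ∀ a, u a ≤ i) : Measurable fun a => X (u a) a := by
  refine measurable_of_tendsto_metrizable (f := fun n a => X (min (dyadicCeil n (u a)) i) a)
    (fun n => ?_) (tendsto_pi_nhds.2 fun a => ?_)
  · exact measurable_comp_of_nat (g := fun k => min (((k : ℝ≥0) + 1) / (n + 1)) i)
      (fun k => hm _ (min_le_right _ _))
      (Nat.measurable_floor.comp (hu.mul_const ((n : ℝ≥0) + 1)))
  · rcases (hui a).eq_or_lt with h | h
    · refine tendsto_const_nhds.congr fun n => ?_
      rw [min_eq_right (h ▸ (lt_dyadicCeil n (u a)).le), h]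
    · refine (hX a (u a)).comp (tendsto_nhdsWithin_iff.2 ⟨?_, Eventually.of_forall fun n =>
        lt_min (lt_dyadicCeil n _) h⟩)
      have := (tendsto_nhdsWithin_iff.1 (tendsto_dyadicCeil (u a))).1.min
        (tendsto_const_nhds (x := i))
      rwa [min_eq_left h.le] at this

lemma measurable_comp_of_rightContinuous {A : Type*} {mA : MeasurableSpace A}
    {X : ℝ≥0 → A → E} (hX : ∀ a t, Tendsto (fun u => X u a) (𝓝[>] t) (𝓝 (X t a)))
    (hm : ∀ t, Measurable (X t)) {u : A → ℝ≥0} (hu : Measurable u) :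
    Measurable fun a => X (u a) a := by
  refine measurable_of_tendsto_metrizable (f := fun (n : ℕ) a => X (min (u a) n) a)
    (fun n => measurable_comp_of_rightContinuous_of_le hX (i := n) (fun t _ => hm t)
      (hu.min measurable_const) fun a => min_le_right _ _) (tendsto_pi_nhds.2 fun a => ?_)
  obtain ⟨N, hN⟩ := exists_nat_ge (u a)
  refine tendsto_const_nhds.congr' ?_
  filter_upwards [eventually_ge_atTop N] with n hn
  rw [min_eq_left (hN.trans (by exact_mod_cast hn))]

lemma isStronglyProgressive_of_rightContinuous [SecondCountableTopology E]
    {mΩ : MeasurableSpace Ω} {f : Filtration ℝ≥0 mΩ} {X : ℝ≥0 → Ω → E}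
    (hX : ∀ ω t, Tendsto (fun u => X u ω) (𝓝[>] t) (𝓝 (X t ω)))
    (hm : ∀ t, Measurable[f t] (X t)) : IsStronglyProgressive f X := by
  intro i
  let _ : MeasurableSpace Ω := f i
  have : Measurable fun p : Iic i × Ω => X p.1 p.2 :=
    measurable_comp_of_rightContinuous_of_le (X := fun t (p : Iic i × Ω) => X t p.2)
      (fun a t => hX a.2 t) (i := i) (fun t ht => ((hm t).mono (f.mono ht) le_rfl).comp
        measurable_snd) (measurable_subtype_coe.comp measurable_fst) (fun a => a.1.2)
  exact this.stronglyMeasurable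

end RightContinuousProcesses

/-! ### Hitting times -/

section Hitting

variable {β Ω : Type*} [TopologicalSpace β]

/-- A right-continuous path that enters an open set stays there for a short time, so a countable
dense set of times detects the visit. -/
lemma hittingAfter_lt_iff_of_isOpen {X : ℝ≥0 → Ω → β} {S : Set β} (hS : IsOpen S) {ω : Ω}
    (hX : ∀ t, Tendsto (fun u => X u ω) (𝓝[>] t) (𝓝 (X t ω))) (i : ℝ≥0) :
    hittingAfter X S 0 ω < i ↔
      ∃ n : ℕ, TopologicalSpace.denseSeq ℝ≥0 n < i ∧ X (TopologicalSpace.denseSeq ℝ≥0 n) ω ∈ S := by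
  rw [hittingAfter_lt_iff]
  constructor
  · rintro ⟨j, hj, hjS⟩
    have h1 : ∀ᶠ u in 𝓝[>] j, X u ω ∈ S := (hX j).eventually (hS.mem_nhds hjS)
    obtain ⟨c, hc, hcS⟩ := (mem_nhdsGT_iff_exists_Ioo_subset' hj.2).1 h1
    obtain ⟨n, hq⟩ := (TopologicalSpace.denseRange_denseSeq ℝ≥0).exists_mem_open
      (isOpen_Ioo (a := j) (b := min c i)) (nonempty_Ioo.2 (lt_min hc hj.2))
    exact ⟨n, hq.2.trans_le (min_le_right _ _), hcS ⟨hq.1, hq.2.trans_le (min_le_left _ _)⟩⟩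
  · rintro ⟨n, hn, hS⟩
    exact ⟨_, ⟨zero_le, hn⟩, hS⟩

lemma setOf_hittingAfter_lt_eq {X : ℝ≥0 → Ω → β} {S : Set β} (hS : IsOpen S)
    (hX : ∀ ω t, Tendsto (fun u => X u ω) (𝓝[>] t) (𝓝 (X t ω))) (i : ℝ≥0) :
    {ω | hittingAfter X S 0 ω < i} = ⋃ (n : ℕ) (_ : TopologicalSpace.denseSeq ℝ≥0 n < i),
      {ω | X (TopologicalSpace.denseSeq ℝ≥0 n) ω ∈ S} := by
  ext ω
  simp only [mem_ofPred_eq, mem_iUnion, hittingAfter_lt_iff_of_isOpen hS (hX ω) i, exists_prop]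

/-- The dense times only give the events with strict inequality; right-continuity of the filtration
closes the gap to `≤`. -/
lemma isStoppingTime_hittingAfter_of_isOpen {mΩ : MeasurableSpace Ω} {f : Filtration ℝ≥0 mΩ}
    [f.IsRightContinuous] {X : ℝ≥0 → Ω → β} {S : Set β} (hS : IsOpen S)
    (hX : ∀ ω t, Tendsto (fun u => X u ω) (𝓝[>] t) (𝓝 (X t ω)))
    (hm : ∀ t, MeasurableSet[f t] {ω | X t ω ∈ S}) :
    IsStoppingTime f (hittingAfter X S 0) := by
  refine isStoppingTime_of_measurableSet_lt_of_isRightContinuous fun i => ?_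
  rw [setOf_hittingAfter_lt_eq hS hX]
  exact MeasurableSet.iUnion fun n => MeasurableSet.iUnion fun h => f.mono h.le _ (hm _)

lemma measurable_hittingAfter_of_isOpen [MeasurableSpace Ω] {X : ℝ≥0 → Ω → β} {S : Set β}
    (hS : IsOpen S) (hX : ∀ ω t, Tendsto (fun u => X u ω) (𝓝[>] t) (𝓝 (X t ω)))
    (hm : ∀ t, MeasurableSet {ω | X t ω ∈ S}) : Measurable (hittingAfter X S 0) := by
  have key : ∀ i : ℝ≥0, MeasurableSet {ω | hittingAfter X S 0 ω < i} := fun i => by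
    rw [setOf_hittingAfter_lt_eq hS hX]
    exact MeasurableSet.iUnion fun n => MeasurableSet.iUnion fun h => hm _
  refine measurable_of_Iio fun c => ?_
  cases c with
  | coe i => exact key i
  | top =>
    have : hittingAfter X S 0 ⁻¹' Iio ⊤ = ⋃ n : ℕ, {ω | hittingAfter X S 0 ω < (n : ℝ≥0)} := by
      ext ω
      simp only [mem_preimage, mem_Iio, mem_iUnion, mem_ofPred_eq]
      refine ⟨fun h => ?_, fun ⟨n, hn⟩ => hn.trans_le le_top⟩
      obtain ⟨a, ha⟩ := WithTop.ne_top_iff_exists.1 h.ne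
      obtain ⟨n, hn⟩ := exists_nat_gt a
      exact ⟨n, by rw [← ha]; exact_mod_cast hn⟩
    rw [this]
    exact MeasurableSet.iUnion fun n => key n

/-- If the path is not in `S` at the infimum, it visits `S` at times decreasing to it, and
right-continuity applies. -/
lemma hittingAfter_mem_closure {X : ℝ≥0 → Ω → β} {S : Set β} {ω : Ω}
    (hX : ∀ t, Tendsto (fun u => X u ω) (𝓝[>] t) (𝓝 (X t ω))) {a : ℝ≥0}
    (h : hittingAfter X S 0 ω = a) : X a ω ∈ closure S := by
  by_cases haS : X a ω ∈ S
  · exact subset_closure haS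
  rw [mem_closure_iff_frequently]
  refine (hX a).frequently ?_
  rw [frequently_iff]
  intro U hU
  obtain ⟨c, hc, hcU⟩ := (mem_nhdsGT_iff_exists_Ioo_subset' (lt_add_one a)).1 hU
  obtain ⟨j, hj, hjS⟩ := (hittingAfter_lt_iff (u := X) (s := S) (n := 0) (ω := ω) (i := c)).1
    (by rw [h]; exact_mod_cast hc)
  have haj : a ≤ j := by
    have := hittingAfter_le_of_mem (u := X) (s := S) (n := 0) (ω := ω) (i := j) zero_le hjS
    rw [h] at this
    exact_mod_cast this
  refine ⟨j, hcU ⟨haj.lt_of_ne fun e => haS (e ▸ hjS), hj.2⟩, hjS⟩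

omit [TopologicalSpace β] in
lemma hittingAfter_eq_add {X : ℝ≥0 → Ω → β} {S : Set β} {ω : Ω} {t : ℝ≥0}
    (h : (t : WithTop ℝ≥0) ≤ hittingAfter X S 0 ω) :
    hittingAfter X S 0 ω = t + hittingAfter (fun u ω => X (t + u) ω) S 0 ω := by
  have hle : ∀ j, X j ω ∈ S → t ≤ j := fun j hj => by
    exact_mod_cast h.trans (hittingAfter_le_of_mem zero_le hj)
  refine WithTop.eq_of_forall_coe_lt_iff fun i => ?_
  have : (t + hittingAfter (fun u ω => X (t + u) ω) S 0 ω < i) ↔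
      ∃ j ∈ Ico 0 (i - t), X (t + j) ω ∈ S := by
    rw [← hittingAfter_lt_iff (u := fun u ω => X (t + u) ω)]
    cases hittingAfter (fun u ω => X (t + u) ω) S 0 ω with
    | top =>
      refine iff_of_false (not_lt_of_ge ?_) ?_
      · rw [WithTop.add_top]
        exact le_top
      · simp
    | coe a =>
      norm_cast
      rw [lt_tsub_iff_left]
  rw [this, hittingAfter_lt_iff]
  constructor
  · rintro ⟨j, hj, hjS⟩
    refine ⟨j - t, ⟨zero_le, ?_⟩, by rwa [add_tsub_cancel_of_le (hle j hjS)]⟩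
    exact tsub_lt_tsub_right_of_le (hle j hjS) hj.2
  · rintro ⟨j, hj, hjS⟩
    exact ⟨t + j, ⟨zero_le, by rw [← lt_tsub_iff_left]; exact hj.2⟩, hjS⟩

end Hitting

end

noncomputable section

/-! ### The space of right-continuous paths -/

/-- Right-continuous paths in `E`. -/
def RCPath (E : Type*) [TopologicalSpace E] : Type _ :=
  {p : ℝ≥0 → E // ∀ t, Tendsto p (𝓝[>] t) (𝓝 (p t))}

namespace RCPath

section Basic

variable {E : Type*} [TopologicalSpace E]

instance : CoeFun (RCPath E) fun _ => ℝ≥0 → E := ⟨Subtype.val⟩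

instance [MeasurableSpace E] : MeasurableSpace (RCPath E) :=
  inferInstanceAs (MeasurableSpace {p : ℝ≥0 → E // ∀ t, Tendsto p (𝓝[>] t) (𝓝 (p t))})

lemma rightContinuous (p : RCPath E) (t : ℝ≥0) : Tendsto (fun u => p u) (𝓝[>] t) (𝓝 (p t)) :=
  p.2 t

/-- The path `u ↦ p (t + u)`. -/
def shift (t : ℝ≥0) (p : RCPath E) : RCPath E :=
  ⟨fun u => p (t + u), fun u => (p.2 (t + u)).comp (tendsto_nhdsWithin_iff.2
    ⟨((continuous_const.add continuous_id).tendsto u).mono_left nhdsWithin_le_nhds,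
      eventually_nhdsWithin_of_forall fun _ h => by simpa using h⟩)⟩

@[simp] lemma shift_apply (t u : ℝ≥0) (p : RCPath E) : shift t p u = p (t + u) := rfl

lemma shift_shift (s t : ℝ≥0) (p : RCPath E) : shift t (shift s p) = shift (s + t) p :=
  Subtype.ext (funext fun u => by simp [add_assoc])

lemma shift_zero (p : RCPath E) : shift 0 p = p :=
  Subtype.ext (funext fun u => by simp)

lemma measurable_eval [MeasurableSpace E] (t : ℝ≥0) : Measurable fun p : RCPath E => p t :=
  (measurable_pi_apply t).comp measurable_subtype_coe

lemma measurable_mk [MeasurableSpace E] {A : Type*} [MeasurableSpace A] {φ : A → RCPath E}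
    (h : ∀ t, Measurable fun a => φ a t) : Measurable φ :=
  Measurable.subtype_mk (measurable_pi_lambda _ h)

lemma measurable_apply [TopologicalSpace.PseudoMetrizableSpace E] [MeasurableSpace E]
    [BorelSpace E] {A : Type*} [MeasurableSpace A] {φ : A → RCPath E} (hφ : Measurable φ)
    {u : A → ℝ≥0} (hu : Measurable u) : Measurable fun a => φ a (u a) :=
  measurable_comp_of_rightContinuous (X := fun t a => φ a t) (fun a t => (φ a).2 t)
    (fun t => (measurable_eval t).comp hφ) hu

lemma measurable_shift [TopologicalSpace.PseudoMetrizableSpace E] [MeasurableSpace E]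
    [BorelSpace E] {A : Type*} [MeasurableSpace A] {φ : A → RCPath E} (hφ : Measurable φ)
    {u : A → ℝ≥0} (hu : Measurable u) : Measurable fun a => shift (u a) (φ a) :=
  measurable_mk fun t => measurable_apply hφ (hu.add_const t)

end Basic

section Exit

variable {E : Type*} [MetricSpace E]

/-- The first time at which `p` comes within distance `1 / (n + 1)` of the complement of `O`. -/
def approachTime (O : Set E) (n : ℕ) (p : RCPath E) : WithTop ℝ≥0 :=
  hittingAfter (fun t (p : RCPath E) => p t) (Metric.thickening (1 / (n + 1)) Oᶜ) 0 p

/-- The first time at which `p` comes arbitrarily close to the complement of `O`; it is a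
measurable version of the exit time. -/
def exitTime (O : Set E) (p : RCPath E) : WithTop ℝ≥0 := ⨆ n, approachTime O n p

lemma approachTime_mono (O : Set E) (p : RCPath E) : Monotone fun n => approachTime O n p :=
  fun _ _ h => hittingAfter_anti (fun t (p : RCPath E) => p t) 0
    (Metric.thickening_mono (Nat.one_div_le_one_div h) _) p

lemma exitTime_le (O : Set E) (p : RCPath E) :
    exitTime O p ≤ hittingAfter (fun t (p : RCPath E) => p t) Oᶜ 0 p :=
  iSup_le fun _ => hittingAfter_anti (fun t (p : RCPath E) => p t) 0
    (Metric.self_subset_thickening Nat.one_div_pos_of_nat _) p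

lemma mem_of_lt_exitTime {O : Set E} {p : RCPath E} {u : ℝ≥0} (h : u < exitTime O p) :
    p u ∈ O := by
  by_contra hu
  exact notMem_of_lt_hittingAfter (u := fun t (p : RCPath E) => p t) (h.trans_le (exitTime_le O p))
    zero_le hu

lemma exitTime_eq_zero {O : Set E} {p : RCPath E} (h : p 0 ∉ O) : exitTime O p = 0 :=
  le_antisymm ((exitTime_le O p).trans
    (hittingAfter_le_of_mem (u := fun t (p : RCPath E) => p t) le_rfl h)) zero_le

lemma approachTime_shift {O : Set E} {n : ℕ} {p : RCPath E} {t : ℝ≥0}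
    (h : t ≤ approachTime O n p) : approachTime O n p = t + approachTime O n (shift t p) :=
  hittingAfter_eq_add h

/-- Additivity is inherited from the approach times. Strictness matters: it puts `t` below some
approach time, and hence below all later ones. -/
lemma exitTime_eq_add {O : Set E} {p : RCPath E} {t : ℝ≥0} (h : t < exitTime O p) :
    exitTime O p = t + exitTime O (shift t p) := by
  obtain ⟨N, hN⟩ := lt_iSup_iff.1 h
  have key : ∀ n, approachTime O (max n N) p = t + approachTime O (max n N) (shift t p) :=
    fun n => approachTime_shift (hN.le.trans (approachTime_mono O p (le_max_right n N)))
  refine le_antisymm (iSup_le fun n => ?_) ?_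
  · refine (approachTime_mono O p (le_max_left n N)).trans ?_
    refine (key n).le.trans ?_
    gcongr
    exact le_iSup (fun n => approachTime O n (shift t p)) _
  · rcases eq_or_ne (exitTime O p) ⊤ with h1 | h1
    · rw [h1]; exact le_top
    lift exitTime O p to ℝ≥0 using h1 with a ha
    have h2 : exitTime O (shift t p) ≤ ((a - t : ℝ≥0) : WithTop ℝ≥0) := by
      refine iSup_le fun n => (approachTime_mono O _ (le_max_left n N)).trans ?_
      have h3 : approachTime O (max n N) p ≤ a := ha ▸ le_iSup (fun n => approachTime O n p) _
      rw [key n] at h3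
      cases hx : approachTime O (max n N) (shift t p) with
      | top =>
        rw [hx, WithTop.add_top] at h3
        exact absurd h3 (not_le.2 (WithTop.coe_lt_top a))
      | coe b =>
        rw [hx] at h3
        change approachTime O (max n N) (shift t p) ≤ _
        rw [hx]
        norm_cast at h3 ⊢
        exact le_tsub_of_add_le_left h3
    have hta : t ≤ a := by exact_mod_cast h.le
    calc (t : WithTop ℝ≥0) + exitTime O (shift t p) ≤ t + ((a - t : ℝ≥0) : WithTop ℝ≥0) := by gcongr
      _ = a := by norm_cast; exact add_tsub_cancel_of_le hta

lemma measurable_approachTime [MeasurableSpace E] [BorelSpace E] (O : Set E) (n : ℕ) :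
    Measurable (approachTime O n) :=
  measurable_hittingAfter_of_isOpen Metric.isOpen_thickening (fun p t => p.2 t)
    fun t => measurable_eval t Metric.isOpen_thickening.measurableSet

lemma measurable_exitTime [MeasurableSpace E] [BorelSpace E] (O : Set E) :
    Measurable (exitTime O) :=
  Measurable.iSup fun n => measurable_approachTime O n

lemma exitTime_univ (p : RCPath E) : exitTime univ p = ⊤ := by
  refine top_le_iff.1 ((le_iSup (fun n => approachTime univ n p) 0).trans' ?_)
  simp [approachTime, hittingAfter_empty]

lemma exitTime_mono {O U : Set E} (h : U ⊆ O) (p : RCPath E) : exitTime U p ≤ exitTime O p :=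
  iSup_mono fun _ => hittingAfter_anti (fun t (p : RCPath E) => p t) 0
    (Metric.thickening_subset_of_subset _ (compl_subset_compl.2 h)) p

/-- For a short time the path stays within `r / 2` of its start, hence at distance at least `r / 2`
from the complement, which excludes approach at any scale below `r / 2`. -/
lemma exitTime_pos {O : Set E} (hO : IsOpen O) {p : RCPath E} (h : p 0 ∈ O) :
    0 < exitTime O p := by
  obtain ⟨r, hr, hrO⟩ := Metric.isOpen_iff.1 hO _ h
  obtain ⟨n, hn⟩ := exists_nat_one_div_lt (half_pos hr)
  refine lt_of_lt_of_le ?_ (le_iSup (fun n => approachTime O n p) n)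
  have h1 : ∀ᶠ u in 𝓝[>] (0 : ℝ≥0), p u ∈ Metric.ball (p 0) (r / 2) :=
    (p.2 0).eventually (Metric.ball_mem_nhds _ (half_pos hr))
  obtain ⟨c, hc, hcU⟩ := (mem_nhdsGT_iff_exists_Ioo_subset' (zero_lt_one' ℝ≥0)).1 h1
  refine lt_of_lt_of_le (b := (c : WithTop ℝ≥0)) (by exact_mod_cast hc) (not_lt.1 fun hlt => ?_)
  obtain ⟨j, hj, hjS⟩ := (hittingAfter_lt_iff (u := fun t (p : RCPath E) => p t)).1 hlt
  obtain ⟨z, hz, hdz⟩ := Metric.mem_thickening_iff.1 hjS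
  have hpj : dist (p j) (p 0) < r / 2 := by
    rcases eq_zero_or_pos j with rfl | h0
    · simpa using half_pos hr
    · exact hcU ⟨h0, hj.2⟩
  refine hz (hrO ?_)
  rw [Metric.mem_ball]
  have := dist_triangle z (p j) (p 0)
  rw [dist_comm] at hdz
  push_cast at *
  linarith

end Exit

end RCPath

namespace StandardMarkovProcess

variable {E Ω : Type*} [MetricSpace E] [MeasurableSpace E] [MeasurableSpace Ω]

instance (M : StandardMarkovProcess E Ω) (x : E) : IsProbabilityMeasure (M.P x) :=
  M.isProbabilityMeasure x

instance (M : StandardMarkovProcess E Ω) : M.filtration.IsRightContinuous :=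
  M.rightContinuous_filtration

/-- The path of the process. -/
def path (M : StandardMarkovProcess E Ω) (ω : Ω) : RCPath E :=
  ⟨fun t => M.X t ω, M.right_continuous ω⟩

@[simp] lemma path_apply (M : StandardMarkovProcess E Ω) (ω : Ω) (t : ℝ≥0) :
    M.path ω t = M.X t ω := rfl

lemma measurable_path (M : StandardMarkovProcess E Ω) : Measurable M.path :=
  RCPath.measurable_mk fun t => (M.adapted t).mono (M.filtration.le t) le_rfl

variable [BorelSpace E]

lemma isStoppingTime_approachTime (M : StandardMarkovProcess E Ω) (O : Set E) (n : ℕ) :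
    IsStoppingTime M.filtration fun ω => RCPath.approachTime O n (M.path ω) :=
  isStoppingTime_hittingAfter_of_isOpen Metric.isOpen_thickening M.right_continuous
    fun t => M.adapted t Metric.isOpen_thickening.measurableSet

lemma isStoppingTime_pathExitTime (M : StandardMarkovProcess E Ω) (O : Set E) :
    IsStoppingTime M.filtration fun ω => RCPath.exitTime O (M.path ω) := by
  intro i
  have : {ω | RCPath.exitTime O (M.path ω) ≤ i} =
      ⋂ n, {ω | RCPath.approachTime O n (M.path ω) ≤ i} := by
    ext ω
    simp only [RCPath.exitTime, mem_ofPred_eq, mem_iInter]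
    exact iSup_le_iff
  rw [this]
  exact MeasurableSet.iInter fun n => M.isStoppingTime_approachTime O n i

/-- At the n-th approach time the path is within `1 / (n + 1)` of the complement. By
quasi-left-continuity these positions converge to the position at the supremum, which therefore lies
in the closed complement. -/
lemma ae_notMem_pathExitTime (M : StandardMarkovProcess E Ω) {O : Set E} (hO : IsOpen O) (x : E) :
    ∀ᵐ ω ∂(M.P x), RCPath.exitTime O (M.path ω) ≠ ⊤ →
      M.X ((RCPath.exitTime O (M.path ω)).untopD 0) ω ∉ O := by
  filter_upwards [M.quasi_left_continuous (fun n ω => RCPath.approachTime O n (M.path ω))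
    (fun ω => RCPath.exitTime O (M.path ω)) (M.isStoppingTime_approachTime O)
    (fun ω => RCPath.approachTime_mono O _) (fun ω => isLUB_iSup) x] with ω hω hne
  have h1 := hω hne
  have h2 : ∀ n : ℕ, Metric.infEDist (M.X ((RCPath.approachTime O n (M.path ω)).untopD 0) ω) Oᶜ ≤
      ENNReal.ofReal (1 / (n + 1)) := fun n => by
    have hne' : RCPath.approachTime O n (M.path ω) ≠ ⊤ :=
      ne_top_of_le_ne_top hne (le_iSup (fun n => RCPath.approachTime O n (M.path ω)) n)
    obtain ⟨a, ha⟩ := WithTop.ne_top_iff_exists.1 hne'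
    rw [← ha]
    exact Metric.closure_thickening_subset_cthickening _ _
      (hittingAfter_mem_closure (X := M.X) (M.right_continuous ω) ha.symm)
  have h3 : Metric.infEDist (M.X ((RCPath.exitTime O (M.path ω)).untopD 0) ω) Oᶜ ≤ 0 := by
    refine le_of_tendsto_of_tendsto' ((Metric.continuous_infEDist.tendsto _).comp h1) ?_ h2
    have := ENNReal.tendsto_ofReal (tendsto_one_div_add_atTop_nhds_zero_nat (𝕜 := ℝ))
    simpa using this
  have h4 := Metric.mem_closure_iff_infEDist_zero.2 (nonpos_iff_eq_zero.1 h3)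
  rwa [hO.isClosed_compl.closure_eq] at h4

lemma ae_exitTime_eq (M : StandardMarkovProcess E Ω) {O : Set E} (hO : IsOpen O) (x : E) :
    ∀ᵐ ω ∂(M.P x), M.exitTime O ω = RCPath.exitTime O (M.path ω) := by
  filter_upwards [M.ae_notMem_pathExitTime hO x] with ω hω
  refine le_antisymm ?_ (RCPath.exitTime_le O (M.path ω))
  rcases eq_or_ne (RCPath.exitTime O (M.path ω)) ⊤ with h | h
  · rw [h]; exact le_top
  have h1 := hω h
  obtain ⟨a, ha⟩ := WithTop.ne_top_iff_exists.1 h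
  rw [← ha] at h1 ⊢
  exact hittingAfter_le_of_mem (u := M.X) zero_le h1

end StandardMarkovProcess

end

noncomputable section

/-! ### The strong Markov property on path space -/

namespace RCPath

variable {E : Type*} [MetricSpace E]

/-- The set of paths which are in `B₁` at time `d₁`, in `B₂` at time `d₁ + d₂`, and so on, for the
list `(d₁, B₁), (d₂, B₂), …`. -/
def cylinder : List (ℝ≥0 × Set E) → Set (RCPath E)
  | [] => univ
  | q :: l => {p | p q.1 ∈ q.2 ∧ shift q.1 p ∈ cylinder l}

/-- The measurable cylinders. -/
def cylinders (E : Type*) [MetricSpace E] [MeasurableSpace E] : Set (Set (RCPath E)) :=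
  {s | ∃ l : List (ℝ≥0 × Set E), (∀ q ∈ l, MeasurableSet q.2) ∧ cylinder l = s}

variable [MeasurableSpace E]

lemma measurableSet_cylinder {l : List (ℝ≥0 × Set E)} (hl : ∀ q ∈ l, MeasurableSet q.2) :
    MeasurableSet (cylinder l) := by
  induction l with
  | nil => exact MeasurableSet.univ
  | cons q l ih =>
    refine (measurable_eval q.1 (hl q (by simp))).inter ?_
    exact (measurable_mk (φ := shift q.1) fun t => measurable_eval (q.1 + t))
      (ih fun q hq => hl q (by simp [hq]))

/-- Merge the two lists in order of time, by induction on their total length. Times are stored as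
successive increments, so using the earlier head reduces the other head's increment. -/
lemma exists_cylinder_inter (n : ℕ) : ∀ l₁ l₂ : List (ℝ≥0 × Set E),
    l₁.length + l₂.length ≤ n → (∀ q ∈ l₁, MeasurableSet q.2) → (∀ q ∈ l₂, MeasurableSet q.2) →
    ∃ l, (∀ q ∈ l, MeasurableSet q.2) ∧ cylinder l = cylinder l₁ ∩ cylinder l₂ := by
  induction n with
  | zero =>
    intro l₁ l₂ h h₁ h₂
    obtain rfl : l₁ = [] := List.length_eq_zero_iff.1 (by omega)
    exact ⟨l₂, h₂, by simp [cylinder]⟩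
  | succ n ih =>
    have main : ∀ (q₁ q₂ : ℝ≥0 × Set E) (l₁ l₂ : List (ℝ≥0 × Set E)), q₁.1 ≤ q₂.1 →
        l₁.length + l₂.length + 2 ≤ n + 1 → (∀ q ∈ q₁ :: l₁, MeasurableSet q.2) →
        (∀ q ∈ q₂ :: l₂, MeasurableSet q.2) →
        ∃ l, (∀ q ∈ l, MeasurableSet q.2) ∧
          cylinder l = cylinder (q₁ :: l₁) ∩ cylinder (q₂ :: l₂) := by
      intro q₁ q₂ l₁ l₂ hq h h₁ h₂
      obtain ⟨l, hl, hl'⟩ := ih l₁ ((q₂.1 - q₁.1, q₂.2) :: l₂) (by simp; omega)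
        (fun q hq => h₁ q (by simp [hq])) (fun q hq => by
          rcases List.mem_cons.1 hq with rfl | hq
          · exact h₂ q₂ (by simp)
          · exact h₂ q (by simp [hq]))
      refine ⟨q₁ :: l, fun q hq => ?_, ?_⟩
      · rcases List.mem_cons.1 hq with rfl | hq
        · exact h₁ q (by simp)
        · exact hl q hq
      · ext p
        simp only [cylinder, hl', mem_ofPred_eq, mem_inter_iff, shift_apply, shift_shift,
          add_tsub_cancel_of_le hq]
        tauto
    intro l₁ l₂ h h₁ h₂
    match l₁, l₂ with
    | [], l₂ => exact ⟨l₂, h₂, by simp [cylinder]⟩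
    | q₁ :: l₁, [] => exact ⟨q₁ :: l₁, h₁, by simp [cylinder]⟩
    | q₁ :: l₁, q₂ :: l₂ =>
      simp only [List.length_cons] at h
      rcases le_total q₁.1 q₂.1 with hq | hq
      · exact main q₁ q₂ l₁ l₂ hq (by omega) h₁ h₂
      · obtain ⟨l, hl, hl'⟩ := main q₂ q₁ l₂ l₁ hq (by omega) h₂ h₁
        exact ⟨l, hl, by rw [hl', inter_comm]⟩

lemma isPiSystem_cylinders : IsPiSystem (cylinders E) := by
  rintro _ ⟨l₁, h₁, rfl⟩ _ ⟨l₂, h₂, rfl⟩ -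
  exact exists_cylinder_inter _ l₁ l₂ le_rfl h₁ h₂

lemma generateFrom_cylinders :
    (inferInstance : MeasurableSpace (RCPath E)) = MeasurableSpace.generateFrom (cylinders E) := by
  refine le_antisymm ?_ (MeasurableSpace.generateFrom_le ?_)
  · have h : @Measurable (RCPath E) (ℝ≥0 → E) (MeasurableSpace.generateFrom (cylinders E))
        MeasurableSpace.pi Subtype.val := ?_
    · exact measurable_iff_comap_le.1 h
    let _ : MeasurableSpace (RCPath E) := MeasurableSpace.generateFrom (cylinders E)
    refine measurable_pi_lambda _ fun t B hB => ?_
    refine MeasurableSpace.measurableSet_generateFrom ⟨[(t, B)], by simpa using hB, ?_⟩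
    ext p
    simp [cylinder]
  · rintro _ ⟨l, hl, rfl⟩
    exact measurableSet_cylinder hl

end RCPath

namespace MeasureTheory.IsStoppingTime

lemma add_nnreal {Ω : Type*} {mΩ : MeasurableSpace Ω} {f : Filtration ℝ≥0 mΩ}
    {τ : Ω → WithTop ℝ≥0} (hτ : IsStoppingTime f τ) (d : ℝ≥0) :
    IsStoppingTime f fun ω => τ ω + d := by
  intro i
  by_cases h : d ≤ i
  · have : {ω | τ ω + d ≤ i} = {ω | τ ω ≤ ((i - d : ℝ≥0) : WithTop ℝ≥0)} := by
      ext ω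
      simp only [mem_ofPred_eq]
      cases τ ω with
      | top =>
        rw [WithTop.top_add]
        exact iff_of_false (not_le.2 (WithTop.coe_lt_top _)) (not_le.2 (WithTop.coe_lt_top _))
      | coe a =>
        norm_cast
        rw [le_tsub_iff_right h]
    rw [this]
    exact f.mono tsub_le_self _ (hτ (i - d))
  · have : {ω | τ ω + d ≤ i} = ∅ := by
      ext ω
      simp only [mem_ofPred_eq, mem_empty_iff_false, iff_false]
      cases τ ω with
      | top => rw [WithTop.top_add]; exact not_le.2 (WithTop.coe_lt_top _)
      | coe a =>
        norm_cast
        exact fun h' => h (le_of_add_le_right h')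
    rw [this]
    exact MeasurableSpace.measurableSet_empty _

end MeasureTheory.IsStoppingTime

namespace StandardMarkovProcess

variable {E Ω : Type*} [MetricSpace E] [SecondCountableTopology E] [MeasurableSpace E]
  [BorelSpace E] [mΩ : MeasurableSpace Ω] (M : StandardMarkovProcess E Ω)

omit [SecondCountableTopology E] [BorelSpace E] in
lemma measurable_X (t : ℝ≥0) : Measurable (M.X t) :=
  (M.adapted t).mono (M.filtration.le t) le_rfl

omit [SecondCountableTopology E] in
lemma measurable_X_comp {u : Ω → ℝ≥0} (hu : Measurable u) : Measurable fun ω => M.X (u ω) ω :=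
  RCPath.measurable_apply M.measurable_path hu

/-- The transition kernel at time `t`. -/
def transition (t : ℝ≥0) : Kernel E E where
  toFun x := (M.P x).map (M.X t)
  measurable' := Measure.measurable_of_measurable_coe _ fun B hB => by
    simp_rw [Measure.map_apply (M.measurable_X t) hB]
    exact M.measurable_transition t B hB

omit [SecondCountableTopology E] [BorelSpace E] in
lemma transition_apply (t : ℝ≥0) (x : E) : M.transition t x = (M.P x).map (M.X t) := rfl

omit [SecondCountableTopology E] in
lemma map_restrict_eq_bind_transition {τ : Ω → WithTop ℝ≥0} (hτ : IsStoppingTime M.filtration τ)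
    (x : E) (t : ℝ≥0) {A : Set Ω} (hA : MeasurableSet[hτ.measurableSpace] A) :
    ((M.P x).restrict (A ∩ {ω | τ ω ≠ ⊤})).map (fun ω => M.X ((τ ω).untopD 0 + t) ω) =
      (((M.P x).restrict (A ∩ {ω | τ ω ≠ ⊤})).map fun ω => M.X ((τ ω).untopD 0) ω).bind
        (M.transition t) := by
  have hu : Measurable fun ω => (τ ω).untopD 0 := hτ.measurable'.untopD 0
  ext B hB
  rw [Measure.map_apply (M.measurable_X_comp (hu.add_const t)) hB,
    Measure.bind_apply hB (M.transition t).measurable.aemeasurable,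
    lintegral_map ((M.transition t).measurable_coe hB) (M.measurable_X_comp hu),
    Measure.restrict_apply (M.measurable_X_comp (hu.add_const t) hB), inter_comm]
  refine (M.strong_markov τ hτ x t A B hA hB).trans (lintegral_congr fun ω => ?_)
  rw [transition_apply, Measure.map_apply (M.measurable_X t) hB]
  rfl

omit [SecondCountableTopology E] in
lemma setLIntegral_comp_add {τ : Ω → WithTop ℝ≥0} (hτ : IsStoppingTime M.filtration τ)
    (x : E) (t : ℝ≥0) {A : Set Ω} (hA : MeasurableSet[hτ.measurableSpace] A) {g : E → ℝ≥0∞}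
    (hg : Measurable g) :
    ∫⁻ ω in A ∩ {ω | τ ω ≠ ⊤}, g (M.X ((τ ω).untopD 0 + t) ω) ∂(M.P x) =
      ∫⁻ ω in A ∩ {ω | τ ω ≠ ⊤}, ∫⁻ y, g y ∂(M.transition t (M.X ((τ ω).untopD 0) ω)) ∂(M.P x) := by
  have hu : Measurable fun ω => (τ ω).untopD 0 := hτ.measurable'.untopD 0
  rw [← lintegral_map hg (M.measurable_X_comp (hu.add_const t)),
    M.map_restrict_eq_bind_transition hτ x t hA,
    Measure.lintegral_bind (M.transition t).measurable.aemeasurable hg.aemeasurable,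
    lintegral_map hg.lintegral_kernel (M.measurable_X_comp hu)]

/-- This makes the event `X(τ + d) ∈ B` admissible as a conditioning event at the stopping time `τ +
d`, which is what the induction over cylinders needs. -/
lemma measurableSet_stopped {τ : Ω → WithTop ℝ≥0} (hτ : IsStoppingTime M.filtration τ)
    (d : ℝ≥0) {A : Set Ω} (hA : MeasurableSet[hτ.measurableSpace] A) {B : Set E}
    (hB : MeasurableSet B) : MeasurableSet[(hτ.add_nnreal d).measurableSpace]
      (A ∩ {ω | τ ω ≠ ⊤} ∩ {ω | M.X ((τ ω).untopD 0 + d) ω ∈ B}) := by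
  have h1 : hτ.measurableSpace ≤ (hτ.add_nnreal d).measurableSpace :=
    hτ.measurableSpace_mono _ fun ω => le_self_add
  have h2 : MeasurableSet[hτ.measurableSpace] {ω | τ ω ≠ ⊤} :=
    (hτ.measurable (measurableSet_singleton ⊤)).compl
  have h3 : Measurable[(hτ.add_nnreal d).measurableSpace] (stoppedValue M.X fun ω => τ ω + d) :=
    measurable_stoppedValue (isStronglyProgressive_of_rightContinuous M.right_continuous M.adapted)
      (hτ.add_nnreal d)
  convert! ((h1 _ hA).inter (h1 _ h2)).inter (h3 hB) using 1
  ext ω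
  simp only [mem_inter_iff, mem_ofPred_eq, mem_preimage, stoppedValue, and_congr_right_iff]
  rintro ⟨-, h⟩
  obtain ⟨a, ha⟩ := WithTop.ne_top_iff_exists.1 h
  rw [← ha]
  rfl

/-- Induction on the list: the tail is handled by the hypothesis at the stopping time `τ + d`, and
the one-time strong Markov property then moves the result from `τ + d` back to `τ`. Measurability in
the starting point is carried along because this last move integrates the tail probability against
the transition kernel. -/
lemma shift_mem_cylinder (l : List (ℝ≥0 × Set E)) (hl : ∀ q ∈ l, MeasurableSet q.2) :
    (Measurable fun y => M.P y {ω | M.path ω ∈ RCPath.cylinder l}) ∧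
    ∀ (τ : Ω → WithTop ℝ≥0) (hτ : IsStoppingTime M.filtration τ) (x : E) (A : Set Ω),
      MeasurableSet[hτ.measurableSpace] A →
      M.P x (A ∩ {ω | τ ω ≠ ⊤} ∩
          {ω | RCPath.shift ((τ ω).untopD 0) (M.path ω) ∈ RCPath.cylinder l}) =
        ∫⁻ ω in A ∩ {ω | τ ω ≠ ⊤},
          M.P (M.X ((τ ω).untopD 0) ω) {ω' | M.path ω' ∈ RCPath.cylinder l} ∂(M.P x) := by
  induction l with
  | nil => simp [RCPath.cylinder]
  | cons q l ih =>
    obtain ⟨d, B⟩ := q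
    obtain ⟨ih1, ih2⟩ := ih fun q hq => hl q (by simp [hq])
    have hB : MeasurableSet B := hl (d, B) (by simp)
    set g : E → ℝ≥0∞ := B.indicator fun y => M.P y {ω | M.path ω ∈ RCPath.cylinder l} with hg
    have hgm : Measurable g := ih1.indicator hB
    have step : ∀ (τ : Ω → WithTop ℝ≥0) (hτ : IsStoppingTime M.filtration τ) (x : E) (A : Set Ω),
        MeasurableSet[hτ.measurableSpace] A →
        M.P x (A ∩ {ω | τ ω ≠ ⊤} ∩
          {ω | RCPath.shift ((τ ω).untopD 0) (M.path ω) ∈ RCPath.cylinder ((d, B) :: l)}) =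
        ∫⁻ ω in A ∩ {ω | τ ω ≠ ⊤}, g (M.X ((τ ω).untopD 0 + d) ω) ∂(M.P x) := by
      intro τ hτ x A hA
      have hu : Measurable fun ω => (τ ω).untopD 0 := hτ.measurable'.untopD 0
      have htop : ∀ ω, τ ω ≠ ⊤ → τ ω + d ≠ ⊤ ∧ (τ ω + d).untopD 0 = (τ ω).untopD 0 + d := by
        intro ω h
        obtain ⟨a, ha⟩ := WithTop.ne_top_iff_exists.1 h
        rw [← ha]
        exact ⟨WithTop.coe_ne_top (a := a + d), rfl⟩
      have h1 := ih2 _ (hτ.add_nnreal d) x _ (M.measurableSet_stopped hτ d hA hB)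
      have h2 : A ∩ {ω | τ ω ≠ ⊤} ∩ {ω | M.X ((τ ω).untopD 0 + d) ω ∈ B} ∩ {ω | τ ω + d ≠ ⊤} =
          A ∩ {ω | τ ω ≠ ⊤} ∩ {ω | M.X ((τ ω).untopD 0 + d) ω ∈ B} := by
        refine inter_eq_left.2 fun ω hω => (htop ω hω.1.2).1
      rw [h2] at h1
      have h3 : A ∩ {ω | τ ω ≠ ⊤} ∩
          {ω | RCPath.shift ((τ ω).untopD 0) (M.path ω) ∈ RCPath.cylinder ((d, B) :: l)} =
          A ∩ {ω | τ ω ≠ ⊤} ∩ {ω | M.X ((τ ω).untopD 0 + d) ω ∈ B} ∩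
          {ω | RCPath.shift ((τ ω + d).untopD 0) (M.path ω) ∈ RCPath.cylinder l} := by
        ext ω
        simp only [mem_inter_iff, mem_ofPred_eq, RCPath.cylinder, RCPath.shift_apply, path_apply,
          RCPath.shift_shift, and_assoc]
        refine and_congr_right fun _ => and_congr_right fun h => ?_
        rw [(htop ω h).2]
      have hBm : MeasurableSet {ω | M.X ((τ ω).untopD 0 + d) ω ∈ B} :=
        M.measurable_X_comp (hu.add_const d) hB
      rw [h3, h1, inter_comm (A ∩ {ω | τ ω ≠ ⊤}), ← Measure.restrict_restrict hBm,
        ← lintegral_indicator hBm]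
      have hms : MeasurableSet (A ∩ {ω | τ ω ≠ ⊤}) :=
        (hτ.measurableSpace_le _ hA).inter hτ.measurableSet_eq_top.compl
      refine setLIntegral_congr_fun hms fun ω hω => ?_
      by_cases hX : M.X ((τ ω).untopD 0 + d) ω ∈ B
      · rw [indicator_of_mem (show ω ∈ {ω | M.X ((τ ω).untopD 0 + d) ω ∈ B} from hX), hg,
          indicator_of_mem hX, (htop ω hω.2).2]
      · rw [indicator_of_notMem (show ω ∉ {ω | M.X ((τ ω).untopD 0 + d) ω ∈ B} from hX), hg,
          indicator_of_notMem hX]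
    -- The formula of `step` at the constant stopping time 0 computes the cylinder probability under
    -- `P y`.
    have hQ : ∀ y, M.P y {ω | M.path ω ∈ RCPath.cylinder ((d, B) :: l)} =
        ∫⁻ z, g z ∂(M.transition d y) := by
      intro y
      have h1 := step (fun _ => ((0 : ℝ≥0) : WithTop ℝ≥0)) (isStoppingTime_const _ 0) y univ
        MeasurableSet.univ
      simp only [univ_inter, WithTop.untopD_coe, RCPath.shift_zero, zero_add] at h1
      rw [transition_apply, lintegral_map hgm (M.measurable_X d)]
      simpa using h1
    refine ⟨?_, fun τ hτ x A hA => ?_⟩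
    · simp_rw [hQ]
      exact hgm.lintegral_kernel
    · simp_rw [hQ]
      rw [step τ hτ x A hA, M.setLIntegral_comp_add hτ x d hA hgm]

/-- The law of the path of the process, as a kernel in the starting point. -/
def pathLaw : Kernel E (RCPath E) where
  toFun x := (M.P x).map M.path
  measurable' := by
    have : ∀ x, IsProbabilityMeasure ((M.P x).map M.path) := fun x =>
      Measure.isProbabilityMeasure_map M.measurable_path.aemeasurable
    refine Measurable.measure_of_isPiSystem_of_isProbabilityMeasure
      RCPath.generateFrom_cylinders RCPath.isPiSystem_cylinders ?_
    rintro _ ⟨l, hl, rfl⟩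
    simp_rw [Measure.map_apply M.measurable_path (RCPath.measurableSet_cylinder hl)]
    exact (M.shift_mem_cylinder l hl).1

lemma pathLaw_apply (x : E) : M.pathLaw x = (M.P x).map M.path := rfl

instance : IsMarkovKernel M.pathLaw :=
  ⟨fun _ => Measure.isProbabilityMeasure_map M.measurable_path.aemeasurable⟩

lemma map_shift_eq_bind {τ : Ω → WithTop ℝ≥0} (hτ : IsStoppingTime M.filtration τ)
    (x : E) {A : Set Ω} (hA : MeasurableSet[hτ.measurableSpace] A) :
    ((M.P x).restrict (A ∩ {ω | τ ω ≠ ⊤})).map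
        (fun ω => RCPath.shift ((τ ω).untopD 0) (M.path ω)) =
      (((M.P x).restrict (A ∩ {ω | τ ω ≠ ⊤})).map fun ω => M.X ((τ ω).untopD 0) ω).bind
        M.pathLaw := by
  have hu : Measurable fun ω => (τ ω).untopD 0 := hτ.measurable'.untopD 0
  have hsh : Measurable fun ω => RCPath.shift ((τ ω).untopD 0) (M.path ω) :=
    RCPath.measurable_shift M.measurable_path hu
  have key : ∀ l : List (ℝ≥0 × Set E), (∀ q ∈ l, MeasurableSet q.2) →
      ((M.P x).restrict (A ∩ {ω | τ ω ≠ ⊤})).map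
        (fun ω => RCPath.shift ((τ ω).untopD 0) (M.path ω)) (RCPath.cylinder l) =
      (((M.P x).restrict (A ∩ {ω | τ ω ≠ ⊤})).map fun ω => M.X ((τ ω).untopD 0) ω).bind
        M.pathLaw (RCPath.cylinder l) := by
    intro l hl
    have hc := RCPath.measurableSet_cylinder hl
    rw [Measure.map_apply hsh hc, Measure.restrict_apply (hsh hc),
      Measure.bind_apply hc M.pathLaw.measurable.aemeasurable,
      lintegral_map (M.pathLaw.measurable_coe hc) (M.measurable_X_comp hu), inter_comm]
    refine ((M.shift_mem_cylinder l hl).2 τ hτ x A hA).trans (lintegral_congr fun ω => ?_)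
    rw [pathLaw_apply, Measure.map_apply M.measurable_path hc]
    rfl
  refine ext_of_generate_finite _ RCPath.generateFrom_cylinders RCPath.isPiSystem_cylinders ?_ ?_
  · rintro _ ⟨l, hl, rfl⟩
    exact key l hl
  -- The empty list is the whole path space, so it yields equality of total masses.
  · simpa [RCPath.cylinder] using key [] (by simp)

/-- For functionals that also depend on `τ`: a condition on the value of `τ` is an event of the
stopped σ-algebra and can be absorbed into `A`. -/
lemma map_shift_eq_compProd {τ : Ω → WithTop ℝ≥0} (hτ : IsStoppingTime M.filtration τ)
    (x : E) {A : Set Ω} (hA : MeasurableSet[hτ.measurableSpace] A) :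
    ((M.P x).restrict (A ∩ {ω | τ ω ≠ ⊤})).map
        (fun ω => ((τ ω).untopD 0, RCPath.shift ((τ ω).untopD 0) (M.path ω))) =
      (((M.P x).restrict (A ∩ {ω | τ ω ≠ ⊤})) ⊗ₘ
        (M.pathLaw.comap _ (M.measurable_X_comp (hτ.measurable'.untopD 0)))).map
        (fun q => ((τ q.1).untopD 0, q.2)) := by
  have hu : Measurable fun ω => (τ ω).untopD 0 := hτ.measurable'.untopD 0
  have hsh : Measurable fun ω => RCPath.shift ((τ ω).untopD 0) (M.path ω) :=
    RCPath.measurable_shift M.measurable_path hu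
  have hq : Measurable fun q : Ω × RCPath E => ((τ q.1).untopD 0, q.2) :=
    (hu.comp measurable_fst).prodMk measurable_snd
  refine Measure.ext_prod fun {C D} hC hD => ?_
  have hA' : MeasurableSet[hτ.measurableSpace] (A ∩ (fun ω => (τ ω).untopD 0) ⁻¹' C) :=
    hA.inter ((hτ.measurable.untopD 0) hC)
  have h1 := congrArg (fun μ => μ D) (M.map_shift_eq_bind hτ x hA')
  have h2 : A ∩ (fun ω => (τ ω).untopD 0) ⁻¹' C ∩ {ω | τ ω ≠ ⊤} =
      (fun ω => (τ ω).untopD 0) ⁻¹' C ∩ (A ∩ {ω | τ ω ≠ ⊤}) := by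
    ext; simp; tauto
  simp only [h2] at h1
  rw [Measure.map_apply hsh hD, Measure.bind_apply hD M.pathLaw.measurable.aemeasurable,
    lintegral_map (M.pathLaw.measurable_coe hD) (M.measurable_X_comp hu),
    ← Measure.restrict_restrict (hu hC)] at h1
  have h3 : (fun q : Ω × RCPath E => ((τ q.1).untopD 0, q.2)) ⁻¹' C ×ˢ D =
      ((fun ω => (τ ω).untopD 0) ⁻¹' C) ×ˢ D := rfl
  rw [Measure.map_apply (hu.prodMk hsh) (hC.prod hD), Measure.map_apply hq (hC.prod hD), h3,
    Measure.compProd_apply_prod (hu hC) hD]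
  refine Eq.trans ?_ h1
  rw [Measure.restrict_apply (hsh hD), inter_comm (_ ⁻¹' D)]
  rfl

/-- The strong Markov property for functionals of the stopping time and of the path after it. -/
lemma setIntegral_shift {τ : Ω → WithTop ℝ≥0} (hτ : IsStoppingTime M.filtration τ)
    (x : E) {A : Set Ω} (hA : MeasurableSet[hτ.measurableSpace] A) {Ψ : ℝ≥0 × RCPath E → ℝ}
    (hΨ : Measurable Ψ) (hb : IsBoundedFunction Ψ) :
    ∫ ω in A ∩ {ω | τ ω ≠ ⊤},
        Ψ ((τ ω).untopD 0, RCPath.shift ((τ ω).untopD 0) (M.path ω)) ∂(M.P x) =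
      ∫ ω in A ∩ {ω | τ ω ≠ ⊤},
        ∫ ω', Ψ ((τ ω).untopD 0, M.path ω') ∂(M.P (M.X ((τ ω).untopD 0) ω)) ∂(M.P x) := by
  obtain ⟨C, hC⟩ := hb
  have hu : Measurable fun ω => (τ ω).untopD 0 := hτ.measurable'.untopD 0
  have hsh : Measurable fun ω => RCPath.shift ((τ ω).untopD 0) (M.path ω) :=
    RCPath.measurable_shift M.measurable_path hu
  have hq : Measurable fun q : Ω × RCPath E => ((τ q.1).untopD 0, q.2) :=
    (hu.comp measurable_fst).prodMk measurable_snd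
  rw [← integral_map (φ := fun ω => ((τ ω).untopD 0, RCPath.shift ((τ ω).untopD 0) (M.path ω)))
    (hu.prodMk hsh).aemeasurable hΨ.aestronglyMeasurable, M.map_shift_eq_compProd hτ x hA,
    integral_map hq.aemeasurable hΨ.aestronglyMeasurable, Measure.integral_compProd]
  · refine integral_congr_ae (Eventually.of_forall fun ω => ?_)
    simp only [Kernel.comap_apply, pathLaw_apply]
    rw [integral_map M.measurable_path.aemeasurable]
    exact (hΨ.comp measurable_prodMk_left).aestronglyMeasurable
  · exact Integrable.of_bound (hΨ.comp hq).aestronglyMeasurable C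
      (Eventually.of_forall fun q => hC _)

end StandardMarkovProcess

end

noncomputable section

/-! ### Discounted rewards along a path -/

/-- Bounded measurable functions. -/
def IsBoundedMeasurable {S : Type*} [MeasurableSpace S] (g : S → ℝ) : Prop :=
  Measurable g ∧ IsBoundedFunction g

namespace IsBoundedMeasurable

variable {S : Type*} [MeasurableSpace S] {g h : S → ℝ}

lemma exists_bound (hg : IsBoundedMeasurable g) : ∃ C, 0 ≤ C ∧ ∀ p, |g p| ≤ C := by
  obtain ⟨C, hC⟩ := hg.2
  exact ⟨max C 0, le_max_right _ _, fun p => (hC p).trans (le_max_left _ _)⟩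

lemma const (c : ℝ) : IsBoundedMeasurable fun _ : S => c :=
  ⟨measurable_const, |c|, fun _ => le_rfl⟩

lemma add (hg : IsBoundedMeasurable g) (hh : IsBoundedMeasurable h) :
    IsBoundedMeasurable fun p => g p + h p := by
  obtain ⟨C, hC⟩ := hg.2
  obtain ⟨D, hD⟩ := hh.2
  exact ⟨hg.1.add hh.1, C + D, fun p => (abs_add_le _ _).trans (add_le_add (hC p) (hD p))⟩

lemma sub (hg : IsBoundedMeasurable g) (hh : IsBoundedMeasurable h) :
    IsBoundedMeasurable fun p => g p - h p := by
  obtain ⟨C, hC⟩ := hg.2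
  obtain ⟨D, hD⟩ := hh.2
  exact ⟨hg.1.sub hh.1, C + D, fun p => (abs_sub _ _).trans (add_le_add (hC p) (hD p))⟩

lemma const_mul (hg : IsBoundedMeasurable g) (c : ℝ) :
    IsBoundedMeasurable fun p => c * g p := by
  obtain ⟨C, hC⟩ := hg.2
  exact ⟨hg.1.const_mul c, |c| * C, fun p => by rw [abs_mul]; gcongr; exact hC p⟩

lemma max (hg : IsBoundedMeasurable g) (hh : IsBoundedMeasurable h) :
    IsBoundedMeasurable fun p => max (g p) (h p) := by
  obtain ⟨C, hC⟩ := hg.2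
  obtain ⟨D, hD⟩ := hh.2
  exact ⟨hg.1.max hh.1, Max.max C D, fun p =>
    abs_max_le_max_abs_abs.trans (max_le_max (hC p) (hD p))⟩

lemma comp {T : Type*} [MeasurableSpace T] {φ : T → S} (hg : IsBoundedMeasurable g)
    (hφ : Measurable φ) : IsBoundedMeasurable fun t => g (φ t) :=
  ⟨hg.1.comp hφ, hg.2.imp fun _ h t => h (φ t)⟩

lemma integrable (hg : IsBoundedMeasurable g) (μ : Measure S) [IsFiniteMeasure μ] :
    Integrable g μ := by
  obtain ⟨C, hC⟩ := hg.2
  exact Integrable.of_bound hg.1.aestronglyMeasurable C (Eventually.of_forall hC)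

end IsBoundedMeasurable

lemma integrableOn_exp_neg_mul_Ici {γ : ℝ} (hγ : 0 < γ) :
    IntegrableOn (fun u : ℝ => Real.exp (-γ * u)) (Ici 0) :=
  Iff.mpr integrableOn_Ici_iff_integrableOn_Ioi (exp_neg_integrableOn_Ioi 0 hγ)

lemma integral_exp_neg_mul_Ici {γ : ℝ} (hγ : 0 < γ) :
    ∫ u : ℝ in Ici 0, Real.exp (-γ * u) = 1 / γ := by
  rw [integral_Ici_eq_integral_Ioi, integral_exp_mul_Ioi (by linarith)]
  simp [neg_div_neg_eq]

namespace RCPath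

/-- The part of the half-line before `T`. -/
def before (T : WithTop ℝ≥0) : Set ℝ := {u : ℝ | 0 ≤ u ∧ ((u.toNNReal : ℝ≥0) : WithTop ℝ≥0) < T}

lemma before_subset_Ici (T : WithTop ℝ≥0) : before T ⊆ Ici 0 := fun _ h => h.1

lemma measurableSet_before (T : WithTop ℝ≥0) : MeasurableSet (before T) :=
  measurableSet_Ici.inter (measurable_real_toNNReal.withTop_coe measurableSet_Iio)

lemma before_coe (a : ℝ≥0) : before a = Ico 0 (a : ℝ) := by
  ext u
  simp only [before, mem_ofPred_eq, mem_Ico, WithTop.coe_lt_coe]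
  refine and_congr_right fun h => ?_
  rw [← NNReal.coe_lt_coe, Real.coe_toNNReal u h]

lemma before_top : before ⊤ = Ici 0 := by
  ext u
  exact and_iff_left (WithTop.coe_lt_top _)

lemma before_mono {T T' : WithTop ℝ≥0} (h : T ≤ T') : before T ⊆ before T' :=
  fun _ hu => ⟨hu.1, hu.2.trans_le h⟩

variable {E : Type*} [MetricSpace E]

/-- The discounted reward rate along the path `p`. -/
def rate (γ : ℝ) (g : ℝ≥0 × E → ℝ) (s : ℝ≥0) (p : RCPath E) (u : ℝ) : ℝ :=
  Real.exp (-γ * u) * g (s + u.toNNReal, p u.toNNReal)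

/-- `∫_0^T e^{-γ u} g(s + u, p(u)) du`. -/
def running (γ : ℝ) (g : ℝ≥0 × E → ℝ) (s : ℝ≥0) (T : WithTop ℝ≥0) (p : RCPath E) : ℝ :=
  ∫ u in before T, rate γ g s p u

open scoped Classical in
/-- `e^{-γ T} F(s + T, p(T))`, and `0` for `T = ∞`. -/
def terminal (γ : ℝ) (F : ℝ≥0 × E → ℝ) (s : ℝ≥0) (T : WithTop ℝ≥0) (p : RCPath E) : ℝ :=
  if T = ⊤ then 0 else Real.exp (-γ * (T.untopD 0 : ℝ≥0)) * F (s + T.untopD 0, p (T.untopD 0))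

@[simp] lemma terminal_top (γ : ℝ) (F : ℝ≥0 × E → ℝ) (s : ℝ≥0) (p : RCPath E) :
    terminal γ F s ⊤ p = 0 := if_pos rfl

@[simp] lemma terminal_coe (γ : ℝ) (F : ℝ≥0 × E → ℝ) (s a : ℝ≥0) (p : RCPath E) :
    terminal γ F s a p = Real.exp (-γ * a) * F (s + a, p a) := if_neg WithTop.coe_ne_top

lemma terminal_zero (γ : ℝ) (F : ℝ≥0 × E → ℝ) (s : ℝ≥0) (p : RCPath E) :
    terminal γ F s 0 p = F (s, p 0) := by
  rw [← WithTop.coe_zero, terminal_coe]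
  simp

lemma running_zero (γ : ℝ) (g : ℝ≥0 × E → ℝ) (s : ℝ≥0) (p : RCPath E) :
    running γ g s 0 p = 0 := by
  rw [running, ← WithTop.coe_zero, before_coe]
  simp

section Bounds

variable {γ : ℝ} {g h : ℝ≥0 × E → ℝ}

lemma abs_rate_le {C : ℝ} (hC : ∀ q, |g q| ≤ C) (s : ℝ≥0) (p : RCPath E) (u : ℝ) :
    |rate γ g s p u| ≤ C * Real.exp (-γ * u) := by
  rw [rate, abs_mul, abs_of_pos (Real.exp_pos _), mul_comm]
  gcongr
  exact hC _

lemma rate_add (s t : ℝ≥0) (p : RCPath E) {u : ℝ} (hu : 0 ≤ u) :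
    rate γ g s p (t + u) = Real.exp (-γ * t) * rate γ g (s + t) (shift t p) u := by
  have : ((t : ℝ) + u).toNNReal = t + u.toNNReal := by
    rw [Real.toNNReal_add t.coe_nonneg hu, Real.toNNReal_coe]
  rw [rate, rate, this, shift_apply, mul_add, Real.exp_add, add_assoc, mul_assoc]

lemma abs_terminal_le (hγ : 0 ≤ γ) {C : ℝ} (hC0 : 0 ≤ C) (hC : ∀ q, |g q| ≤ C) (s : ℝ≥0)
    (T : WithTop ℝ≥0) (p : RCPath E) : |terminal γ g s T p| ≤ C := by
  cases T with
  | top => simpa using hC0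
  | coe a =>
    rw [terminal_coe, abs_mul, abs_of_pos (Real.exp_pos _)]
    have : Real.exp (-γ * a) ≤ 1 := Real.exp_le_one_iff.2 (by
      have := mul_nonneg hγ a.coe_nonneg; linarith)
    calc Real.exp (-γ * a) * |g (s + a, p a)| ≤ 1 * C :=
          mul_le_mul this (hC _) (abs_nonneg _) zero_le_one
      _ = C := one_mul C

lemma terminal_add (s t : ℝ≥0) (T : WithTop ℝ≥0) (p : RCPath E) :
    terminal γ g s (t + T) p = Real.exp (-γ * t) * terminal γ g (s + t) T (shift t p) := by
  cases T with
  | top => rw [WithTop.add_top]; simp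
  | coe a =>
    rw [← WithTop.coe_add, terminal_coe, terminal_coe, shift_apply, NNReal.coe_add, mul_add,
      Real.exp_add, add_assoc, mul_assoc]

lemma running_congr {s : ℝ≥0} {T : WithTop ℝ≥0} {p : RCPath E} {s' : ℝ≥0} {p' : RCPath E}
    (H : ∀ u : ℝ≥0, u < T → g (s + u, p u) = h (s' + u, p' u)) :
    running γ g s T p = running γ h s' T p' :=
  setIntegral_congr_fun (measurableSet_before T) fun u hu => by
    simp only [rate, H _ hu.2]

lemma running_const_mul (c : ℝ) (s : ℝ≥0) (T : WithTop ℝ≥0) (p : RCPath E) :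
    running γ (fun q => c * g q) s T p = c * running γ g s T p := by
  rw [running, running, ← integral_const_mul]
  refine integral_congr_ae (Eventually.of_forall fun u => ?_)
  simp only [rate]
  ring

variable [MeasurableSpace E] [BorelSpace E]

lemma measurable_rate (hg : Measurable g) {A : Type*} [MeasurableSpace A] {s : A → ℝ≥0}
    (hs : Measurable s) {φ : A → RCPath E} (hφ : Measurable φ) {u : A → ℝ} (hu : Measurable u) :
    Measurable fun a => rate γ g (s a) (φ a) (u a) :=
  (Real.measurable_exp.comp (hu.const_mul (-γ))).mul
    (hg.comp ((hs.add hu.real_toNNReal).prodMk (measurable_apply hφ hu.real_toNNReal)))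

lemma integrableOn_rate (hγ : 0 < γ) (hg : IsBoundedMeasurable g) (s : ℝ≥0) (p : RCPath E)
    {S : Set ℝ} (hS : S ⊆ Ici 0) : IntegrableOn (rate γ g s p) S := by
  obtain ⟨C, -, hC⟩ := hg.exists_bound
  have hm : Measurable (rate γ g s p) :=
    measurable_rate hg.1 measurable_const measurable_const measurable_id
  refine ((integrableOn_exp_neg_mul_Ici hγ).mono_set hS |>.const_mul C).mono'
    hm.aestronglyMeasurable (Eventually.of_forall fun u => abs_rate_le hC s p u)

lemma running_add_fun (hγ : 0 < γ) (hg : IsBoundedMeasurable g) (hh : IsBoundedMeasurable h)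
    (s : ℝ≥0) (T : WithTop ℝ≥0) (p : RCPath E) :
    running γ (fun q => g q + h q) s T p = running γ g s T p + running γ h s T p := by
  rw [running, running, running, ← integral_add (integrableOn_rate hγ hg s p (before_subset_Ici T))
    (integrableOn_rate hγ hh s p (before_subset_Ici T))]
  refine integral_congr_ae (Eventually.of_forall fun u => ?_)
  simp only [rate]
  ring

lemma running_mono (hγ : 0 < γ) (hg : IsBoundedMeasurable g) (hh : IsBoundedMeasurable h)
    {s : ℝ≥0} {T : WithTop ℝ≥0} {p : RCPath E} {s' : ℝ≥0} {p' : RCPath E}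
    (H : ∀ u : ℝ≥0, u < T → g (s + u, p u) ≤ h (s' + u, p' u)) :
    running γ g s T p ≤ running γ h s' T p' :=
  setIntegral_mono_on (integrableOn_rate hγ hg s p (before_subset_Ici T))
    (integrableOn_rate hγ hh s' p' (before_subset_Ici T)) (measurableSet_before T) fun u hu => by
    simp only [rate]
    gcongr
    exact H _ hu.2

omit [MeasurableSpace E] [BorelSpace E] in
lemma running_nonneg {s : ℝ≥0} {T : WithTop ℝ≥0} {p : RCPath E}
    (H : ∀ u : ℝ≥0, u < T → 0 ≤ g (s + u, p u)) : 0 ≤ running γ g s T p :=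
  setIntegral_nonneg (measurableSet_before T) fun _ hu =>
    mul_nonneg (Real.exp_pos _).le (H _ hu.2)

omit [MeasurableSpace E] [BorelSpace E] in
lemma abs_running_le (hγ : 0 < γ) {C : ℝ} (hC0 : 0 ≤ C) (hC : ∀ q, |g q| ≤ C)
    (s : ℝ≥0) (T : WithTop ℝ≥0) (p : RCPath E) : |running γ g s T p| ≤ C / γ := by
  have h1 : IntegrableOn (fun u : ℝ => C * Real.exp (-γ * u)) (Ici 0) :=
    (integrableOn_exp_neg_mul_Ici hγ).const_mul C
  calc |running γ g s T p| ≤ ∫ u in before T, C * Real.exp (-γ * u) :=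
        norm_integral_le_of_norm_le (f := rate γ g s p) (h1.mono_set (before_subset_Ici T))
          (Eventually.of_forall fun u => abs_rate_le hC s p u)
    _ ≤ ∫ u in Ici 0, C * Real.exp (-γ * u) :=
        setIntegral_mono_set h1 (Eventually.of_forall fun u => by positivity)
          (before_subset_Ici T).eventuallyLE
    _ = C / γ := by rw [integral_const_mul, integral_exp_neg_mul_Ici hγ]; ring

omit [MeasurableSpace E] [BorelSpace E] in
lemma abs_running_le_mul (hγ : 0 ≤ γ) {C : ℝ} (hC0 : 0 ≤ C) (hC : ∀ q, |g q| ≤ C)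
    (s : ℝ≥0) {T : WithTop ℝ≥0} {a : ℝ≥0} (hT : T ≤ a) (p : RCPath E) :
    |running γ g s T p| ≤ C * a := by
  lift T to ℝ≥0 using ne_top_of_le_ne_top WithTop.coe_ne_top hT with b
  have hba : b ≤ a := by exact_mod_cast hT
  rw [running, before_coe]
  have := norm_setIntegral_le_of_norm_le_const (μ := volume) (s := Ico 0 (b : ℝ))
    (f := rate γ g s p) (C := C) (by simp) fun u hu => (abs_rate_le hC s p u).trans (by
      have : Real.exp (-γ * u) ≤ 1 := Real.exp_le_one_iff.2 (by
        have := mul_nonneg hγ hu.1; linarith)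
      calc C * Real.exp (-γ * u) ≤ C * 1 := by gcongr
        _ = C := mul_one C)
  refine this.trans ?_
  simp only [measureReal_def, Real.volume_Ico, sub_zero, ENNReal.toReal_ofReal b.coe_nonneg]
  gcongr

lemma running_add (hγ : 0 < γ) (hg : IsBoundedMeasurable g) (s t : ℝ≥0) (T : WithTop ℝ≥0)
    (p : RCPath E) : running γ g s (t + T) p =
      running γ g s t p + Real.exp (-γ * t) * running γ g (s + t) T (shift t p) := by
  have hsub : before t ⊆ before (t + T) := before_mono le_self_add
  have hint := integrableOn_rate hγ hg s p (before_subset_Ici (t + T))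
  have h1 := setIntegral_sdiff (measurableSet_before (t : WithTop ℝ≥0)) hint hsub
  have h2 : ∫ u in before (t + T) \ before t, rate γ g s p u =
      Real.exp (-γ * t) * running γ g (s + t) T (shift t p) := by
    rw [running, ← integral_const_mul, ← integral_indicator (measurableSet_before T),
      ← integral_indicator ((measurableSet_before _).diff (measurableSet_before _)),
      ← integral_add_left_eq_self _ (t : ℝ)]
    refine integral_congr_ae (Eventually.of_forall fun u => ?_)
    have hmem : (t : ℝ) + u ∈ before (t + T) \ before t ↔ u ∈ before T := by
      rw [before_coe]
      simp only [before, Set.mem_sdiff, mem_ofPred_eq, mem_Ico, not_and, not_lt]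
      by_cases hu : 0 ≤ u
      · have h3 : ((t : ℝ) + u).toNNReal = t + u.toNNReal := by
          rw [Real.toNNReal_add t.coe_nonneg hu, Real.toNNReal_coe]
        have h4 : ((t + u.toNNReal : ℝ≥0) : WithTop ℝ≥0) < t + T ↔
            (u.toNNReal : WithTop ℝ≥0) < T := by
          rw [WithTop.coe_add]
          exact WithTop.add_lt_add_iff_left WithTop.coe_ne_top
        rw [h3, h4]
        have := add_nonneg t.coe_nonneg hu
        simp [hu, this]
      · refine iff_of_false (fun h => ?_) fun h => hu h.1
        have := h.2 h.1.1
        linarith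
    by_cases hu : u ∈ before T
    · beta_reduce
      rw [indicator_of_mem hu, indicator_of_mem (hmem.2 hu), rate_add s t p hu.1]
    · beta_reduce
      rw [indicator_of_notMem hu, indicator_of_notMem (mt hmem.1 hu)]
  rw [← h2, h1]
  simp only [running]
  ring

lemma measurable_running (hg : Measurable g) {A : Type*} [MeasurableSpace A]
    {s : A → ℝ≥0} (hs : Measurable s) {T : A → WithTop ℝ≥0} (hT : Measurable T)
    {φ : A → RCPath E} (hφ : Measurable φ) :
    Measurable fun a => running γ g (s a) (T a) (φ a) := by
  have h1 : MeasurableSet {q : A × ℝ | q.2 ∈ before (T q.1)} :=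
    (measurable_snd measurableSet_Ici).inter (measurableSet_lt
      (measurable_snd.real_toNNReal.withTop_coe) (hT.comp measurable_fst))
  have h2 : Measurable ({q : A × ℝ | q.2 ∈ before (T q.1)}.indicator
      fun q => rate γ g (s q.1) (φ q.1) q.2) :=
    (measurable_rate hg (hs.comp measurable_fst) (hφ.comp measurable_fst)
      measurable_snd).indicator h1
  have h3 := (h2.stronglyMeasurable.integral_prod_right' (ν := volume)).measurable
  refine (congrArg Measurable (funext fun a => ?_)).mpr h3
  rw [running, ← integral_indicator (measurableSet_before _)]
  rfl

lemma measurable_terminal (hg : Measurable g) {A : Type*} [MeasurableSpace A]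
    {s : A → ℝ≥0} (hs : Measurable s) {T : A → WithTop ℝ≥0} (hT : Measurable T)
    {φ : A → RCPath E} (hφ : Measurable φ) :
    Measurable fun a => terminal γ g (s a) (T a) (φ a) := by
  have hu := hT.untopD 0
  refine Measurable.ite (hT (measurableSet_singleton ⊤)) measurable_const ?_
  exact (Real.measurable_exp.comp ((measurable_coe_nnreal_real.comp hu).const_mul (-γ))).mul
    (hg.comp ((hs.add hu).prodMk (measurable_apply hφ hu)))

end Bounds

end RCPath

end

/-! ### ### The reward up to the exit time and its pathwise resolvent identity -/

noncomputable section

namespace RCPath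

variable {E : Type*} [MetricSpace E]

/-- The discounted reward up to the exit from `O`. -/
def reward (O : Set E) (γ : ℝ) (g F : ℝ≥0 × E → ℝ) (s : ℝ≥0) (p : RCPath E) : ℝ :=
  running γ g s (exitTime O p) p + terminal γ F s (exitTime O p) p

variable {O : Set E} {γ : ℝ} {g F : ℝ≥0 × E → ℝ}

lemma abs_reward_le (hγ : 0 < γ) {C D : ℝ} (hC0 : 0 ≤ C) (hC : ∀ q, |g q| ≤ C) (hD0 : 0 ≤ D)
    (hD : ∀ q, |F q| ≤ D) (s : ℝ≥0) (p : RCPath E) : |reward O γ g F s p| ≤ C / γ + D :=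
  (abs_add_le _ _).trans
    (add_le_add (abs_running_le hγ hC0 hC _ _ _) (abs_terminal_le hγ.le hD0 hD _ _ _))

/-- The terminal reward of the constant 1 encodes the factor exp(-γT), with the correct value 0 for
T = ∞. -/
lemma integral_exp_before (hγ : 0 < γ) (T : WithTop ℝ≥0) (s : ℝ≥0) (p : RCPath E) {v : ℝ}
    (hv : 0 ≤ v) (hvT : (v.toNNReal : WithTop ℝ≥0) ≤ T) :
    ∫ u in before T ∩ Ici v, γ * Real.exp (-γ * u) =
      Real.exp (-γ * v) - terminal γ (fun _ => 1) s T p := by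
  rw [integral_const_mul]
  cases T with
  | top =>
    rw [before_top, inter_eq_right.2 (Ici_subset_Ici.2 hv), integral_Ici_eq_integral_Ioi,
      integral_exp_mul_Ioi (by linarith), terminal_top]
    field_simp
    ring
  | coe a =>
    have hva : v ≤ a := by
      rw [WithTop.coe_le_coe, ← NNReal.coe_le_coe, Real.coe_toNNReal v hv] at hvT
      exact hvT
    have : Ico 0 (a : ℝ) ∩ Ici v = Ico v a := by
      ext u
      simp only [mem_inter_iff, mem_Ico, mem_Ici]
      constructor
      · rintro ⟨⟨_, h⟩, h'⟩
        exact ⟨h', h⟩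
      · rintro ⟨h, h'⟩
        exact ⟨⟨hv.trans h, h'⟩, h⟩
    rw [before_coe, this, integral_Ico_eq_integral_Ioc, ← intervalIntegral.integral_of_le hva,
      intervalIntegral.integral_comp_mul_left _ (by linarith : -γ ≠ 0), integral_exp, terminal_coe,
      smul_eq_mul]
    field_simp
    ring

variable [MeasurableSpace E] [BorelSpace E]

lemma measurable_reward (hg : Measurable g) (hF : Measurable F) {A : Type*} [MeasurableSpace A]
    {s : A → ℝ≥0} (hs : Measurable s) {φ : A → RCPath E} (hφ : Measurable φ) :
    Measurable fun a => reward O γ g F (s a) (φ a) :=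
  (measurable_running hg hs ((measurable_exitTime O).comp hφ) hφ).add
    (measurable_terminal hF hs ((measurable_exitTime O).comp hφ) hφ)

lemma reward_eq_add (hγ : 0 < γ) (hg : IsBoundedMeasurable g) {s t : ℝ≥0} {p : RCPath E}
    (h : t < exitTime O p) : reward O γ g F s p =
      running γ g s t p + Real.exp (-γ * t) * reward O γ g F (s + t) (shift t p) := by
  rw [reward, reward, exitTime_eq_add h, running_add hγ hg, terminal_add]
  ring

/-- Fubini: the reward earned at time `v` is counted for all `u` between `v` and `T`, with total
weight exp(-γv) - exp(-γT). -/
lemma integral_running_exp {α : ℝ} (hα : 0 < α) (hγ : 0 < γ) (hg : IsBoundedMeasurable g)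
    (s : ℝ≥0) (T : WithTop ℝ≥0) (p : RCPath E) :
    ∫ u in before T, γ * Real.exp (-γ * u) * running α g s u.toNNReal p =
      running (α + γ) g s T p - terminal γ (fun _ => 1) s T p * running α g s T p := by
  set ν : Measure ℝ := volume.restrict (before T) with hν
  have hρ : Integrable (rate α g s p) ν := integrableOn_rate hα hg s p (before_subset_Ici T)
  have he : Integrable (fun u => γ * Real.exp (-γ * u)) ν :=
    ((integrableOn_exp_neg_mul_Ici hγ).mono_set (before_subset_Ici T)).const_mul γ
  have hS : MeasurableSet {q : ℝ × ℝ | q.2 ≤ q.1} := measurableSet_le measurable_snd measurable_fst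
  have hf : Integrable (Function.uncurry fun u v => {q : ℝ × ℝ | q.2 ≤ q.1}.indicator
      (fun q => γ * Real.exp (-γ * q.1) * rate α g s p q.2) (u, v)) (ν.prod ν) :=
    (he.mul_prod hρ).indicator hS
  have hswap := integral_integral_swap hf
  have hl : ∀ u ∈ before T, ∫ v, {q : ℝ × ℝ | q.2 ≤ q.1}.indicator
      (fun q => γ * Real.exp (-γ * q.1) * rate α g s p q.2) (u, v) ∂ν =
      γ * Real.exp (-γ * u) * running α g s u.toNNReal p := by
    intro u hu
    have h1 : (fun v => {q : ℝ × ℝ | q.2 ≤ q.1}.indicator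
      (fun q => γ * Real.exp (-γ * q.1) * rate α g s p q.2) (u, v)) =
      (Iic u).indicator fun v => γ * Real.exp (-γ * u) * rate α g s p v := rfl
    have h2 : Iic u ∩ before T = Icc 0 u := by
      ext v
      simp only [mem_inter_iff, mem_Iic, mem_Icc]
      constructor
      · rintro ⟨h, h'⟩
        exact ⟨h'.1, h⟩
      · rintro ⟨h, h'⟩
        exact ⟨h', h, lt_of_le_of_lt (by exact_mod_cast Real.toNNReal_le_toNNReal h') hu.2⟩
    rw [h1, integral_indicator measurableSet_Iic, hν, Measure.restrict_restrict measurableSet_Iic,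
      h2, integral_const_mul, running, before_coe, Real.coe_toNNReal u hu.1,
      integral_Icc_eq_integral_Ico]
  have hr : ∀ v ∈ before T, ∫ u, {q : ℝ × ℝ | q.2 ≤ q.1}.indicator
      (fun q => γ * Real.exp (-γ * q.1) * rate α g s p q.2) (u, v) ∂ν =
      rate (α + γ) g s p v - terminal γ (fun _ => 1) s T p * rate α g s p v := by
    intro v hv
    have h1 : (fun u => {q : ℝ × ℝ | q.2 ≤ q.1}.indicator
      (fun q => γ * Real.exp (-γ * q.1) * rate α g s p q.2) (u, v)) =
      (Ici v).indicator fun u => γ * Real.exp (-γ * u) * rate α g s p v := rfl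
    rw [h1, integral_indicator measurableSet_Ici, hν, Measure.restrict_restrict measurableSet_Ici,
      integral_mul_const, inter_comm, integral_exp_before hγ T s p hv.1 hv.2.le, sub_mul, rate,
      rate, neg_add, add_mul, Real.exp_add]
    ring
  rw [← setIntegral_congr_fun (measurableSet_before T) hl, hswap,
    setIntegral_congr_fun (measurableSet_before T) hr, running, running, ← integral_const_mul]
  exact integral_sub (integrableOn_rate (by linarith) hg s p (before_subset_Ici T))
    (hρ.const_mul _)

/-- The pathwise resolvent identity. -/
lemma integral_reward_shift {α : ℝ} (hα : 0 < α) (hγ : 0 < γ) (hg : IsBoundedMeasurable g)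
    (s : ℝ≥0) (p : RCPath E) :
    ∫ u in before (exitTime O p), γ * Real.exp (-(α + γ) * u) *
        reward O α g F (s + u.toNNReal) (shift u.toNNReal p) =
      reward O α g F s p - reward O (α + γ) g F s p := by
  set T := exitTime O p with hT
  set R := reward O α g F s p with hR
  -- The discounted reward of the path after `u` is the total reward minus what was earned before
  -- `u`.
  have h1 : ∀ u ∈ before T, γ * Real.exp (-(α + γ) * u) *
      reward O α g F (s + u.toNNReal) (shift u.toNNReal p) =
      γ * Real.exp (-γ * u) * R - γ * Real.exp (-γ * u) * running α g s u.toNNReal p := by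
    intro u hu
    rw [hR, reward_eq_add hα hg hu.2, Real.coe_toNNReal u hu.1, neg_add, add_mul, Real.exp_add]
    ring
  have he : IntegrableOn (fun u => γ * Real.exp (-γ * u)) (before T) :=
    ((integrableOn_exp_neg_mul_Ici hγ).mono_set (before_subset_Ici T)).const_mul γ
  obtain ⟨C, hC0, hC⟩ := hg.exists_bound
  have hm : Measurable fun u : ℝ => running α g s u.toNNReal p :=
    measurable_running hg.1 measurable_const measurable_real_toNNReal.withTop_coe measurable_const
  have he' : IntegrableOn (fun u => γ * Real.exp (-γ * u) * running α g s u.toNNReal p)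
      (before T) :=
    he.mul_bdd (c := C / α) hm.aestronglyMeasurable
      (Eventually.of_forall fun u => abs_running_le hα hC0 hC _ _ _)
  have h2 := integral_exp_before hγ T s p le_rfl (by simp)
  rw [inter_eq_left.2 (before_subset_Ici T)] at h2
  have h3 : terminal γ (fun _ => 1) s T p * terminal α F s T p = terminal (α + γ) F s T p := by
    cases T with
    | top => simp
    | coe a =>
      simp only [terminal_coe]
      rw [neg_add, add_mul, Real.exp_add]
      ring
  rw [setIntegral_congr_fun (measurableSet_before T) h1, integral_sub (he.mul_const R) he',
    integral_mul_const, h2, integral_running_exp hα hγ hg, reward, ← hT, hR, reward, ← hT, ← h3]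
  simp only [mul_zero, Real.exp_zero]
  ring

end RCPath

end

/-! ### ### Expected rewards, stopping and the resolvent equation -/

noncomputable section

namespace StandardMarkovProcess

set_option linter.unusedSectionVars false

open RCPath

variable {E Ω : Type*} [MetricSpace E] [SecondCountableTopology E] [MeasurableSpace E]
  [BorelSpace E] [mΩ : MeasurableSpace Ω] (M : StandardMarkovProcess E Ω)

/-- The exit time from `O`, replaced by the measurable version which is a stopping time. -/
abbrev exit (O : Set E) (ω : Ω) : WithTop ℝ≥0 := RCPath.exitTime O (M.path ω)

/-- The expected discounted reward up to the exit from `O`. -/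
def value (O : Set E) (γ : ℝ) (g F : ℝ≥0 × E → ℝ) (q : ℝ≥0 × E) : ℝ :=
  ∫ ω, reward O γ g F q.1 (M.path ω) ∂(M.P q.2)

lemma measurable_exit (O : Set E) : Measurable (M.exit O) :=
  (measurable_exitTime O).comp M.measurable_path

lemma isStoppingTime_exit (O : Set E) : IsStoppingTime M.filtration (M.exit O) :=
  M.isStoppingTime_pathExitTime O

variable {O : Set E} {γ : ℝ} {g h F : ℝ≥0 × E → ℝ}

lemma value_eq_integral_pathLaw (hg : Measurable g) (hF : Measurable F) (q : ℝ≥0 × E) :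
    M.value O γ g F q = ∫ p, reward O γ g F q.1 p ∂(M.pathLaw q.2) := by
  rw [pathLaw_apply, integral_map M.measurable_path.aemeasurable]
  · rfl
  · exact (measurable_reward hg hF measurable_const measurable_id).aestronglyMeasurable

lemma measurable_value (hg : Measurable g) (hF : Measurable F) : Measurable (M.value O γ g F) := by
  have h1 : Measurable fun q : (ℝ≥0 × E) × RCPath E => reward O γ g F q.1.1 q.2 :=
    measurable_reward hg hF (measurable_fst.comp measurable_fst) measurable_snd
  have h2 := (StronglyMeasurable.integral_kernel_prod_right'
    (κ := M.pathLaw.comap (Prod.snd : ℝ≥0 × E → E) measurable_snd) h1.stronglyMeasurable).measurable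
  refine (congrArg Measurable (funext fun q => ?_)).mpr h2
  rw [M.value_eq_integral_pathLaw hg hF]
  rfl

lemma abs_value_le (hγ : 0 < γ) {C D : ℝ} (hC0 : 0 ≤ C) (hC : ∀ q, |g q| ≤ C) (hD0 : 0 ≤ D)
    (hD : ∀ q, |F q| ≤ D) (q : ℝ≥0 × E) : |M.value O γ g F q| ≤ C / γ + D := by
  have := norm_integral_le_of_norm_le_const (μ := M.P q.2)
    (f := fun ω => reward O γ g F q.1 (M.path ω)) (Eventually.of_forall fun ω =>
    abs_reward_le (O := O) hγ hC0 hC hD0 hD q.1 (M.path ω))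
  rw [value]
  simpa using this

lemma isBoundedMeasurable_value (hγ : 0 < γ) (hg : IsBoundedMeasurable g)
    (hF : IsBoundedMeasurable F) : IsBoundedMeasurable (M.value O γ g F) := by
  obtain ⟨C, hC0, hC⟩ := hg.exists_bound
  obtain ⟨D, hD0, hD⟩ := hF.exists_bound
  exact ⟨M.measurable_value hg.1 hF.1, C / γ + D, M.abs_value_le hγ hC0 hC hD0 hD⟩

/-- Rewards of a path are bounded measurable in the scenario. -/
lemma isBoundedMeasurable_reward (hγ : 0 < γ) (hg : IsBoundedMeasurable g)
    (hF : IsBoundedMeasurable F) {A : Type*} [MeasurableSpace A] {s : A → ℝ≥0}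
    (hs : Measurable s) {φ : A → RCPath E} (hφ : Measurable φ) :
    IsBoundedMeasurable fun a => reward O γ g F (s a) (φ a) := by
  obtain ⟨C, hC0, hC⟩ := hg.exists_bound
  obtain ⟨D, hD0, hD⟩ := hF.exists_bound
  exact ⟨measurable_reward hg.1 hF.1 hs hφ, C / γ + D, fun a => abs_reward_le hγ hC0 hC hD0 hD _ _⟩

lemma isBoundedMeasurable_running (hγ : 0 < γ) (hg : IsBoundedMeasurable g) {A : Type*}
    [MeasurableSpace A] {s : A → ℝ≥0} (hs : Measurable s) {T : A → WithTop ℝ≥0}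
    (hT : Measurable T) {φ : A → RCPath E} (hφ : Measurable φ) :
    IsBoundedMeasurable fun a => running γ g (s a) (T a) (φ a) := by
  obtain ⟨C, hC0, hC⟩ := hg.exists_bound
  exact ⟨measurable_running hg.1 hs hT hφ, C / γ, fun a => abs_running_le hγ hC0 hC _ _ _⟩

lemma isBoundedMeasurable_terminal (hγ : 0 ≤ γ) (hF : IsBoundedMeasurable F) {A : Type*}
    [MeasurableSpace A] {s : A → ℝ≥0} (hs : Measurable s) {T : A → WithTop ℝ≥0}
    (hT : Measurable T) {φ : A → RCPath E} (hφ : Measurable φ) :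
    IsBoundedMeasurable fun a => terminal γ F (s a) (T a) (φ a) := by
  obtain ⟨D, hD0, hD⟩ := hF.exists_bound
  exact ⟨measurable_terminal hF.1 hs hT hφ, D, fun a => abs_terminal_le hγ hD0 hD _ _ _⟩

lemma integrable_reward (hγ : 0 < γ) (hg : IsBoundedMeasurable g) (hF : IsBoundedMeasurable F)
    (s : ℝ≥0) (x : E) : Integrable (fun ω => reward O γ g F s (M.path ω)) (M.P x) :=
  (isBoundedMeasurable_reward hγ hg hF measurable_const M.measurable_path).integrable _

lemma ae_start_notMem {x : E} (hx : x ∉ O) : ∀ᵐ ω ∂(M.P x), M.exit O ω = 0 ∧ M.X 0 ω = x := by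
  filter_upwards [M.start x] with ω hω
  refine ⟨exitTime_eq_zero ?_, hω⟩
  rw [path_apply, hω]
  exact hx

lemma value_of_notMem {x : E} (hx : x ∉ O) (s : ℝ≥0) : M.value O γ g F (s, x) = F (s, x) := by
  have : ∀ᵐ ω ∂(M.P x), reward O γ g F s (M.path ω) = F (s, x) := by
    filter_upwards [M.ae_start_notMem hx] with ω hω
    have h0 : RCPath.exitTime O (M.path ω) = 0 := hω.1
    rw [reward, h0, running_zero, terminal_zero, path_apply, hω.2, zero_add]
  rw [value, integral_congr_ae this]
  simp

lemma value_mono (hγ : 0 < γ) (hg : IsBoundedMeasurable g) (hh : IsBoundedMeasurable h)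
    (hF : IsBoundedMeasurable F) (hle : ∀ q, g q ≤ h q) (q : ℝ≥0 × E) :
    M.value O γ g F q ≤ M.value O γ h F q :=
  integral_mono (M.integrable_reward hγ hg hF _ _) (M.integrable_reward hγ hh hF _ _) fun _ =>
    add_le_add_left (running_mono hγ hg hh fun _ _ => hle _) _

lemma abs_value_sub_le (hγ : 0 < γ) (hg : IsBoundedMeasurable g) (hh : IsBoundedMeasurable h)
    (hF : IsBoundedMeasurable F) {C : ℝ} (hC0 : 0 ≤ C) (hC : ∀ q, |g q - h q| ≤ C)
    (q : ℝ≥0 × E) : |M.value O γ g F q - M.value O γ h F q| ≤ C / γ := by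
  rw [value, value, ← integral_sub (M.integrable_reward hγ hg hF _ _)
    (M.integrable_reward hγ hh hF _ _)]
  have h1 : ∀ p : RCPath E, reward O γ g F q.1 p - reward O γ h F q.1 p =
      running γ (fun q => g q - h q) q.1 (RCPath.exitTime O p) p := by
    intro p
    have := running_add_fun hγ (hg.sub hh) hh q.1 (RCPath.exitTime O p) p
    simp only [sub_add_cancel] at this
    rw [reward, reward, this]
    ring
  have := norm_integral_le_of_norm_le_const (μ := M.P q.2)
    (f := fun ω => reward O γ g F q.1 (M.path ω) - reward O γ h F q.1 (M.path ω))
    (Eventually.of_forall fun ω => by rw [h1]; exact abs_running_le hγ hC0 hC _ _ _)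
  simpa using this

/-- The strong Markov property of the expected reward, up to a stopping time. -/
lemma setIntegral_reward_shift (hγ : 0 < γ) (hg : IsBoundedMeasurable g)
    (hF : IsBoundedMeasurable F) {θ : Ω → WithTop ℝ≥0} (hθ : IsStoppingTime M.filtration θ)
    (s : ℝ≥0) (x : E) :
    ∫ ω in {ω | θ ω < M.exit O ω}, Real.exp (-γ * ((θ ω).untopD 0 : ℝ≥0)) *
        reward O γ g F (s + (θ ω).untopD 0) (shift ((θ ω).untopD 0) (M.path ω)) ∂(M.P x) =
      ∫ ω in {ω | θ ω < M.exit O ω}, Real.exp (-γ * ((θ ω).untopD 0 : ℝ≥0)) *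
        M.value O γ g F (s + (θ ω).untopD 0, M.X ((θ ω).untopD 0) ω) ∂(M.P x) := by
  obtain ⟨C, hC0, hC⟩ := hg.exists_bound
  obtain ⟨D, hD0, hD⟩ := hF.exists_bound
  -- The strong Markov property at `θ` may be restricted to this event only because it is known at
  -- time `θ`.
  have hA : MeasurableSet[hθ.measurableSpace] {ω | θ ω < M.exit O ω} := by
    have := ((M.isStoppingTime_exit O).measurableSet_stopping_time_le hθ).compl
    refine (congrArg _ ?_).mp this
    ext ω
    simp only [mem_compl_iff, mem_ofPred_eq, not_le]
  have h2 : {ω | θ ω < M.exit O ω} ∩ {ω | θ ω ≠ ⊤} = {ω | θ ω < M.exit O ω} :=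
    inter_eq_left.2 fun ω hω => ne_top_of_lt hω
  have h3 := M.setIntegral_shift hθ x hA
    (Ψ := fun q => Real.exp (-γ * q.1) * reward O γ g F (s + q.1) q.2)
    ((Real.measurable_exp.comp (measurable_fst.coe_nnreal_real.const_mul _)).mul
      (measurable_reward hg.1 hF.1 (measurable_fst.const_add s) measurable_snd))
    ⟨C / γ + D, fun q => by
      rw [abs_mul, abs_of_pos (Real.exp_pos _)]
      have h4 : Real.exp (-γ * q.1) ≤ 1 := Real.exp_le_one_iff.2 (by
        have := mul_nonneg hγ.le q.1.coe_nonneg; linarith)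
      calc _ ≤ 1 * (C / γ + D) := mul_le_mul h4 (abs_reward_le hγ hC0 hC hD0 hD _ _)
            (abs_nonneg _) zero_le_one
        _ = _ := one_mul _⟩
  rw [h2] at h3
  refine h3.trans (integral_congr_ae (Eventually.of_forall fun ω => ?_))
  simp only [value, integral_const_mul]

/-- If `θ` comes before the exit, the future reward can be replaced by its conditional expectation,
the value at the position at `θ`. Otherwise the two integrands agree almost surely, since the exit
position is outside `O`, where the value equals `F`. -/
lemma value_eq_stopped (hO : IsOpen O) (hγ : 0 < γ) (hg : IsBoundedMeasurable g)
    (hF : IsBoundedMeasurable F) {θ : Ω → WithTop ℝ≥0} (hθ : IsStoppingTime M.filtration θ)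
    (s : ℝ≥0) (x : E) :
    M.value O γ g F (s, x) = ∫ ω, (running γ g s (min (θ ω) (M.exit O ω)) (M.path ω) +
      terminal γ (M.value O γ g F) s (min (θ ω) (M.exit O ω)) (M.path ω)) ∂(M.P x) := by
  have hV := M.isBoundedMeasurable_value (O := O) hγ hg hF
  have hu : Measurable fun ω => (θ ω).untopD 0 := hθ.measurable'.untopD 0
  have hmin := hθ.measurable'.min (M.measurable_exit O)
  have hA : MeasurableSet {ω | θ ω < M.exit O ω} :=
    measurableSet_lt hθ.measurable' (M.measurable_exit O)
  have h1 := M.integrable_reward (O := O) hγ hg hF s x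
  have h2 : Integrable (fun ω => running γ g s (min (θ ω) (M.exit O ω)) (M.path ω) +
      terminal γ (M.value O γ g F) s (min (θ ω) (M.exit O ω)) (M.path ω)) (M.P x) :=
    ((isBoundedMeasurable_running hγ hg measurable_const hmin M.measurable_path).add
      (isBoundedMeasurable_terminal hγ.le hV measurable_const hmin M.measurable_path)).integrable _
  set Ψ : Ω → ℝ := fun ω => Real.exp (-γ * ((θ ω).untopD 0 : ℝ≥0)) *
        reward O γ g F (s + (θ ω).untopD 0) (shift ((θ ω).untopD 0) (M.path ω)) with hΨ
  set Ψ' : Ω → ℝ := fun ω => Real.exp (-γ * ((θ ω).untopD 0 : ℝ≥0)) *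
        M.value O γ g F (s + (θ ω).untopD 0, M.X ((θ ω).untopD 0) ω) with hΨ'
  have hexp : IsBoundedMeasurable fun ω => Real.exp (-γ * ((θ ω).untopD 0 : ℝ≥0)) :=
    ⟨Real.measurable_exp.comp (hu.coe_nnreal_real.const_mul _), 1, fun ω => by
      rw [abs_of_pos (Real.exp_pos _), Real.exp_le_one_iff]
      have := mul_nonneg hγ.le ((θ ω).untopD 0).coe_nonneg
      linarith⟩
  have hΨi : Integrable Ψ (M.P x) := by
    have h3 := isBoundedMeasurable_reward (O := O) hγ hg hF (hu.const_add s)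
      (measurable_shift M.measurable_path hu)
    obtain ⟨C, -, hC⟩ := h3.exists_bound
    exact (hexp.integrable _).mul_bdd (c := C) h3.1.aestronglyMeasurable
      (Eventually.of_forall hC)
  have hΨi' : Integrable Ψ' (M.P x) := by
    have h3 := hV.comp ((hu.const_add s).prodMk (M.measurable_X_comp hu))
    obtain ⟨C, -, hC⟩ := h3.exists_bound
    exact (hexp.integrable _).mul_bdd (c := C) h3.1.aestronglyMeasurable
      (Eventually.of_forall hC)
  rw [← sub_eq_zero, value, ← integral_sub h1 h2]
  have h3 : ∀ᵐ ω ∂(M.P x), reward O γ g F s (M.path ω) -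
      (running γ g s (min (θ ω) (M.exit O ω)) (M.path ω) +
      terminal γ (M.value O γ g F) s (min (θ ω) (M.exit O ω)) (M.path ω)) =
      {ω | θ ω < M.exit O ω}.indicator (fun ω => Ψ ω - Ψ' ω) ω := by
    filter_upwards [M.ae_notMem_pathExitTime hO x] with ω hω
    by_cases hlt : θ ω < M.exit O ω
    · rw [indicator_of_mem (show ω ∈ {ω | θ ω < M.exit O ω} from hlt), min_eq_left hlt.le]
      obtain ⟨a, ha⟩ := WithTop.ne_top_iff_exists.1 (ne_top_of_lt hlt)
      rw [← ha] at hlt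
      simp only [hΨ, hΨ', ← ha, WithTop.untopD_coe, terminal_coe, path_apply]
      rw [reward_eq_add hγ hg hlt]
      ring
    · rw [indicator_of_notMem (show ω ∉ {ω | θ ω < M.exit O ω} from hlt),
        min_eq_right (not_lt.1 hlt), reward]
      have : terminal γ (M.value O γ g F) s (M.exit O ω) (M.path ω) =
          terminal γ F s (M.exit O ω) (M.path ω) := by
        rcases eq_or_ne (M.exit O ω) ⊤ with h | h
        · rw [h]; simp
        · have h4 : M.X ((M.exit O ω).untopD 0) ω ∉ O := hω h
          obtain ⟨a, ha⟩ := WithTop.ne_top_iff_exists.1 h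
          rw [← ha] at h4 ⊢
          rw [WithTop.untopD_coe] at h4
          rw [terminal_coe, terminal_coe, path_apply, M.value_of_notMem h4]
      rw [this]
      ring
  rw [integral_congr_ae h3, integral_indicator hA, integral_sub hΨi.integrableOn hΨi'.integrableOn,
    M.setIntegral_reward_shift hγ hg hF hθ s x, sub_self]

/-- The resolvent equation. -/
lemma value_resolvent {α : ℝ} (hα : 0 < α) (hγ : 0 < γ) (hg : IsBoundedMeasurable g)
    (hF : IsBoundedMeasurable F) (q : ℝ≥0 × E) :
    M.value O α g F q =
      M.value O (α + γ) (fun r => g r + γ * M.value O α g F r) F q := by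
  obtain ⟨s, x⟩ := q
  have hV := M.isBoundedMeasurable_value (O := O) hα hg hF
  have hαγ : 0 < α + γ := by linarith
  -- By the pathwise resolvent identity the two sides differ by a discounted time integral of the
  -- value minus the reward of the shifted path.
  have h1 : M.value O (α + γ) (fun r => g r + γ * M.value O α g F r) F (s, x) -
      M.value O α g F (s, x) = ∫ ω, (∫ u in before (M.exit O ω), Real.exp (-(α + γ) * u) *
        (γ * (M.value O α g F (s + u.toNNReal, M.X u.toNNReal ω) -
          reward O α g F (s + u.toNNReal) (shift u.toNNReal (M.path ω))))) ∂(M.P x) := by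
    rw [value, value, ← integral_sub
      (M.integrable_reward hαγ (hg.add (hV.const_mul γ)) hF _ _) (M.integrable_reward hα hg hF _ _)]
    refine integral_congr_ae (Eventually.of_forall fun ω => ?_)
    have h2 := integral_reward_shift (O := O) (F := F) hα hγ hg s (M.path ω)
    have h3 := running_add_fun hαγ hg (hV.const_mul γ) s (M.exit O ω) (M.path ω)
    have h4 : ∀ u : ℝ, Real.exp (-(α + γ) * u) *
        (γ * (M.value O α g F (s + u.toNNReal, M.X u.toNNReal ω) -
          reward O α g F (s + u.toNNReal) (shift u.toNNReal (M.path ω)))) =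
        rate (α + γ) (fun q => γ * M.value O α g F q) s (M.path ω) u -
        γ * Real.exp (-(α + γ) * u) *
          reward O α g F (s + u.toNNReal) (shift u.toNNReal (M.path ω)) := by
      intro u
      simp only [rate, path_apply]
      ring
    simp_rw [h4]
    have h5 : IntegrableOn (fun u : ℝ => γ * Real.exp (-(α + γ) * u) *
          reward O α g F (s + u.toNNReal) (shift u.toNNReal (M.path ω))) (before (M.exit O ω)) := by
      have h6 := isBoundedMeasurable_reward (O := O) hα hg hF
        (measurable_real_toNNReal.const_add s)
        (measurable_shift (measurable_const (a := M.path ω)) measurable_real_toNNReal)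
      obtain ⟨C, -, hC⟩ := h6.exists_bound
      exact (((integrableOn_exp_neg_mul_Ici hαγ).mono_set (before_subset_Ici _)).const_mul
        γ).mul_bdd (c := C) h6.1.aestronglyMeasurable (Eventually.of_forall hC)
    rw [integral_sub (integrableOn_rate hαγ (hV.const_mul γ) s _ (before_subset_Ici _)) h5, h2]
    simp only [reward]
    rw [h3]
    simp only [running]
    ring
  -- After Fubini, each fixed time `u` contributes zero: on the event that `u` precedes the exit,
  -- the Markov property replaces the reward of the shifted path by the value.
  have h2 : ∫ ω, (∫ u in before (M.exit O ω), Real.exp (-(α + γ) * u) *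
        (γ * (M.value O α g F (s + u.toNNReal, M.X u.toNNReal ω) -
          reward O α g F (s + u.toNNReal) (shift u.toNNReal (M.path ω))))) ∂(M.P x) = 0 := by
    set D : ℝ × Ω → ℝ := fun z => γ * (M.value O α g F (s + z.1.toNNReal, M.X z.1.toNNReal z.2) -
          reward O α g F (s + z.1.toNNReal) (shift z.1.toNNReal (M.path z.2))) with hD
    have hDm : IsBoundedMeasurable D := by
      have hu : Measurable fun z : ℝ × Ω => z.1.toNNReal := measurable_fst.real_toNNReal
      have hp : Measurable fun z : ℝ × Ω => M.path z.2 := M.measurable_path.comp measurable_snd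
      exact ((hV.comp ((hu.const_add s).prodMk (measurable_apply hp hu))).sub
        (isBoundedMeasurable_reward (O := O) hα hg hF (hu.const_add s)
          (measurable_shift hp hu))).const_mul γ
    obtain ⟨C, -, hC⟩ := hDm.exists_bound
    set S : Set (ℝ × Ω) := {z | z.1 ∈ before (M.exit O z.2)} with hS
    have hSm : MeasurableSet S :=
      (measurable_fst measurableSet_Ici).inter (measurableSet_lt
        (measurable_fst.real_toNNReal.withTop_coe) ((M.measurable_exit O).comp measurable_snd))
    set ν : Measure ℝ := volume.restrict (Ici 0) with hν
    have hint : Integrable (Function.uncurry fun u ω =>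
        S.indicator (fun z => Real.exp (-(α + γ) * z.1) * D z) (u, ω)) (ν.prod (M.P x)) := by
      refine Integrable.indicator ?_ hSm
      have h3 : Integrable (fun z : ℝ × Ω => Real.exp (-(α + γ) * z.1) * (1 : ℝ))
          (ν.prod (M.P x)) :=
        Integrable.mul_prod (integrableOn_exp_neg_mul_Ici hαγ) (integrable_const (1 : ℝ))
      simp only [mul_one] at h3
      exact h3.mul_bdd (c := C) hDm.1.aestronglyMeasurable (Eventually.of_forall hC)
    have h3 : ∀ ω, ∫ u in before (M.exit O ω), Real.exp (-(α + γ) * u) * D (u, ω) =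
        ∫ u, S.indicator (fun z => Real.exp (-(α + γ) * z.1) * D z) (u, ω) ∂ν := by
      intro ω
      have h4 : (fun u => S.indicator (fun z => Real.exp (-(α + γ) * z.1) * D z) (u, ω)) =
        (before (M.exit O ω)).indicator fun u => Real.exp (-(α + γ) * u) * D (u, ω) := rfl
      rw [h4, integral_indicator (measurableSet_before _), hν,
        Measure.restrict_restrict (measurableSet_before _),
        inter_eq_left.2 (before_subset_Ici _)]
    simp_rw [hD] at h3
    simp_rw [h3]
    rw [← integral_integral_swap hint]
    refine setIntegral_eq_zero_of_forall_eq_zero fun u hu => ?_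
    have h4 : (fun ω => S.indicator (fun z => Real.exp (-(α + γ) * z.1) * D z) (u, ω)) =
        {ω | ((u.toNNReal : ℝ≥0) : WithTop ℝ≥0) < M.exit O ω}.indicator
          fun ω => Real.exp (-(α + γ) * u) * D (u, ω) := by
      ext ω
      refine indicator_eq_indicator ?_ rfl
      exact and_iff_right hu
    rw [h4, integral_indicator (measurableSet_lt measurable_const (M.measurable_exit O)),
      integral_const_mul]
    refine mul_eq_zero_of_right _ ?_
    have h5 := M.setIntegral_reward_shift (O := O) hα hg hF
      (isStoppingTime_const M.filtration u.toNNReal) s x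
    simp only [WithTop.untopD_coe, integral_const_mul] at h5
    have h6 := mul_left_cancel₀ (Real.exp_pos _).ne' h5
    simp only [hD, integral_const_mul]
    rw [integral_sub, h6, sub_self, mul_zero]
    · exact ((hV.comp (measurable_const.prodMk (M.measurable_X _))).integrable _).integrableOn
    · exact ((isBoundedMeasurable_reward (O := O) hα hg hF measurable_const
        (measurable_shift M.measurable_path measurable_const)).integrable _).integrableOn
  rw [h2] at h1
  linarith

end StandardMarkovProcess

end

/-! ### ### The penalized equation: existence, uniqueness and comparison -/

noncomputable section

/-- Iterating the improvement gives the bound κ^n times the initial one. It serves as a maximum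
principle that needs no attained maximum. -/
lemma nonpos_of_contraction {S : Type*} {u : S → ℝ} {κ : ℝ} (hκ0 : 0 ≤ κ) (hκ : κ < 1)
    (hu : ∃ B, ∀ q, u q ≤ B)
    (h : ∀ C, 0 ≤ C → (∀ q, u q ≤ C) → ∀ q, u q ≤ κ * C) (q : S) : u q ≤ 0 := by
  obtain ⟨B, hB⟩ := hu
  have key : ∀ n : ℕ, ∀ q, u q ≤ κ ^ n * max B 0 := by
    intro n
    induction n with
    | zero => exact fun q => by simpa using Or.inl (hB q)
    | succ n ih =>
      intro q
      rw [pow_succ', mul_assoc]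
      exact h _ (by positivity) ih q
  have hlim : Tendsto (fun n : ℕ => κ ^ n * max B 0) atTop (𝓝 0) := by
    simpa using (tendsto_pow_atTop_nhds_zero_of_lt_one hκ0 hκ).mul_const (max B 0)
  exact ge_of_tendsto' hlim fun n => key n q

namespace StandardMarkovProcess

set_option linter.unusedSectionVars false

open RCPath

variable {E Ω : Type*} [MetricSpace E] [SecondCountableTopology E] [MeasurableSpace E]
  [BorelSpace E] [mΩ : MeasurableSpace Ω] (M : StandardMarkovProcess E Ω)

lemma functional_eq {O : Set E} (hO : IsOpen O) (α : ℝ) (f F : ℝ≥0 × E → ℝ) (q : ℝ≥0 × E)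
    (τ : Ω → WithTop ℝ≥0) : M.functional O α f F q τ =
      ∫ ω, (running α f q.1 (min (τ ω) (M.exit O ω)) (M.path ω) +
        terminal α F q.1 (min (τ ω) (M.exit O ω)) (M.path ω)) ∂(M.P q.2) := by
  refine integral_congr_ae ?_
  filter_upwards [M.ae_exitTime_eq hO q.2] with ω hω
  rw [hω]
  rfl

lemma isPenalizedSolution_iff {O : Set E} (hO : IsOpen O) {α : ℝ} {f F : ℝ≥0 × E → ℝ} {β : ℝ}
    {w : ℝ≥0 × E → ℝ} : M.IsPenalizedSolution O α f F β w ↔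
      IsBoundedMeasurable w ∧
        ∀ q, w q = M.value O α (fun r => f r + β * max (F r - w r) 0) F q := by
  have key : ∀ q : ℝ≥0 × E, M.value O α (fun r => f r + β * max (F r - w r) 0) F q =
      ∫ ω, (M.runningReward α (fun q => f q + β * max (F q - w q) 0) q.1 (M.exitTime O ω) ω +
        M.terminalReward α F q.1 (M.exitTime O ω) ω) ∂(M.P q.2) := by
    intro q
    refine integral_congr_ae ?_
    filter_upwards [M.ae_exitTime_eq hO q.2] with ω hω
    rw [hω]
    rfl
  rw [IsPenalizedSolution, IsBoundedMeasurable, and_assoc]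
  simp only [key, Prod.forall]

section Penalization

variable {O : Set E} {α β : ℝ} {f F w : ℝ≥0 × E → ℝ}

lemma isBoundedMeasurable_penalty (hf : IsBoundedMeasurable f) (hF : IsBoundedMeasurable F)
    (hw : IsBoundedMeasurable w) (β : ℝ) :
    IsBoundedMeasurable fun r => f r + β * max (F r - w r) 0 :=
  hf.add (((hF.sub hw).max (.const 0)).const_mul β)

lemma isBoundedMeasurable_penalty_max (hf : IsBoundedMeasurable f) (hF : IsBoundedMeasurable F)
    (hw : IsBoundedMeasurable w) (β : ℝ) :
    IsBoundedMeasurable fun r => f r + β * max (F r) (w r) :=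
  hf.add ((hF.max hw).const_mul β)

lemma penalty_add_mul (β : ℝ) (r : ℝ≥0 × E) :
    f r + β * max (F r - w r) 0 + β * w r = f r + β * max (F r) (w r) := by
  rw [add_assoc, ← mul_add, ← max_add_add_right, sub_add_cancel, zero_add]

/-- The penalized equation as a fixed point equation for a contraction. -/
lemma penalized_iff (hα : 0 < α) (hβ : 0 < β) (hf : IsBoundedMeasurable f)
    (hF : IsBoundedMeasurable F) (hw : IsBoundedMeasurable w) :
    (∀ q, w q = M.value O α (fun r => f r + β * max (F r - w r) 0) F q) ↔
      ∀ q, w q = M.value O (α + β) (fun r => f r + β * max (F r) (w r)) F q := by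
  have hαβ : 0 < α + β := by linarith
  have hg := isBoundedMeasurable_penalty hf hF hw β
  have hV := M.isBoundedMeasurable_value (O := O) hα hg hF
  constructor
  · intro h q
    have h1 := M.value_resolvent (O := O) hα hβ hg hF q
    rw [← h q] at h1
    rw [h1]
    congr 1
    ext r
    rw [← h r, penalty_add_mul]
  · intro h
    -- Both terms are values at rate `α + β` (by hypothesis and by the resolvent equation), and
    -- their running rates differ by β times this same difference. Hence its sup norm is at most
    -- β/(α+β) times itself.
    have key : ∀ q, |w q - M.value O α (fun r => f r + β * max (F r - w r) 0) F q| ≤ 0 := by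
      refine nonpos_of_contraction (κ := β / (α + β)) (by positivity)
        ((div_lt_one hαβ).2 (by linarith)) (hw.sub hV).2 fun C hC0 hC q => ?_
      have h2 : M.value O (α + β) (fun r => f r + β * max (F r) (w r)) F q -
          M.value O (α + β) (fun r => f r + β * max (F r - w r) 0 +
            β * M.value O α (fun r => f r + β * max (F r - w r) 0) F r) F q =
          w q - M.value O α (fun r => f r + β * max (F r - w r) 0) F q := by
        rw [← h q, ← M.value_resolvent hα hβ hg hF q]
      rw [← h2, div_mul_eq_mul_div]
      refine M.abs_value_sub_le hαβ (isBoundedMeasurable_penalty_max hf hF hw β)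
        (hg.add (hV.const_mul β)) hF (by positivity) (fun r => ?_) q
      rw [← penalty_add_mul, add_sub_add_left_eq_sub, ← mul_sub, abs_mul, abs_of_pos hβ]
      exact mul_le_mul_of_nonneg_left (hC r) hβ.le
    exact fun q => sub_eq_zero.1 (abs_nonpos_iff.1 (key q))

/-- Comparison of penalized solutions. -/
lemma penalized_mono {β₁ β₂ : ℝ} {w₁ w₂ : ℝ≥0 × E → ℝ} (hα : 0 < α) (hβ₁ : 0 < β₁)
    (hβ : β₁ ≤ β₂) (hf : IsBoundedMeasurable f) (hF : IsBoundedMeasurable F)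
    (hw₁ : IsBoundedMeasurable w₁) (hw₂ : IsBoundedMeasurable w₂)
    (h₁ : ∀ q, w₁ q = M.value O α (fun r => f r + β₁ * max (F r - w₁ r) 0) F q)
    (h₂ : ∀ q, w₂ q = M.value O α (fun r => f r + β₂ * max (F r - w₂ r) 0) F q)
    (q : ℝ≥0 × E) : w₁ q ≤ w₂ q := by
  have hβ₂ : 0 < β₂ := hβ₁.trans_le hβ
  have hαβ : 0 < α + β₂ := by linarith
  have hg := isBoundedMeasurable_penalty hf hF hw₁ β₁
  have h₂' := (M.penalized_iff hα hβ₂ hf hF hw₂).1 h₂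
  -- Both solutions are written at the common rate `α + β₂`, so that their running rates can be
  -- compared directly.
  have h₁' : ∀ q, w₁ q =
      M.value O (α + β₂) (fun r => f r + β₁ * max (F r - w₁ r) 0 + β₂ * w₁ r) F q := by
    intro q
    have h := M.value_resolvent (O := O) hα hβ₂ hg hF q
    simpa only [← h₁] using h
  refine sub_nonpos.1 (nonpos_of_contraction (u := fun q => w₁ q - w₂ q) (κ := β₂ / (α + β₂))
    (by positivity) ((div_lt_one hαβ).2 (by linarith))
    ((hw₁.sub hw₂).2.imp fun C h q => (le_abs_self _).trans (h q)) (fun C hC0 hC q => ?_) q)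
  have hm := isBoundedMeasurable_penalty_max hf hF hw₂ β₂
  -- An excess `C` of `w₁` over `w₂` raises the running rate by at most `β₂ * C`, which is worth at
  -- most β₂C/(α+β₂): this is the contraction.
  have h3 : w₁ q ≤ M.value O (α + β₂) (fun r => f r + β₂ * max (F r) (w₂ r) + β₂ * C) F q := by
    rw [h₁' q]
    refine M.value_mono hαβ (hg.add (hw₁.const_mul β₂)) (hm.add (.const _)) hF (fun r => ?_) q
    have h4 : β₁ * max (F r - w₁ r) 0 ≤ β₂ * max (F r - w₁ r) 0 := by gcongr
    have h5 := penalty_add_mul (f := f) (F := F) (w := w₁) β₂ r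
    have h6 : max (F r) (w₁ r) ≤ max (F r) (w₂ r) + C := by
      have := hC r
      refine max_le ?_ ?_
      · have := le_max_left (F r) (w₂ r); linarith
      · have := le_max_right (F r) (w₂ r); linarith
    have h7 := mul_le_mul_of_nonneg_left h6 hβ₂.le
    linarith
  have h8 := M.abs_value_sub_le (O := O) hαβ (hm.add (.const (β₂ * C))) hm hF
    (C := β₂ * C) (by positivity) (fun r => by simp [abs_of_nonneg, hβ₂.le, hC0]) q
  rw [← h₂' q] at h8
  have h9 := (abs_le.1 h8).2
  rw [div_mul_eq_mul_div]
  linarith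

lemma penalized_unique {w₁ w₂ : ℝ≥0 × E → ℝ} (hα : 0 < α) (hβ : 0 < β)
    (hf : IsBoundedMeasurable f) (hF : IsBoundedMeasurable F)
    (hw₁ : IsBoundedMeasurable w₁) (hw₂ : IsBoundedMeasurable w₂)
    (h₁ : ∀ q, w₁ q = M.value O α (fun r => f r + β * max (F r - w₁ r) 0) F q)
    (h₂ : ∀ q, w₂ q = M.value O α (fun r => f r + β * max (F r - w₂ r) 0) F q) : w₁ = w₂ :=
  funext fun q => le_antisymm (M.penalized_mono hα hβ le_rfl hf hF hw₁ hw₂ h₁ h₂ q)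
    (M.penalized_mono hα hβ le_rfl hf hF hw₂ hw₁ h₂ h₁ q)

/-- The iterates which approximate the solution of the penalized equation. -/
def penalizedIterate (O : Set E) (α β : ℝ) (f F : ℝ≥0 × E → ℝ) : ℕ → ℝ≥0 × E → ℝ
  | 0 => fun _ => 0
  | n + 1 => M.value O (α + β)
      (fun r => f r + β * max (F r) (penalizedIterate O α β f F n r)) F

lemma isBoundedMeasurable_penalizedIterate (hα : 0 < α) (hβ : 0 < β)
    (hf : IsBoundedMeasurable f) (hF : IsBoundedMeasurable F) (n : ℕ) :
    IsBoundedMeasurable (M.penalizedIterate O α β f F n) := by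
  induction n with
  | zero => exact .const 0
  | succ n ih =>
    exact M.isBoundedMeasurable_value (by linarith) (isBoundedMeasurable_penalty_max hf hF ih β) hF

lemma abs_penalty_max_sub_le (hβ : 0 < β) {w₁ w₂ : ℝ≥0 × E → ℝ} {C : ℝ} {r : ℝ≥0 × E}
    (h : |w₁ r - w₂ r| ≤ C) :
    |f r + β * max (F r) (w₁ r) - (f r + β * max (F r) (w₂ r))| ≤ β * C := by
  rw [add_sub_add_left_eq_sub, ← mul_sub, abs_mul, abs_of_pos hβ]
  refine mul_le_mul_of_nonneg_left ((abs_max_sub_max_le_max _ _ _ _).trans ?_) hβ.le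
  simpa using h

/-- Picard iteration with geometric error bounds. Uniform convergence of the iterates is recorded
because it later transfers their continuity to the solution. -/
lemma exists_penalized_fixedPoint (hα : 0 < α) (hβ : 0 < β)
    (hf : IsBoundedMeasurable f) (hF : IsBoundedMeasurable F) :
    ∃ w, IsBoundedMeasurable w ∧
      (∀ q, w q = M.value O (α + β) (fun r => f r + β * max (F r) (w r)) F q) ∧
      TendstoUniformly (M.penalizedIterate O α β f F) w atTop := by
  have hαβ : 0 < α + β := by linarith
  set κ : ℝ := β / (α + β) with hκ
  have hκ0 : 0 ≤ κ := by positivity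
  have hκ1 : κ < 1 := (div_lt_one hαβ).2 (by linarith)
  set W := M.penalizedIterate O α β f F with hW
  have hWm : ∀ n, IsBoundedMeasurable (W n) := M.isBoundedMeasurable_penalizedIterate hα hβ hf hF
  obtain ⟨K, hK0, hK⟩ := ((hWm 1).sub (hWm 0)).exists_bound
  have hstep : ∀ n q, |W (n + 1) q - W n q| ≤ K * κ ^ n := by
    intro n
    induction n with
    | zero => simpa using hK
    | succ n ih =>
      intro q
      have := M.abs_value_sub_le (O := O) hαβ (isBoundedMeasurable_penalty_max hf hF (hWm (n + 1)) β)
        (isBoundedMeasurable_penalty_max hf hF (hWm n) β) hF (C := β * (K * κ ^ n)) (by positivity)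
        (fun r => abs_penalty_max_sub_le hβ (ih r)) q
      refine this.trans (le_of_eq ?_)
      rw [hκ, pow_succ]
      ring
  have hdist : ∀ q n, dist (W n q) (W (n + 1) q) ≤ K * κ ^ n := fun q n => by
    rw [dist_comm]; exact hstep n q
  have hlim : ∀ q, ∃ l, Tendsto (fun n => W n q) atTop (𝓝 l) := fun q =>
    cauchySeq_tendsto_of_complete (cauchySeq_of_le_geometric κ K hκ1 (hdist q))
  choose w hw using hlim
  have hbound : ∀ n q, |W n q - w q| ≤ K * κ ^ n / (1 - κ) := fun n q =>
    dist_le_of_le_geometric_of_tendsto κ K hκ1 (hdist q) (hw q) n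
  have hwm : IsBoundedMeasurable w := by
    refine ⟨measurable_of_tendsto_metrizable (fun n => (hWm n).1) (tendsto_pi_nhds.2 hw),
      K * κ ^ 0 / (1 - κ), fun q => ?_⟩
    have := hbound 0 q
    rwa [hW, penalizedIterate, zero_sub, abs_neg] at this
  have hzero : Tendsto (fun n : ℕ => K * κ ^ n / (1 - κ)) atTop (𝓝 0) := by
    simpa using ((tendsto_pow_atTop_nhds_zero_of_lt_one hκ0 hκ1).const_mul K).div_const (1 - κ)
  refine ⟨w, hwm, fun q => ?_, ?_⟩
  · refine tendsto_nhds_unique ((tendsto_add_atTop_iff_nat 1).2 (hw q)) ?_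
    rw [tendsto_iff_dist_tendsto_zero]
    refine squeeze_zero (fun _ => dist_nonneg) (fun n => ?_)
      (by simpa using (hzero.const_mul β).div_const (α + β))
    have h1κ : 0 < 1 - κ := by linarith
    exact M.abs_value_sub_le hαβ (isBoundedMeasurable_penalty_max hf hF (hWm n) β)
        (isBoundedMeasurable_penalty_max hf hF hwm β) hF (by positivity)
        (fun r => abs_penalty_max_sub_le hβ (hbound n r)) q
  · rw [Metric.tendstoUniformly_iff]
    intro ε hε
    filter_upwards [hzero.eventually_lt_const hε] with n hn q
    rw [dist_comm]
    exact (hbound n q).trans_lt hn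

end Penalization

end StandardMarkovProcess

end

/-! ### ### Continuity of expected rewards and of penalized solutions -/

noncomputable section

/-- The supremum of the tail of a sequence. -/
def tailSup (a : ℕ → ℝ) (N : ℕ) : ℝ := ⨆ n, a (N + n)

lemma tailSup_le {a : ℕ → ℝ} {C : ℝ} (N : ℕ) (h : ∀ n, N ≤ n → a n ≤ C) : tailSup a N ≤ C :=
  ciSup_le fun n => h _ (Nat.le_add_right N n)

lemma le_tailSup {a : ℕ → ℝ} {C : ℝ} (h : ∀ n, a n ≤ C) {N n : ℕ} (hn : N ≤ n) :
    a n ≤ tailSup a N := by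
  obtain ⟨k, rfl⟩ := Nat.exists_eq_add_of_le hn
  exact le_ciSup (f := fun k => a (N + k)) ⟨C, by rintro _ ⟨k, rfl⟩; exact h _⟩ k

lemma tendsto_tailSup {a : ℕ → ℝ} (h0 : ∀ n, 0 ≤ a n) (h : Tendsto a atTop (𝓝 0)) :
    Tendsto (tailSup a) atTop (𝓝 0) := by
  refine tendsto_order.2 ⟨fun c hc => Eventually.of_forall fun N => hc.trans_le
    (Real.iSup_nonneg fun n => h0 _), fun c hc => ?_⟩
  obtain ⟨N, hN⟩ := eventually_atTop.1 (h.eventually_le_const (half_pos hc))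
  filter_upwards [eventually_ge_atTop N] with M hM
  exact (tailSup_le M fun n hn => hN n (hM.trans hn)).trans_lt (half_lt_self hc)

lemma IsBoundedMeasurable.tailSup {S : Type*} [MeasurableSpace S] {g : ℕ → S → ℝ} {C : ℝ}
    (hg : ∀ n, Measurable (g n)) (hC : ∀ n q, |g n q| ≤ C) (N : ℕ) :
    IsBoundedMeasurable fun q => _root_.tailSup (fun n => g n q) N :=
  ⟨Measurable.iSup fun _ => hg _, C, fun q => abs_le.2
    ⟨(abs_le.1 (hC N q)).1.trans (le_tailSup (a := fun n => g n q)
      (fun n => (le_abs_self _).trans (hC n q)) le_rfl),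
      tailSup_le _ fun n _ => (le_abs_self _).trans (hC n q)⟩⟩

lemma ContinuousInTimeUniformlyOnCompacts.continuous {E : Type*} [TopologicalSpace E]
    {g : ℝ≥0 × E → ℝ} (hg : ContinuousInTimeUniformlyOnCompacts g) (y : E) :
    Continuous fun r => g (r, y) :=
  continuous_iff_continuousAt.2 fun s =>
    (hg {y} isCompact_singleton s).tendsto_at (mem_singleton y)

namespace RCPath

variable {E : Type*} [MetricSpace E] [SecondCountableTopology E] [MeasurableSpace E]
  [BorelSpace E] {O : Set E} {γ : ℝ}

omit [SecondCountableTopology E] in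
lemma tendsto_running (hγ : 0 < γ) {g : ℕ → ℝ≥0 × E → ℝ} {g' : ℝ≥0 × E → ℝ} {C : ℝ}
    (hg : ∀ n, Measurable (g n)) (hC : ∀ n q, |g n q| ≤ C) {s : ℕ → ℝ≥0} {s' : ℝ≥0}
    {T : WithTop ℝ≥0} {p : RCPath E}
    (h : ∀ u : ℝ≥0, u < T → Tendsto (fun n => g n (s n + u, p u)) atTop (𝓝 (g' (s' + u, p u)))) :
    Tendsto (fun n => running γ (g n) (s n) T p) atTop (𝓝 (running γ g' s' T p)) := by
  refine tendsto_integral_of_dominated_convergence (fun u : ℝ => C * Real.exp (-γ * u))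
    (fun n => (measurable_rate (hg n) measurable_const measurable_const
      measurable_id).aestronglyMeasurable)
    (((integrableOn_exp_neg_mul_Ici hγ).mono_set (before_subset_Ici T)).const_mul C)
    (fun n => Eventually.of_forall fun u => abs_rate_le (hC n) _ _ _) ?_
  filter_upwards [ae_restrict_mem (measurableSet_before T)] with u hu
  exact (h _ hu.2).const_mul _

end RCPath

namespace StandardMarkovProcess

set_option linter.unusedSectionVars false

open RCPath

variable {E Ω : Type*} [MetricSpace E] [SecondCountableTopology E] [MeasurableSpace E]
  [BorelSpace E] [mΩ : MeasurableSpace Ω] (M : StandardMarkovProcess E Ω)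

/-- Locally uniformly on `O`, the process does not leave `O` quickly. -/
def NoQuickExit (O : Set E) : Prop :=
  ∀ x₀ ∈ O, ∀ η : ℝ, 0 < η → ∃ ε : ℝ≥0, 0 < ε ∧
    ∀ᶠ x in 𝓝 x₀, (M.P x).real {ω | M.exit O ω ≤ ε} ≤ η

lemma noQuickExit_univ : M.NoQuickExit univ := by
  refine fun x₀ _ η hη => ⟨1, one_pos, Eventually.of_forall fun x => ?_⟩
  have : {ω | M.exit univ ω ≤ ((1 : ℝ≥0) : WithTop ℝ≥0)} = ∅ := by
    ext ω
    have h := exitTime_univ (M.path ω)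
    simp only [mem_ofPred_eq, mem_empty_iff_false, iff_false, h]
    exact not_le.2 (WithTop.coe_lt_top _)
  rw [this]
  simpa using hη.le

variable {O : Set E} {γ : ℝ}

lemma tendsto_value (hγ : 0 < γ) {g G : ℕ → ℝ≥0 × E → ℝ} {g' G' : ℝ≥0 × E → ℝ}
    (hg : ∀ n, Measurable (g n)) (hG : ∀ n, Measurable (G n)) {C : ℝ}
    (hgC : ∀ n q, |g n q| ≤ C) (hGC : ∀ n q, |G n q| ≤ C)
    (h : ∀ r, ∀ y ∈ O, Tendsto (fun n => g n (r, y)) atTop (𝓝 (g' (r, y))))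
    (h' : ∀ q, Tendsto (fun n => G n q) atTop (𝓝 (G' q))) (q : ℝ≥0 × E) :
    Tendsto (fun n => M.value O γ (g n) (G n) q) atTop (𝓝 (M.value O γ g' G' q)) := by
  have hC0 : 0 ≤ C := (abs_nonneg _).trans (hgC 0 q)
  refine tendsto_integral_of_dominated_convergence (fun _ => C / γ + C)
    (fun n => (measurable_reward (hg n) (hG n) measurable_const
      M.measurable_path).aestronglyMeasurable) (integrable_const _)
    (fun n => Eventually.of_forall fun ω => abs_reward_le hγ hC0 (hgC n) hC0 (hGC n) _ _)
    (Eventually.of_forall fun ω => ?_)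
  refine (tendsto_running hγ (s := fun _ => q.1) hg hgC fun u hu =>
    h _ _ (mem_of_lt_exitTime hu)).add ?_
  generalize RCPath.exitTime O (M.path ω) = T
  cases T with
  | top => simp
  | coe a =>
    simp only [terminal_coe]
    exact (h' _).const_mul _

/-- The expected reward is approximated by its strong Feller regularization. -/
lemma abs_value_sub_integral_le (hO : IsOpen O) (hγ : 0 < γ) {g F : ℝ≥0 × E → ℝ}
    (hg : IsBoundedMeasurable g) (hF : IsBoundedMeasurable F) {C D : ℝ} (hC0 : 0 ≤ C)
    (hC : ∀ q, |g q| ≤ C) (hD0 : 0 ≤ D) (hD : ∀ q, |M.value O γ g F q| ≤ D) (s ε : ℝ≥0) (x : E) :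
    |M.value O γ g F (s, x) -
        ∫ ω, Real.exp (-γ * ε) * M.value O γ g F (s + ε, M.X ε ω) ∂(M.P x)| ≤
      C * ε + 2 * D * (M.P x).real {ω | M.exit O ω ≤ ε} := by
  have hV := M.isBoundedMeasurable_value (O := O) hγ hg hF
  have hmin : Measurable fun ω => min (ε : WithTop ℝ≥0) (M.exit O ω) :=
    measurable_const.min (M.measurable_exit O)
  have hS : MeasurableSet {ω | M.exit O ω ≤ ε} := M.measurable_exit O measurableSet_Iic
  have hi1 := ((isBoundedMeasurable_running hγ hg (measurable_const (a := s)) hmin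
    M.measurable_path).add (isBoundedMeasurable_terminal hγ.le hV (measurable_const (a := s)) hmin
    M.measurable_path)).integrable (M.P x)
  have hi2 : Integrable (fun ω => Real.exp (-γ * ε) * M.value O γ g F (s + ε, M.X ε ω)) (M.P x) :=
    ((hV.comp (measurable_const.prodMk (M.measurable_X ε))).const_mul _).integrable _
  have hexp : Real.exp (-γ * ε) ≤ 1 := Real.exp_le_one_iff.2 (by
    have := mul_nonneg hγ.le ε.coe_nonneg; linarith)
  -- Stopped at `ε` or at the exit, the running part is at most `C * ε`. The terminal part differs
  -- from the regularization only if the exit comes by time `ε`, and then by at most `2 * D`.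
  rw [M.value_eq_stopped hO hγ hg hF (isStoppingTime_const M.filtration ε) s x,
    ← integral_sub hi1 hi2]
  have hi3 : Integrable ({ω | M.exit O ω ≤ ε}.indicator fun _ => 2 * D) (M.P x) :=
    (integrable_const _).indicator hS
  have hb : ∫ ω, (C * ε + {ω | M.exit O ω ≤ ε}.indicator (fun _ => 2 * D) ω) ∂(M.P x) =
      C * ε + 2 * D * (M.P x).real {ω | M.exit O ω ≤ ε} := by
    rw [integral_add (integrable_const _) hi3, integral_indicator_const _ hS]
    simp [mul_comm]
  rw [← hb]
  rw [← Real.norm_eq_abs]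
  refine norm_integral_le_of_norm_le ((integrable_const _).add hi3) (Eventually.of_forall fun ω => ?_)
  rw [Real.norm_eq_abs, add_sub_assoc]
  refine (abs_add_le _ _).trans (add_le_add
    (abs_running_le_mul hγ.le hC0 hC s (min_le_left _ _) _) ?_)
  by_cases h : M.exit O ω ≤ ε
  · rw [indicator_of_mem (show ω ∈ {ω | M.exit O ω ≤ ε} from h), two_mul]
    refine (abs_sub _ _).trans (add_le_add (abs_terminal_le hγ.le hD0 hD _ _ _) ?_)
    rw [abs_mul, abs_of_pos (Real.exp_pos _)]
    calc _ ≤ 1 * D := mul_le_mul hexp (hD _) (abs_nonneg _) zero_le_one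
      _ = D := one_mul D
  · rw [indicator_of_notMem (show ω ∉ {ω | M.exit O ω ≤ ε} from h), min_eq_left (not_le.1 h).le,
      terminal_coe, path_apply, sub_self, abs_zero]

/-- A locally uniform approximation by strong Feller functions: near `x₀` the error is small because
both `ε` and the exit probability are. -/
lemma continuousAt_value (hO : IsOpen O) (hA3 : M.StrongFeller) (hexit : M.NoQuickExit O)
    (hγ : 0 < γ) {g F : ℝ≥0 × E → ℝ} (hg : IsBoundedMeasurable g) (hF : IsBoundedMeasurable F)
    (s : ℝ≥0) {x₀ : E} (hx₀ : x₀ ∈ O) : ContinuousAt (fun x => M.value O γ g F (s, x)) x₀ := by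
  have hV := M.isBoundedMeasurable_value (O := O) hγ hg hF
  obtain ⟨C, hC0, hC⟩ := hg.exists_bound
  obtain ⟨D, hD0, hD⟩ := hV.exists_bound
  refine continuousAt_of_locally_uniform_approx_of_continuousAt fun U hU => ?_
  obtain ⟨η, hη, hηU⟩ := Metric.mem_uniformity_dist.1 hU
  -- The error is at most `C + 2 * D` times the common small bound on time and exit probability; the
  -- extra 1 keeps the divisor positive.
  have hK : 0 < C + 2 * D + 1 := by positivity
  obtain ⟨ε, hε, hx⟩ := hexit x₀ hx₀ (η / 2 / (C + 2 * D + 1)) (by positivity)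
  set δ : ℝ≥0 := min ε (Real.toNNReal (η / 2 / (C + 2 * D + 1))) with hδ
  have hδ0 : 0 < δ := lt_min hε (Real.toNNReal_pos.2 (by positivity))
  have hδ1 : (δ : ℝ) ≤ η / 2 / (C + 2 * D + 1) := by
    have : δ ≤ Real.toNNReal (η / 2 / (C + 2 * D + 1)) := min_le_right _ _
    calc (δ : ℝ) ≤ (Real.toNNReal (η / 2 / (C + 2 * D + 1)) : ℝ) := by exact_mod_cast this
      _ = _ := Real.coe_toNNReal _ (by positivity)
  refine ⟨_, hx, fun x => ∫ ω, Real.exp (-γ * δ) * M.value O γ g F (s + δ, M.X δ ω) ∂(M.P x),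
    ?_, fun x hx => hηU ?_⟩
  · have h1 := (hV.comp (measurable_prodMk_left (x := s + δ))).const_mul (Real.exp (-γ * δ))
    exact (hA3 δ hδ0 _ h1.1 h1.2).continuousAt
  · rw [Real.dist_eq]
    have h1 := M.abs_value_sub_integral_le hO hγ hg hF hC0 hC hD0 hD s δ x
    have h2 : (M.P x).real {ω | M.exit O ω ≤ δ} ≤ (M.P x).real {ω | M.exit O ω ≤ ε} :=
      measureReal_mono (fun ω (hω : M.exit O ω ≤ δ) =>
        show M.exit O ω ≤ ε from hω.trans (WithTop.coe_le_coe.2 (min_le_left _ _)))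
    have h3 : (M.P x).real {ω | M.exit O ω ≤ δ} ≤ η / 2 / (C + 2 * D + 1) := h2.trans hx
    have h4 : C * δ + 2 * D * (M.P x).real {ω | M.exit O ω ≤ δ} ≤
        (C + 2 * D) * (η / 2 / (C + 2 * D + 1)) := by
      rw [add_mul]; gcongr
    have h5 : (C + 2 * D) * (η / 2 / (C + 2 * D + 1)) ≤ η / 2 := by
      rw [mul_div_assoc', div_le_iff₀ hK]
      nlinarith
    linarith

/-- The time increment is dominated by one value function at time 0, so a time estimate becomes a
statement about a function of `x` alone. -/
lemma abs_value_time_sub_le (hγ : 0 < γ) {g F G H : ℝ≥0 × E → ℝ} (hg : IsBoundedMeasurable g)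
    (hF : IsBoundedMeasurable F) (hG : IsBoundedMeasurable G) (hH : IsBoundedMeasurable H)
    {s t : ℝ≥0} (h : ∀ u, ∀ y ∈ O, |g (t + u, y) - g (s + u, y)| ≤ G (u, y))
    (h' : ∀ u y, |F (t + u, y) - F (s + u, y)| ≤ H (u, y)) (x : E) :
    |M.value O γ g F (t, x) - M.value O γ g F (s, x)| ≤ M.value O γ G H (0, x) := by
  rw [value, value, ← integral_sub (M.integrable_reward hγ hg hF _ _)
    (M.integrable_reward hγ hg hF _ _), ← Real.norm_eq_abs]
  refine norm_integral_le_of_norm_le (M.integrable_reward hγ hG hH _ _)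
    (Eventually.of_forall fun ω => ?_)
  rw [Real.norm_eq_abs, reward, reward, reward, add_sub_add_comm]
  refine (abs_add_le _ _).trans (add_le_add ?_ ?_)
  · rw [running, running, running, ← integral_sub
      (integrableOn_rate hγ hg _ _ (before_subset_Ici _))
      (integrableOn_rate hγ hg _ _ (before_subset_Ici _)), ← Real.norm_eq_abs]
    refine norm_integral_le_of_norm_le (integrableOn_rate hγ hG _ _ (before_subset_Ici _)) ?_
    filter_upwards [ae_restrict_mem (measurableSet_before _)] with u hu
    rw [Real.norm_eq_abs, rate, rate, rate, ← mul_sub, abs_mul, abs_of_pos (Real.exp_pos _),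
      zero_add]
    exact mul_le_mul_of_nonneg_left (h _ _ (mem_of_lt_exitTime hu.2)) (Real.exp_pos _).le
  · generalize RCPath.exitTime O (M.path ω) = T
    cases T with
    | top => simp
    | coe a =>
      simp only [terminal_coe]
      rw [← mul_sub, abs_mul, abs_of_pos (Real.exp_pos _), zero_add]
      exact mul_le_mul_of_nonneg_left (h' _ _) (Real.exp_pos _).le

/-- Along a sequence (s_n, x_n), all time increments with n ≥ N are dominated by the value of the
tail suprema from N on. This value is continuous in x for fixed N and tends to 0 at x₀ as N grows;
one N thus controls all later n near x₀. Spatial continuity at the fixed time `s` handles the rest.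
-/
lemma continuousOn_value (hO : IsOpen O) (hA3 : M.StrongFeller) (hexit : M.NoQuickExit O)
    (hγ : 0 < γ) {g F : ℝ≥0 × E → ℝ} (hg : IsBoundedMeasurable g) (hF : IsBoundedMeasurable F)
    (hgc : ∀ y ∈ O, Continuous fun r => g (r, y)) (hFc : ∀ y, Continuous fun r => F (r, y)) :
    ContinuousOn (M.value O γ g F) (univ ×ˢ O) := by
  rintro ⟨s, x₀⟩ ⟨-, hx₀⟩
  refine ContinuousAt.continuousWithinAt (tendsto_of_seq_tendsto fun q hq => ?_)
  obtain ⟨C, hC0, hC⟩ := hg.exists_bound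
  obtain ⟨D, hD0, hD⟩ := hF.exists_bound
  have hs : Tendsto (fun n => (q n).1) atTop (𝓝 s) := (continuous_fst.tendsto _).comp hq
  have hx : Tendsto (fun n => (q n).2) atTop (𝓝 x₀) := (continuous_snd.tendsto _).comp hq
  set a : ℕ → ℝ≥0 × E → ℝ := fun n r =>
    (univ ×ˢ O).indicator (fun r => |g ((q n).1 + r.1, r.2) - g (s + r.1, r.2)|) r with ha
  set b : ℕ → ℝ≥0 × E → ℝ := fun n r => |F ((q n).1 + r.1, r.2) - F (s + r.1, r.2)| with hb
  have hcomp : ∀ (k : ℝ≥0 × E → ℝ) (_ : Measurable k) (t : ℝ≥0),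
      Measurable fun r : ℝ≥0 × E => k (t + r.1, r.2) := fun k hk t =>
    hk.comp ((measurable_fst.const_add t).prodMk measurable_snd)
  have ham : ∀ n, Measurable (a n) := fun n =>
    Measurable.indicator (((hcomp g hg.1 _).sub (hcomp g hg.1 _)).abs)
      (MeasurableSet.univ.prod hO.measurableSet)
  have hbm : ∀ n, Measurable (b n) := fun n => ((hcomp F hF.1 _).sub (hcomp F hF.1 _)).abs
  have ha0 : ∀ n r, 0 ≤ a n r := fun n r => indicator_nonneg (fun _ _ => abs_nonneg _) _
  have haC : ∀ n r, |a n r| ≤ 2 * C + 2 * D := fun n r => by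
    rw [abs_of_nonneg (ha0 n r)]
    simp only [ha]
    by_cases hr : r ∈ univ ×ˢ O
    swap
    · rw [indicator_of_notMem hr]
      positivity
    rw [indicator_of_mem hr]
    refine (abs_sub _ _).trans ?_
    linarith [hC ((q n).1 + r.1, r.2), hC (s + r.1, r.2)]
  have hbC : ∀ n r, |b n r| ≤ 2 * C + 2 * D := fun n r => by
    rw [hb, abs_abs]
    refine (abs_sub _ _).trans ?_
    linarith [hD ((q n).1 + r.1, r.2), hD (s + r.1, r.2)]
  have hadd : ∀ u : ℝ≥0, Tendsto (fun n => (q n).1 + u) atTop (𝓝 (s + u)) := fun u =>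
    hs.add_const u
  have hlim : ∀ k : ℝ≥0 × E → ℝ, ∀ y, (Continuous fun r => k (r, y)) → ∀ u : ℝ≥0,
      Tendsto (fun n => |k ((q n).1 + u, y) - k (s + u, y)|) atTop (𝓝 0) := fun k y hk u => by
    have h1 : Tendsto (fun n => k ((q n).1 + u, y)) atTop (𝓝 (k (s + u, y))) :=
      (hk.tendsto _).comp (hadd u)
    simpa using (h1.sub_const (k (s + u, y))).abs
  have hGm := fun N => IsBoundedMeasurable.tailSup ham haC N
  have hHm := fun N => IsBoundedMeasurable.tailSup hbm hbC N
  have hlimV : Tendsto (fun N => M.value O γ (fun r => tailSup (fun n => a n r) N)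
      (fun r => tailSup (fun n => b n r) N) (0, x₀)) atTop (𝓝 0) := by
    have h0 : M.value O γ (fun _ => 0) (fun _ => 0) (0, x₀) = 0 := by
      have := M.abs_value_le (O := O) hγ (g := fun _ => 0) (F := fun _ => 0) (C := 0) (D := 0)
        le_rfl (by simp) le_rfl (by simp) (0, x₀)
      simpa using this
    have hle : ∀ c : ℕ → ℝ≥0 × E → ℝ, (∀ n r, |c n r| ≤ 2 * C + 2 * D) → ∀ N r,
        |tailSup (fun n => c n r) N| ≤ 2 * C + 2 * D := fun c hc N r => abs_le.2
      ⟨(abs_le.1 (hc N r)).1.trans (le_tailSup (a := fun n => c n r)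
        (fun n => (le_abs_self _).trans (hc n r)) le_rfl),
        tailSup_le _ fun n _ => (le_abs_self _).trans (hc n r)⟩
    rw [← h0]
    refine M.tendsto_value hγ (fun N => (hGm N).1) (fun N => (hHm N).1) (hle a haC) (hle b hbC)
      (fun r y hy => tendsto_tailSup (fun n => ha0 n _) ?_)
      (fun r => tendsto_tailSup (fun n => abs_nonneg _) (hlim F r.2 (hFc _) r.1)) _
    have h1 : ∀ n, a n (r, y) = |g ((q n).1 + r, y) - g (s + r, y)| := fun n =>
      indicator_of_mem (show (r, y) ∈ univ ×ˢ O from ⟨trivial, hy⟩) _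
    simp_rw [h1]
    exact hlim g y (hgc y hy) r
  have hdiff : Tendsto (fun n => M.value O γ g F (q n) - M.value O γ g F (s, (q n).2)) atTop
      (𝓝 0) := by
    rw [tendsto_zero_iff_abs_tendsto_zero]
    refine tendsto_order.2 ⟨fun c hc => Eventually.of_forall fun N => hc.trans_le (abs_nonneg _),
      fun c hc => ?_⟩
    -- Fix `N` using the point `x₀` only; continuity in space then carries the bound to the moving
    -- points.
    obtain ⟨N, hN⟩ := (hlimV.eventually_lt_const hc).exists
    have h1 := ((M.continuousAt_value hO hA3 hexit hγ (hGm N) (hHm N) 0 hx₀).tendsto.comp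
      hx).eventually_lt_const hN
    filter_upwards [h1, eventually_ge_atTop N] with n hn hNn
    refine (M.abs_value_time_sub_le hγ hg hF (hGm N) (hHm N) (fun u y hy => ?_)
      (fun u y => ?_) _).trans_lt hn
    · refine le_trans (le_of_eq ?_) (le_tailSup (a := fun n => a n (u, y))
        (fun n => (le_abs_self _).trans (haC n _)) hNn)
      rw [ha]
      exact (indicator_of_mem (show (u, y) ∈ univ ×ˢ O from ⟨trivial, hy⟩)
        fun r => |g ((q n).1 + r.1, r.2) - g (s + r.1, r.2)|).symm
    · exact le_tailSup (a := fun n => b n (u, y)) (fun n => (le_abs_self _).trans (hbC n _)) hNn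
  have := hdiff.add ((M.continuousAt_value hO hA3 hexit hγ hg hF s hx₀).tendsto.comp hx)
  simpa [Function.comp_def] using this

section Penalization

variable {α β : ℝ} {f F w : ℝ≥0 × E → ℝ}

lemma continuousOn_penalizedIterate (hO : IsOpen O) (hA3 : M.StrongFeller)
    (hexit : M.NoQuickExit O) (hα : 0 < α) (hβ : 0 < β) (hf : IsBoundedMeasurable f)
    (hF : IsBoundedMeasurable F) (hfc : ∀ y, Continuous fun r => f (r, y))
    (hFc : ∀ y, Continuous fun r => F (r, y)) (n : ℕ) :
    ContinuousOn (M.penalizedIterate O α β f F n) (univ ×ˢ O) := by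
  induction n with
  | zero => exact continuousOn_const
  | succ n ih =>
    refine M.continuousOn_value hO hA3 hexit (by linarith) (isBoundedMeasurable_penalty_max hf hF
      (M.isBoundedMeasurable_penalizedIterate hα hβ hf hF n) β) hF (fun y hy => ?_) hFc
    have : Continuous fun r => M.penalizedIterate O α β f F n (r, y) :=
      ih.comp_continuous (by fun_prop) fun r => ⟨trivial, hy⟩
    exact (hfc y).add (((hFc y).max this).const_mul β)

lemma continuousOn_penalized (hO : IsOpen O) (hA3 : M.StrongFeller)
    (hexit : M.NoQuickExit O) (hα : 0 < α) (hβ : 0 < β) (hf : IsBoundedMeasurable f)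
    (hF : IsBoundedMeasurable F) (hfc : ∀ y, Continuous fun r => f (r, y))
    (hFc : ∀ y, Continuous fun r => F (r, y)) (hw : IsBoundedMeasurable w)
    (h : ∀ q, w q = M.value O α (fun r => f r + β * max (F r - w r) 0) F q) :
    ContinuousOn w (univ ×ˢ O) := by
  obtain ⟨w', hw', h', hlim⟩ := M.exists_penalized_fixedPoint (O := O) hα hβ hf hF
  obtain rfl := M.penalized_unique hα hβ hf hF hw hw' h ((M.penalized_iff hα hβ hf hF hw').2 h')
  exact hlim.tendstoUniformlyOn.continuousOn (Frequently.of_forall fun n =>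
    M.continuousOn_penalizedIterate hO hA3 hexit hα hβ hf hF hfc hFc n)

end Penalization

end StandardMarkovProcess

end

/-! ### ### Behaviour for large β and pointwise convergence -/

noncomputable section

namespace RCPath

variable {E : Type*} [MetricSpace E] [MeasurableSpace E] [BorelSpace E] {O : Set E}

/-- The exponential average at high rate concentrates at the starting point. -/
lemma tendsto_mul_running {F : ℝ≥0 × E → ℝ} (hF : IsBoundedMeasurable F) {s : ℝ≥0}
    {T : WithTop ℝ≥0} (hT : 0 < T) {p : RCPath E} {l : ℝ}
    (h : Tendsto (fun u : ℝ≥0 => F (s + u, p u)) (𝓝[>] 0) (𝓝 l)) :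
    Tendsto (fun γ => γ * running γ F s T p) atTop (𝓝 l) := by
  obtain ⟨C, hC0, hC⟩ := hF.exists_bound
  -- The integrand after the substitution u = v/γ: the factor γ disappears, exp(-v) dominates, and
  -- the position is evaluated at a time tending to 0.
  set k : ℝ → ℝ → ℝ := fun γ v =>
    (before T).indicator (fun u => Real.exp (-γ * u) * F (s + u.toNNReal, p u.toNNReal)) (γ⁻¹ * v)
    with hk
  have hkm : ∀ γ, Measurable (k γ) := fun γ =>
    (Measurable.indicator (measurable_rate (γ := γ) hF.1 (measurable_const (a := s))
      (measurable_const (a := p)) measurable_id) (measurableSet_before T)).comp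
      (measurable_id.const_mul γ⁻¹)
  have h1 : ∀ᶠ γ : ℝ in atTop, γ * running γ F s T p = ∫ v in Ioi 0, k γ v := by
    filter_upwards [eventually_gt_atTop 0] with γ hγ
    have h2 := integral_comp_mul_left_Ioi ((before T).indicator (rate γ F s p)) 0 (inv_pos.2 hγ)
    rw [mul_zero, inv_inv, smul_eq_mul] at h2
    refine Eq.trans ?_ h2.symm
    rw [← integral_Ici_eq_integral_Ioi, setIntegral_indicator (measurableSet_before T),
      inter_eq_right.2 (before_subset_Ici T), running]
  refine Tendsto.congr' (h1.mono fun _ h => h.symm) ?_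
  have h3 : ∫ v : ℝ in Ioi 0, Real.exp (-1 * v) * l = l := by
    rw [integral_mul_const, ← integral_Ici_eq_integral_Ioi, integral_exp_neg_mul_Ici one_pos]
    simp
  rw [← h3]
  refine tendsto_integral_filter_of_dominated_convergence (fun v => Real.exp (-1 * v) * C)
    (Eventually.of_forall fun γ => (hkm γ).aestronglyMeasurable) ?_ ?_ ?_
  · filter_upwards [eventually_gt_atTop 0] with γ hγ
    refine Eventually.of_forall fun v => ?_
    simp only [hk, Real.norm_eq_abs]
    by_cases hv : γ⁻¹ * v ∈ before T
    · rw [indicator_of_mem hv, abs_mul, abs_of_pos (Real.exp_pos _), ← mul_assoc, neg_mul,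
        mul_inv_cancel₀ hγ.ne']
      exact mul_le_mul_of_nonneg_left (hC _) (Real.exp_pos _).le
    · rw [indicator_of_notMem hv, abs_zero]
      positivity
  · exact ((integrableOn_exp_neg_mul_Ici one_pos).mono_set Ioi_subset_Ici_self).mul_const C
  · filter_upwards [ae_restrict_mem measurableSet_Ioi] with v hv
    have h4 : Tendsto (fun γ : ℝ => γ⁻¹ * v) atTop (𝓝 0) := by
      simpa using tendsto_inv_atTop_zero.mul_const v
    have h5 : Tendsto (fun γ : ℝ => (γ⁻¹ * v).toNNReal) atTop (𝓝[>] 0) := by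
      refine tendsto_nhdsWithin_iff.2 ⟨?_, ?_⟩
      · simpa [Function.comp_def] using (continuous_real_toNNReal.tendsto 0).comp h4
      · filter_upwards [eventually_gt_atTop 0] with γ hγ
        exact Real.toNNReal_pos.2 (mul_pos (inv_pos.2 hγ) hv)
    have h6 : ∀ᶠ γ : ℝ in atTop, γ⁻¹ * v ∈ before T := by
      have h7 : ∀ᶠ u : ℝ≥0 in 𝓝 0, (u : WithTop ℝ≥0) < T := by
        cases T with
        | top => exact Eventually.of_forall fun u => WithTop.coe_lt_top u
        | coe a =>
          filter_upwards [Iio_mem_nhds (show (0 : ℝ≥0) < a by exact_mod_cast hT)] with u hu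
          exact WithTop.coe_lt_coe.2 hu
      filter_upwards [eventually_gt_atTop 0, h5.eventually (h7.filter_mono nhdsWithin_le_nhds)]
        with γ hγ hlt
      exact ⟨mul_nonneg (inv_pos.2 hγ).le (le_of_lt hv), hlt⟩
    refine Tendsto.congr' ?_ ((h.comp h5).const_mul (Real.exp (-1 * v)))
    filter_upwards [h6, eventually_gt_atTop 0] with γ hγ hγ0
    simp only [hk]
    have h7 : -γ * (γ⁻¹ * v) = -1 * v := by field_simp
    rw [indicator_of_mem hγ, h7]
    rfl

omit [MeasurableSpace E] [BorelSpace E] in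
lemma tendsto_terminal_atTop (F : ℝ≥0 × E → ℝ) (s : ℝ≥0) {T : WithTop ℝ≥0} (hT : 0 < T)
    (p : RCPath E) : Tendsto (fun γ => terminal γ F s T p) atTop (𝓝 0) := by
  cases T with
  | top => simp
  | coe a =>
    simp only [terminal_coe]
    have ha : (0 : ℝ) < a := by exact_mod_cast hT
    have h1 : Tendsto (fun γ : ℝ => -γ * a) atTop atBot :=
      tendsto_neg_atTop_atBot.atBot_mul_const ha
    simpa using (Real.tendsto_exp_atBot.comp h1).mul_const (F (s + a, p a))

end RCPath

namespace StandardMarkovProcess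

set_option linter.unusedSectionVars false

open RCPath

variable {E Ω : Type*} [MetricSpace E] [SecondCountableTopology E] [MeasurableSpace E]
  [BorelSpace E] [mΩ : MeasurableSpace Ω] (M : StandardMarkovProcess E Ω)

variable {O : Set E} {α : ℝ} {f F : ℝ≥0 × E → ℝ}

lemma abs_penalty_reward_le (hα : 0 < α) {C D : ℝ} (hC0 : 0 ≤ C) (hC : ∀ q, |f q| ≤ C)
    (hD0 : 0 ≤ D) (hD : ∀ q, |F q| ≤ D) {β : ℝ} (hβ : 0 < β) (s : ℝ≥0) (p : RCPath E) :
    |reward O (α + β) (fun r => f r + β * F r) F s p| ≤ C / α + 2 * D := by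
  have hαβ : 0 < α + β := by linarith
  have h1 := abs_reward_le (O := O) hαβ (g := fun r => f r + β * F r) (C := C + β * D)
    (by positivity) (fun q => (abs_add_le _ _).trans (add_le_add (hC q) (by
      rw [abs_mul, abs_of_pos hβ]
      exact mul_le_mul_of_nonneg_left (hD q) hβ.le))) hD0 hD s p
  have h2 : C / (α + β) ≤ C / α := div_le_div_of_nonneg_left hC0 hα (by linarith)
  have h3 : β * D / (α + β) ≤ D := by
    rw [div_le_iff₀ hαβ]
    nlinarith
  rw [add_div] at h1
  linarith

/-- Inside `O` the exit time is positive, so at rate `α + β` the terminal term vanishes, the `f`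
part is of order 1/β, and the weight of the `F` part concentrates at the start, where `F` is
continuous along the path. Outside `O` the value is already `F`. -/
lemma tendsto_value_penalty (hO : IsOpen O) (hα : 0 < α) (hf : IsBoundedMeasurable f)
    (hF : IsBoundedMeasurable F) (hFc : ContinuousOn F (univ ×ˢ O)) (q : ℝ≥0 × E) :
    Tendsto (fun β => M.value O (α + β) (fun r => f r + β * F r) F q) atTop (𝓝 (F q)) := by
  obtain ⟨s, x⟩ := q
  by_cases hx : x ∉ O
  · simp_rw [M.value_of_notMem hx]
    exact tendsto_const_nhds
  rw [not_not] at hx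
  obtain ⟨C, hC0, hC⟩ := hf.exists_bound
  obtain ⟨D, hD0, hD⟩ := hF.exists_bound
  have h1 : F (s, x) = ∫ _, F (s, x) ∂(M.P x) := by simp
  rw [h1]
  refine tendsto_integral_filter_of_dominated_convergence (fun _ => C / α + 2 * D)
    (Eventually.of_forall fun β => (measurable_reward (hf.1.add (hF.1.const_mul β)) hF.1
      measurable_const M.measurable_path).aestronglyMeasurable) ?_ (integrable_const _) ?_
  · filter_upwards [eventually_gt_atTop 0] with β hβ
    exact Eventually.of_forall fun ω => abs_penalty_reward_le hα hC0 hC hD0 hD hβ _ _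
  filter_upwards [M.start x] with ω hω
  have hT : 0 < RCPath.exitTime O (M.path ω) := exitTime_pos hO (by rwa [path_apply, hω])
  have hlim : Tendsto (fun β => α + β) atTop atTop := tendsto_atTop_add_const_left _ _ tendsto_id
  have hFlim : Tendsto (fun u : ℝ≥0 => F (s + u, M.path ω u)) (𝓝[>] 0) (𝓝 (F (s, x))) := by
    have h2 : ContinuousAt F (s, x) :=
      hFc.continuousAt ((isOpen_univ.prod hO).mem_nhds ⟨trivial, hx⟩)
    refine h2.tendsto.comp (Tendsto.prodMk_nhds ?_ ?_)
    · simpa using ((continuous_const_add s).tendsto 0).mono_left nhdsWithin_le_nhds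
    · have := (M.path ω).rightContinuous 0
      rwa [path_apply, hω] at this
  have h3 := (tendsto_mul_running hF hT hFlim).comp hlim
  have h4 : Tendsto (fun β => running (α + β) f s (RCPath.exitTime O (M.path ω)) (M.path ω)) atTop
      (𝓝 0) := by
    refine squeeze_zero_norm' ?_ (Tendsto.const_div_atTop hlim C)
    filter_upwards [eventually_gt_atTop 0] with β hβ
    exact abs_running_le (by linarith) hC0 hC _ _ _
  have h5 : Tendsto (fun β => β / (α + β)) atTop (𝓝 1) := by
    have h6 : Tendsto (fun β => 1 - α / (α + β)) atTop (𝓝 (1 - 0)) :=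
      tendsto_const_nhds.sub (Tendsto.const_div_atTop hlim α)
    rw [sub_zero] at h6
    refine Tendsto.congr' ?_ h6
    filter_upwards [eventually_gt_atTop 0] with β hβ
    have : α + β ≠ 0 := by linarith
    field_simp
    ring
  have h7 := (h4.add (h5.mul h3)).add ((tendsto_terminal_atTop F s hT (M.path ω)).comp hlim)
  rw [one_mul, zero_add, add_zero] at h7
  refine Tendsto.congr' ?_ h7
  filter_upwards [eventually_gt_atTop 0] with β hβ
  have : α + β ≠ 0 := by linarith
  rw [reward, running_add_fun (by linarith) hf (hF.const_mul β), running_const_mul]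
  simp only [Function.comp_apply]
  field_simp

/-- A family of penalized solutions. -/
structure IsPenalizedFamily (O : Set E) (α : ℝ) (f F : ℝ≥0 × E → ℝ) (w : ℝ → ℝ≥0 × E → ℝ) :
    Prop where
  isBoundedMeasurable : ∀ β, 0 < β → IsBoundedMeasurable (w β)
  eq_value : ∀ β, 0 < β → ∀ q, w β q = M.value O α (fun r => f r + β * max (F r - w β r) 0) F q

lemma exists_isPenalizedFamily (hα : 0 < α) (hf : IsBoundedMeasurable f)
    (hF : IsBoundedMeasurable F) (O : Set E) : ∃ w, M.IsPenalizedFamily O α f F w := by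
  have h : ∀ β : ℝ, ∃ w : ℝ≥0 × E → ℝ, 0 < β → IsBoundedMeasurable w ∧
      ∀ q, w q = M.value O α (fun r => f r + β * max (F r - w r) 0) F q := by
    intro β
    by_cases hβ : 0 < β
    · obtain ⟨w, hw, h, -⟩ := M.exists_penalized_fixedPoint (O := O) hα hβ hf hF
      exact ⟨w, fun _ => ⟨hw, (M.penalized_iff hα hβ hf hF hw).2 h⟩⟩
    · exact ⟨0, fun h => absurd h hβ⟩
  choose w hw using h
  exact ⟨w, fun β hβ => (hw β hβ).1, fun β hβ => (hw β hβ).2⟩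

namespace IsPenalizedFamily

variable {M} {w : ℝ → ℝ≥0 × E → ℝ}

lemma of_notMem (h : M.IsPenalizedFamily O α f F w) {β : ℝ} (hβ : 0 < β) {x : E} (hx : x ∉ O)
    (s : ℝ≥0) : w β (s, x) = F (s, x) := by
  rw [h.eq_value β hβ, M.value_of_notMem hx]

lemma monotoneOn (h : M.IsPenalizedFamily O α f F w) (hα : 0 < α) (hf : IsBoundedMeasurable f)
    (hF : IsBoundedMeasurable F) {β₁ β₂ : ℝ} (hβ₁ : 0 < β₁) (hβ : β₁ ≤ β₂) (q : ℝ≥0 × E) :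
    w β₁ q ≤ w β₂ q :=
  have hβ₂ := hβ₁.trans_le hβ
  M.penalized_mono hα hβ₁ hβ hf hF (h.isBoundedMeasurable _ hβ₁) (h.isBoundedMeasurable _ hβ₂)
    (h.eq_value _ hβ₁) (h.eq_value _ hβ₂) q

lemma value_penalty_le (h : M.IsPenalizedFamily O α f F w) (hα : 0 < α)
    (hf : IsBoundedMeasurable f) (hF : IsBoundedMeasurable F) {β : ℝ} (hβ : 0 < β)
    (q : ℝ≥0 × E) : M.value O (α + β) (fun r => f r + β * F r) F q ≤ w β q := by
  have hw := h.isBoundedMeasurable β hβ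
  rw [(M.penalized_iff hα hβ hf hF hw).1 (h.eq_value β hβ) q]
  refine M.value_mono (by linarith) (hf.add (hF.const_mul β))
    (isBoundedMeasurable_penalty_max hf hF hw β) hF (fun r => ?_) q
  gcongr
  exact le_max_left _ _

/-- The solution lies above a quantity converging to `F`, so only a vanishing positive part of `F -
w β` remains. -/
lemma tendsto_penalty (h : M.IsPenalizedFamily O α f F w) (hO : IsOpen O) (hα : 0 < α)
    (hf : IsBoundedMeasurable f) (hF : IsBoundedMeasurable F)
    (hFc : ContinuousOn F (univ ×ˢ O)) (q : ℝ≥0 × E) :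
    Tendsto (fun β => max (F q - w β q) 0) atTop (𝓝 0) := by
  have h1 := ((M.tendsto_value_penalty hO hα hf hF hFc q).const_sub (F q)).max
    (tendsto_const_nhds (x := (0 : ℝ)))
  rw [sub_self, max_self] at h1
  refine squeeze_zero' (Eventually.of_forall fun β => le_max_right _ _) ?_ h1
  filter_upwards [eventually_gt_atTop 0] with β hβ
  exact max_le_max (sub_le_sub_left (h.value_penalty_le hα hf hF hβ q) _) le_rfl

/-- A bound uniform in `β` as well as in the point, to dominate the penalty at stopping times. -/
lemma exists_penalty_bound (h : M.IsPenalizedFamily O α f F w) (hα : 0 < α)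
    (hf : IsBoundedMeasurable f) (hF : IsBoundedMeasurable F) :
    ∃ K, 0 ≤ K ∧ ∀ β, 0 < β → ∀ q, |max (F q - w β q) 0| ≤ K := by
  obtain ⟨C, hC0, hC⟩ := hf.exists_bound
  obtain ⟨D, hD0, hD⟩ := hF.exists_bound
  refine ⟨C / α + 3 * D, by positivity, fun β hβ q => ?_⟩
  have h1 := h.value_penalty_le hα hf hF hβ q
  have h2 := norm_integral_le_of_norm_le_const (μ := M.P q.2)
    (f := fun ω => reward O (α + β) (fun r => f r + β * F r) F q.1 (M.path ω))
    (Eventually.of_forall fun ω => abs_penalty_reward_le hα hC0 hC hD0 hD hβ _ _)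
  rw [probReal_univ, mul_one, Real.norm_eq_abs] at h2
  have h3 := (abs_le.1 h2).1
  rw [value] at h1
  rw [abs_of_nonneg (le_max_right _ _)]
  refine max_le ?_ (by positivity)
  have := (abs_le.1 (hD q)).2
  linarith

lemma eq_stopped (h : M.IsPenalizedFamily O α f F w) (hO : IsOpen O) (hα : 0 < α)
    (hf : IsBoundedMeasurable f) (hF : IsBoundedMeasurable F) {β : ℝ} (hβ : 0 < β)
    {θ : Ω → WithTop ℝ≥0} (hθ : IsStoppingTime M.filtration θ) (q : ℝ≥0 × E) :
    w β q = ∫ ω, (running α (fun r => f r + β * max (F r - w β r) 0) q.1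
        (min (θ ω) (M.exit O ω)) (M.path ω) +
      terminal α (w β) q.1 (min (θ ω) (M.exit O ω)) (M.path ω)) ∂(M.P q.2) := by
  have h1 : w β = M.value O α (fun r => f r + β * max (F r - w β r) 0) F :=
    funext (h.eq_value β hβ)
  have h2 := M.value_eq_stopped hO hα
    (isBoundedMeasurable_penalty hf hF (h.isBoundedMeasurable β hβ) β) hF hθ q.1 q.2
  rw [← h1] at h2
  exact h2

end IsPenalizedFamily

lemma integrable_stopped (hα : 0 < α) (hf : IsBoundedMeasurable f) (hF : IsBoundedMeasurable F)
    {T : Ω → WithTop ℝ≥0} (hT : Measurable T) (q : ℝ≥0 × E) :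
    Integrable (fun ω => running α f q.1 (T ω) (M.path ω) + terminal α F q.1 (T ω) (M.path ω))
      (M.P q.2) :=
  ((isBoundedMeasurable_running hα hf measurable_const hT M.measurable_path).add
    (isBoundedMeasurable_terminal hα.le hF measurable_const hT M.measurable_path)).integrable _

lemma abs_functional_le (hO : IsOpen O) (hα : 0 < α) {C D : ℝ} (hC0 : 0 ≤ C)
    (hC : ∀ q, |f q| ≤ C) (hD0 : 0 ≤ D) (hD : ∀ q, |F q| ≤ D) (q : ℝ≥0 × E)
    (τ : Ω → WithTop ℝ≥0) : |M.functional O α f F q τ| ≤ C / α + D := by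
  rw [M.functional_eq hO]
  have := norm_integral_le_of_norm_le_const (μ := M.P q.2)
    (f := fun ω => running α f q.1 (min (τ ω) (M.exit O ω)) (M.path ω) +
        terminal α F q.1 (min (τ ω) (M.exit O ω)) (M.path ω)) (Eventually.of_forall fun ω =>
    (abs_add_le _ _).trans (add_le_add (abs_running_le hα hC0 hC _ _ _)
      (abs_terminal_le hα.le hD0 hD _ _ _)))
  rwa [probReal_univ, mul_one, Real.norm_eq_abs] at this

lemma functional_le_valueFunction (hO : IsOpen O) (hα : 0 < α) (hf : IsBoundedMeasurable f)
    (hF : IsBoundedMeasurable F) (q : ℝ≥0 × E) {τ : Ω → WithTop ℝ≥0}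
    (hτ : IsStoppingTime M.filtration τ) :
    M.functional O α f F q τ ≤ M.valueFunction O α f F q := by
  obtain ⟨C, hC0, hC⟩ := hf.exists_bound
  obtain ⟨D, hD0, hD⟩ := hF.exists_bound
  refine le_ciSup (f := fun τ : {τ : Ω → WithTop ℝ≥0 // IsStoppingTime M.filtration τ} =>
    M.functional O α f F q τ.1) ⟨C / α + D, ?_⟩ ⟨τ, hτ⟩
  rintro _ ⟨τ, rfl⟩
  exact (le_abs_self _).trans (M.abs_functional_le hO hα hC0 hC hD0 hD q _)

lemma valueFunction_le {q : ℝ≥0 × E} {c : ℝ} (h : ∀ τ, IsStoppingTime M.filtration τ →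
    M.functional O α f F q τ ≤ c) : M.valueFunction O α f F q ≤ c := by
  have : Nonempty {τ : Ω → WithTop ℝ≥0 // IsStoppingTime M.filtration τ} :=
    ⟨⟨_, isStoppingTime_const M.filtration 0⟩⟩
  exact ciSup_le fun τ => h τ.1 τ.2

/-- The first time at which the obstacle exceeds `v`. -/
lemma exists_isStoppingTime_obstacle (hO : IsOpen O) {v : ℝ≥0 × E → ℝ}
    (hFc : ContinuousOn F (univ ×ˢ O)) (hvc : ContinuousOn v (univ ×ˢ O)) (s : ℝ≥0) : ∃ τ, IsStoppingTime M.filtration τ ∧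
      (∀ ω, ∀ u : ℝ≥0, u < τ ω → M.X u ω ∈ O → F (s + u, M.X u ω) ≤ v (s + u, M.X u ω)) ∧
      ∀ ω, ∀ a : ℝ≥0, τ ω = a → M.X a ω ∈ O → v (s + a, M.X a ω) ≤ F (s + a, M.X a ω) := by
  have hUO : IsOpen ((univ : Set ℝ≥0) ×ˢ O) := isOpen_univ.prod hO
  set G : Set (ℝ≥0 × E) := {r | r ∈ univ ×ˢ O ∧ v r < F r} with hG
  have hGo : IsOpen G := by
    have := (hFc.sub hvc).isOpen_inter_preimage hUO (isOpen_Ioi (a := (0 : ℝ)))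
    refine (congrArg IsOpen ?_).mp this
    ext r
    simp [hG]
  have hYc : ∀ ω t, Tendsto (fun u => (s + u, M.X u ω)) (𝓝[>] t) (𝓝 (s + t, M.X t ω)) :=
    fun ω t => (((continuous_const_add s).tendsto t).mono_left nhdsWithin_le_nhds).prodMk_nhds
      (M.right_continuous ω t)
  -- Hitting the open set of strict inequality gives a stopping time without completeness. At that
  -- time the space-time position is only in the closure, and continuity on `O` turns this into the
  -- non-strict inequality.
  refine ⟨hittingAfter (fun t ω => (s + t, M.X t ω)) G 0,
    isStoppingTime_hittingAfter_of_isOpen hGo hYc fun t =>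
      (measurable_const.prodMk (M.adapted t)) hGo.measurableSet, fun ω u hu huO => ?_,
    fun ω a ha haO => ?_⟩
  · have h2 : (s + u, M.X u ω) ∉ G :=
      notMem_of_lt_hittingAfter (u := fun t ω => (s + t, M.X t ω)) hu zero_le
    exact not_lt.1 fun hlt => h2 ⟨⟨trivial, huO⟩, hlt⟩
  · have h7 : (s + a, M.X a ω) ∈ closure G :=
      hittingAfter_mem_closure (X := fun t ω => (s + t, M.X t ω)) (hYc ω) ha
    have h8 : (s + a, M.X a ω) ∈ (univ : Set ℝ≥0) ×ˢ O := ⟨trivial, haO⟩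
    have := mem_closure_iff_nhdsWithin_neBot.1 h7
    have hsub : G ⊆ univ ×ˢ O := fun r hr => hr.1
    exact le_of_tendsto_of_tendsto ((hvc _ h8).mono_left (nhdsWithin_mono _ hsub))
      ((hFc _ h8).mono_left (nhdsWithin_mono _ hsub))
      (eventually_nhdsWithin_of_forall fun r hr => hr.2.le)

namespace IsPenalizedFamily

variable {M} {w : ℝ → ℝ≥0 × E → ℝ}

/-- Up to the penalty at the stopping time, a penalized solution dominates the functional. -/
lemma functional_le (h : M.IsPenalizedFamily O α f F w) (hO : IsOpen O) (hα : 0 < α)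
    (hf : IsBoundedMeasurable f) (hF : IsBoundedMeasurable F) {β : ℝ} (hβ : 0 < β)
    (q : ℝ≥0 × E) {τ : Ω → WithTop ℝ≥0} (hτ : IsStoppingTime M.filtration τ) :
    M.functional O α f F q τ ≤ w β q + ∫ ω, terminal α (fun r => max (F r - w β r) 0) q.1
      (min (τ ω) (M.exit O ω)) (M.path ω) ∂(M.P q.2) := by
  have hw := h.isBoundedMeasurable β hβ
  have hmin := hτ.measurable'.min (M.measurable_exit O)
  have hg := isBoundedMeasurable_penalty hf hF hw β
  have hd : IsBoundedMeasurable fun r => max (F r - w β r) 0 := (hF.sub hw).max (.const 0)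
  have hi := (isBoundedMeasurable_terminal hα.le hd (measurable_const (a := q.1)) hmin
    M.measurable_path).integrable (M.P q.2)
  have hi2 := M.integrable_stopped hα hg hw hmin q
  rw [h.eq_stopped hO hα hf hF hβ hτ q, M.functional_eq hO, ← integral_add hi2 hi]
  refine integral_mono (M.integrable_stopped hα hf hF hmin q) (hi2.add hi) fun ω => ?_
  beta_reduce
  rw [add_assoc]
  refine add_le_add (running_mono hα hf hg fun u _ => ?_) ?_
  · have := mul_nonneg hβ.le (le_max_right (F (q.1 + u, M.path ω u) - w β (q.1 + u, M.path ω u)) 0)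
    linarith
  · generalize min (τ ω) (M.exit O ω) = T
    cases T with
    | top => simp
    | coe a =>
      simp only [terminal_coe]
      rw [← mul_add]
      refine mul_le_mul_of_nonneg_left ?_ (Real.exp_pos _).le
      have := le_max_left (F (q.1 + a, M.path ω a) - w β (q.1 + a, M.path ω a)) 0
      linarith

/-- Stop when the obstacle first exceeds `w β`. Until then the penalty vanishes, so the stopped
equation earns exactly `f`; its terminal value is at most `F` at the obstacle time and equals `F` at
the exit. -/
lemma le_valueFunction (h : M.IsPenalizedFamily O α f F w) (hO : IsOpen O) (hα : 0 < α)
    (hf : IsBoundedMeasurable f) (hF : IsBoundedMeasurable F)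
    (hFc : ContinuousOn F (univ ×ˢ O)) {β : ℝ} (hβ : 0 < β)
    (hwc : ContinuousOn (w β) (univ ×ˢ O)) (q : ℝ≥0 × E) :
    w β q ≤ M.valueFunction O α f F q := by
  have hw := h.isBoundedMeasurable β hβ
  have hg := isBoundedMeasurable_penalty hf hF hw β
  obtain ⟨τ, hτ, hτlt, hτeq⟩ := M.exists_isStoppingTime_obstacle hO hFc hwc q.1
  have hmin := hτ.measurable'.min (M.measurable_exit O)
  refine le_trans ?_ (M.functional_le_valueFunction hO hα hf hF q hτ)
  rw [h.eq_stopped hO hα hf hF hβ hτ q, M.functional_eq hO]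
  refine integral_mono_ae (M.integrable_stopped hα hg hw hmin q)
    (M.integrable_stopped hα hf hF hmin q) ?_
  filter_upwards [M.ae_notMem_pathExitTime hO q.2] with ω hω
  refine add_le_add (running_mono hα hg hf fun u hu => ?_) ?_
  · have h3 := hτlt ω u (hu.trans_le (min_le_left _ _))
      (mem_of_lt_exitTime (hu.trans_le (min_le_right _ _)))
    rw [path_apply, max_eq_right (sub_nonpos.2 h3), mul_zero, add_zero]
  · rcases eq_or_ne (min (τ ω) (M.exit O ω)) ⊤ with htop | htop
    · rw [htop]; simp
    obtain ⟨a, ha⟩ := WithTop.ne_top_iff_exists.1 htop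
    rw [← ha, terminal_coe, terminal_coe]
    refine mul_le_mul_of_nonneg_left ?_ (Real.exp_pos _).le
    -- If the stopped position is still in `O`, the minimum cannot be the exit time, since the exit
    -- position is almost surely outside `O`.
    by_cases haO : M.X a ω ∈ O
    · refine hτeq ω a ?_ haO
      rcases min_choice (τ ω) (M.exit O ω) with hm | hm
      · rw [← hm, ha]
      · rw [← ha] at hm
        have h6 : RCPath.exitTime O (M.path ω) = a := hm.symm
        rw [h6] at hω
        exact absurd haO (hω WithTop.coe_ne_top)
    · exact (h.of_notMem hβ haO _).le

/-- The upper bound is `le_valueFunction`. For the lower one, fix a nearly optimal `τ`: the penalty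
at `τ` tends to 0 in mean by bounded convergence. -/
lemma tendsto_valueFunction (h : M.IsPenalizedFamily O α f F w) (hO : IsOpen O) (hα : 0 < α)
    (hf : IsBoundedMeasurable f) (hF : IsBoundedMeasurable F)
    (hFc : ContinuousOn F (univ ×ˢ O))
    (hwc : ∀ β, 0 < β → ContinuousOn (w β) (univ ×ˢ O)) (q : ℝ≥0 × E) :
    Tendsto (fun β => w β q) atTop (𝓝 (M.valueFunction O α f F q)) := by
  obtain ⟨K, hK0, hK⟩ := h.exists_penalty_bound hα hf hF
  refine tendsto_order.2 ⟨fun c hc => ?_, fun c hc => ?_⟩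
  · obtain ⟨τ, hτ, hcτ⟩ : ∃ τ, IsStoppingTime M.filtration τ ∧ c < M.functional O α f F q τ := by
      by_contra! hcon
      exact hc.not_ge (M.valueFunction_le hcon)
    have hmin := hτ.measurable'.min (M.measurable_exit O)
    have hlim : Tendsto (fun β => ∫ ω, terminal α (fun r => max (F r - w β r) 0) q.1
        (min (τ ω) (M.exit O ω)) (M.path ω) ∂(M.P q.2)) atTop (𝓝 (∫ _, (0 : ℝ) ∂(M.P q.2))) := by
      refine tendsto_integral_filter_of_dominated_convergence (fun _ => K) ?_ ?_
        (integrable_const _) (Eventually.of_forall fun ω => ?_)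
      · filter_upwards [eventually_gt_atTop 0] with β hβ
        exact (measurable_terminal ((hF.sub (h.isBoundedMeasurable β hβ)).max (.const 0)).1
          measurable_const hmin M.measurable_path).aestronglyMeasurable
      · filter_upwards [eventually_gt_atTop 0] with β hβ
        exact Eventually.of_forall fun ω => abs_terminal_le hα.le hK0 (hK β hβ) _ _ _
      · generalize min (τ ω) (M.exit O ω) = T
        cases T with
        | top => simp
        | coe a =>
          simp only [terminal_coe]
          simpa using (h.tendsto_penalty hO hα hf hF hFc _).const_mul (Real.exp (-α * a))
    rw [integral_zero] at hlim
    filter_upwards [eventually_gt_atTop 0, hlim.eventually_lt_const (sub_pos.2 hcτ)] with β hβ hlt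
    have := h.functional_le hO hα hf hF hβ q hτ
    linarith
  · filter_upwards [eventually_gt_atTop 0] with β hβ
    exact (h.le_valueFunction hO hα hf hF hFc hβ (hwc β hβ) q).trans_lt hc

/-- The obstacle is asymptotically respected, uniformly on compact sets. -/
lemma eventually_le_add (h : M.IsPenalizedFamily O α f F w) (hO : IsOpen O) (hα : 0 < α)
    (hf : IsBoundedMeasurable f) (hF : IsBoundedMeasurable F)
    (hFc : ContinuousOn F (univ ×ˢ O)) (hwc : ∀ β, 0 < β → ContinuousOn (w β) (univ ×ˢ O))
    {K : Set (ℝ≥0 × E)} (hK : IsCompact K) (hKO : K ⊆ univ ×ˢ O) {η : ℝ} (hη : 0 < η) :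
    ∀ᶠ β in atTop, ∀ q ∈ K, F q ≤ w β q + η := by
  refine hK.induction_on (p := fun S => ∀ᶠ β in atTop, ∀ q ∈ S, F q ≤ w β q + η) (by simp)
    (fun S T hST hT => hT.mono fun β hβ q hq => hβ q (hST hq))
    (fun S T hS hT => (hS.and hT).mono fun β hβ q hq => hq.elim (hβ.1 q) (hβ.2 q)) fun q hq => ?_
  -- A Dini argument: one `β` works at `q`, continuity extends it to a neighbourhood, and
  -- monotonicity to all larger parameters.
  obtain ⟨β, hβη, hβ⟩ := (((h.tendsto_penalty hO hα hf hF hFc q).eventually_lt_const hη).and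
    (eventually_gt_atTop 0)).exists
  have hUO : IsOpen ((univ : Set ℝ≥0) ×ˢ O) := isOpen_univ.prod hO
  have h1 : ContinuousAt (fun r => F r - w β r) q :=
    (hFc.sub (hwc β hβ)).continuousAt (hUO.mem_nhds (hKO hq))
  refine ⟨{r | F r - w β r < η}, mem_nhdsWithin_of_mem_nhds
    (h1.eventually_lt_const ((le_max_left _ _).trans_lt hβη)), ?_⟩
  filter_upwards [eventually_ge_atTop β] with β' hβ' r hr
  have h2 := h.monotoneOn hα hf hF hβ hβ' r
  have h3 : F r - w β r < η := hr
  linarith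

end IsPenalizedFamily

end StandardMarkovProcess

end

/-! ### ### A barrier on the whole space and the absence of quick exits -/

noncomputable section

namespace RCPath

variable {E : Type*} [MetricSpace E]

lemma running_one_top {γ : ℝ} (hγ : 0 < γ) (s : ℝ≥0) (p : RCPath E) (c : ℝ) :
    running γ (fun _ => c) s ⊤ p = c / γ := by
  simp only [running, rate, before_top]
  rw [integral_mul_const, integral_exp_neg_mul_Ici hγ]
  ring

end RCPath

namespace StandardMarkovProcess

set_option linter.unusedSectionVars false

open RCPath

variable {E Ω : Type*} [MetricSpace E] [ProperSpace E] [MeasurableSpace E]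
  [BorelSpace E] [mΩ : MeasurableSpace Ω] (M : StandardMarkovProcess E Ω)

lemma _root_.ZeroAtInftyContinuousMap.isBoundedMeasurable_comp_snd (k : C₀(E, ℝ)) :
    IsBoundedMeasurable fun q : ℝ≥0 × E => k q.2 := by
  refine ⟨k.continuous.measurable.comp measurable_snd, ?_⟩
  obtain ⟨C, hC⟩ := (ZeroAtInftyContinuousMap.isBounded_range k).exists_norm_le
  exact ⟨C, fun q => hC _ ⟨q.2, rfl⟩⟩

/-- The resolvent of a weak Feller process vanishes at infinity. -/
lemma tendsto_integral_running_cocompact (hweak : M.WeakFeller) (k : C₀(E, ℝ)) {γ : ℝ}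
    (hγ : 0 < γ) (s : ℝ≥0) :
    Tendsto (fun x => ∫ ω, running γ (fun q => k q.2) s ⊤ (M.path ω) ∂(M.P x)) (cocompact E)
      (𝓝 0) := by
  have hk := k.isBoundedMeasurable_comp_snd
  obtain ⟨C, hC0, hC⟩ := hk.exists_bound
  have hswap : ∀ x, ∫ ω, running γ (fun q => k q.2) s ⊤ (M.path ω) ∂(M.P x) =
      ∫ u in Ici (0 : ℝ), Real.exp (-γ * u) * ∫ ω, k (M.X u.toNNReal ω) ∂(M.P x) := by
    intro x
    simp only [running, rate, before_top, path_apply]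
    rw [integral_integral_swap]
    · simp_rw [integral_const_mul]
    · have h1 : Integrable (fun z : Ω × ℝ => (1 : ℝ) * Real.exp (-γ * z.2))
          ((M.P x).prod (volume.restrict (Ici 0))) :=
        Integrable.mul_prod (integrable_const (1 : ℝ)) (integrableOn_exp_neg_mul_Ici hγ)
      simp only [one_mul] at h1
      exact h1.mul_bdd (c := C) ((k.continuous.measurable.comp (measurable_apply
        (M.measurable_path.comp measurable_fst)
        measurable_snd.real_toNNReal)).aestronglyMeasurable)
        (Eventually.of_forall fun z => hC (0, M.X z.2.toNNReal z.1))
  simp_rw [hswap]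
  have h0 : ∫ _ in Ici (0 : ℝ), (0 : ℝ) = 0 := by simp
  -- Dominated convergence along a filter needs countable generation; in a proper space this filter
  -- is pulled back from `atTop` by the distance to a point.
  have : (cocompact E).IsCountablyGenerated := by
    rcases isEmpty_or_nonempty E with hE | ⟨⟨x₀⟩⟩
    · rw [filter_eq_bot_of_isEmpty (cocompact E)]
      infer_instance
    · rw [← comap_dist_left_atTop_eq_cocompact x₀]
      infer_instance
  refine Eq.mp (congrArg (Tendsto _ _) (congrArg 𝓝 h0)) ?_
  refine tendsto_integral_filter_of_dominated_convergence (fun u => Real.exp (-γ * u) * C)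
    (Eventually.of_forall fun x => ?_) (Eventually.of_forall fun x => Eventually.of_forall fun u =>
      ?_) ((integrableOn_exp_neg_mul_Ici hγ).mul_const C) (Eventually.of_forall fun u => ?_)
  · have h1 : Measurable fun z : ℝ × Ω => k (M.X z.1.toNNReal z.2) :=
      k.continuous.measurable.comp (measurable_apply (M.measurable_path.comp measurable_snd)
        measurable_fst.real_toNNReal)
    exact ((Real.measurable_exp.comp (measurable_id.const_mul _)).mul
      (h1.stronglyMeasurable.integral_prod_right (ν := M.P x)).measurable).aestronglyMeasurable
  · rw [Real.norm_eq_abs, abs_mul, abs_of_pos (Real.exp_pos _)]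
    refine mul_le_mul_of_nonneg_left ?_ (Real.exp_pos _).le
    have := norm_integral_le_of_norm_le_const (μ := M.P x) (f := fun ω => k (M.X u.toNNReal ω))
      (Eventually.of_forall fun ω => hC (0, M.X u.toNNReal ω))
    simpa using this
  · obtain ⟨g, hg⟩ := hweak u.toNNReal k
    have h1 := (ZeroAtInftyContinuousMapClass.zero_at_infty g).const_mul (Real.exp (-γ * u))
    rw [mul_zero] at h1
    exact h1.congr fun x => by rw [hg]

section Barrier

variable {l : ℝ} {k : C₀(E, ℝ)} {w : ℝ → ℝ≥0 × E → ℝ}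

lemma isBoundedMeasurable_one_sub (k : C₀(E, ℝ)) :
    IsBoundedMeasurable fun q : ℝ≥0 × E => 1 - k q.2 :=
  (IsBoundedMeasurable.const 1).sub k.isBoundedMeasurable_comp_snd

variable {M}

namespace IsPenalizedFamily

/-- Since the whole space is never left, continuity is available here without knowing anything about
exits; this avoids a circular argument. -/
lemma continuousOn_barrier (hA3 : M.StrongFeller) (hl : 0 < l)
    (h : M.IsPenalizedFamily univ l (fun _ => 0) (fun q => 1 - k q.2) w) {β : ℝ} (hβ : 0 < β) :
    ContinuousOn (w β) (univ ×ˢ univ) :=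
  M.continuousOn_penalized isOpen_univ hA3 M.noQuickExit_univ hl hβ (.const 0)
    (isBoundedMeasurable_one_sub k) (fun _ => continuous_const)
    (fun y => (continuous_const : Continuous fun _ : ℝ≥0 => 1 - k y))
    (h.isBoundedMeasurable β hβ) (h.eq_value β hβ)

lemma nonneg_barrier (hl : 0 < l) (hk : ∀ y, k y ≤ 1)
    (h : M.IsPenalizedFamily univ l (fun _ => 0) (fun q => 1 - k q.2) w) {β : ℝ} (hβ : 0 < β)
    (q : ℝ≥0 × E) : 0 ≤ w β q := by
  refine le_trans ?_ (h.value_penalty_le hl (.const 0) (isBoundedMeasurable_one_sub k) hβ q)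
  refine integral_nonneg fun ω => add_nonneg (running_nonneg fun u _ => ?_) ?_
  · have := mul_nonneg hβ.le (sub_nonneg.2 (hk (M.path ω u)))
    linarith
  · rw [exitTime_univ, terminal_top]

/-- The penalized solutions dominate the barrier function, up to `η`, uniformly in space. -/
lemma exists_barrier_le (hweak : M.WeakFeller) (hA3 : M.StrongFeller) (hl : 0 < l)
    (hk0 : ∀ y, 0 ≤ k y)
    (h : M.IsPenalizedFamily univ l (fun _ => 0) (fun q => 1 - k q.2) w) {η : ℝ} (hη : 0 < η) :
    ∃ β, 0 < β ∧ ∀ r : ℝ≥0, r ≤ 1 → ∀ x, 1 - k x ≤ w β (r, x) + η := by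
  have hF := isBoundedMeasurable_one_sub k
  have hFc : Continuous fun q : ℝ≥0 × E => 1 - k q.2 := by fun_prop
  -- At `β₀` the solution is at least 1 - l/(l+β₀) - β₀ R, and R vanishes at infinity; half of `η`
  -- is spent on each error.
  obtain ⟨β₀, hβ₀, hlβ⟩ : ∃ β₀, 0 < β₀ ∧ l / (l + β₀) ≤ η / 2 := by
    have h1 : Tendsto (fun β => l / (l + β)) atTop (𝓝 0) :=
      Tendsto.const_div_atTop (tendsto_atTop_add_const_left _ _ tendsto_id) l
    obtain ⟨β₀, h2, h3⟩ := ((eventually_gt_atTop 0).and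
      (h1.eventually_le_const (half_pos hη))).exists
    exact ⟨β₀, h2, h3⟩
  have hlβ₀ : 0 < l + β₀ := by linarith
  set R : E → ℝ := fun x => ∫ ω, running (l + β₀) (fun q => k q.2) 0 ⊤ (M.path ω) ∂(M.P x) with hR
  have hinf : ∀ᶠ x in cocompact E, β₀ * R x ≤ η / 2 := by
    have h1 := (M.tendsto_integral_running_cocompact hweak k hlβ₀ 0).const_mul β₀
    rw [mul_zero] at h1
    exact h1.eventually_le_const (half_pos hη)
  have hlow : ∀ r x, β₀ / (l + β₀) - β₀ * R x ≤ w β₀ (r, x) := by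
    intro r x
    refine le_trans (le_of_eq ?_) (h.value_penalty_le hl (.const 0) hF hβ₀ (r, x))
    have h1 : ∀ ω, reward univ (l + β₀) (fun q : ℝ≥0 × E => 0 + β₀ * (1 - k q.2))
        (fun q => 1 - k q.2) r (M.path ω) =
        β₀ / (l + β₀) - β₀ * running (l + β₀) (fun q => k q.2) 0 ⊤ (M.path ω) := by
      intro ω
      have hk := k.isBoundedMeasurable_comp_snd
      rw [reward, exitTime_univ, terminal_top, add_zero, ← running_one_top hlβ₀ 0 (M.path ω) β₀,
        ← running_const_mul, eq_sub_iff_add_eq]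
      have h2 := running_add_fun hlβ₀ ((IsBoundedMeasurable.const 0).add (hF.const_mul β₀))
        (hk.const_mul β₀) r ⊤ (M.path ω)
      have h3 : running (l + β₀) (fun q : ℝ≥0 × E => β₀ * k q.2) r ⊤ (M.path ω) =
        running (l + β₀) (fun q => β₀ * k q.2) 0 ⊤ (M.path ω) := running_congr fun u _ => rfl
      rw [← h3, ← h2]
      exact running_congr fun u _ => by ring
    rw [value]
    simp_rw [h1]
    rw [integral_sub (integrable_const _), integral_const_mul]
    · simp [hR]
    · exact ((isBoundedMeasurable_running hlβ₀ k.isBoundedMeasurable_comp_snd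
        (measurable_const (a := 0)) (measurable_const (a := ⊤)) M.measurable_path).const_mul
        β₀).integrable _
  -- Off `K` the lower bound at `β₀` suffices and persists by monotonicity. On `K` the Dini argument
  -- applies, over the compact time interval [0, 1].
  obtain ⟨K, hK, hKc⟩ := mem_cocompact.1 hinf
  have hcpt := h.eventually_le_add isOpen_univ hl (.const 0) hF hFc.continuousOn
    (fun β hβ => continuousOn_barrier hA3 hl h hβ)
    ((isCompact_Icc (a := (0 : ℝ≥0)) (b := 1)).prod hK) (by simp) hη
  obtain ⟨β, hβK, hβ⟩ := (hcpt.and (eventually_ge_atTop β₀)).exists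
  refine ⟨β, hβ₀.trans_le hβ, fun r hr x => ?_⟩
  by_cases hx : x ∈ K
  · exact hβK (r, x) ⟨⟨zero_le, hr⟩, hx⟩
  · have h1 : β₀ * R x ≤ η / 2 := hKc hx
    have h2 := h.monotoneOn hl (.const 0) hF hβ₀ hβ (r, x)
    have h3 := hlow r x
    have h4 : β₀ / (l + β₀) = 1 - l / (l + β₀) := by field_simp; ring
    have := hk0 x
    linarith

/-- A penalized solution dominates the probability of a quick exit. -/
lemma measure_exit_le (hl : 0 < l) (hk : ∀ y, k y ≤ 1) {U : Set E} (hU : IsOpen U)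
    (hkU : ∀ y, y ∉ U → k y = 0)
    (h : M.IsPenalizedFamily univ l (fun _ => 0) (fun q => 1 - k q.2) w) {β η : ℝ} (hβ : 0 < β)
    (hη : η ≤ 1) (hb : ∀ r : ℝ≥0, r ≤ 1 → ∀ x, 1 - k x ≤ w β (r, x) + η) {ε : ℝ≥0} (hε : ε ≤ 1)
    (x : E) : (M.P x).real {ω | M.exit U ω ≤ ε} * (Real.exp (-l * ε) * (1 - η)) ≤ w β (0, x) := by
  have hF := isBoundedMeasurable_one_sub k
  have hw := h.isBoundedMeasurable β hβ
  have hθ : IsStoppingTime M.filtration (M.exit U) := M.isStoppingTime_exit U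
  have hS : MeasurableSet {ω | M.exit U ω ≤ ε} := M.measurable_exit U measurableSet_Iic
  -- Stop the whole-space equation at the exit from `U`. The exit position lies outside `U`, where
  -- `k = 0`, so for exits by time `ε` the terminal value is at least `1 - η`; all other
  -- contributions are nonnegative.
  rw [h.eq_stopped isOpen_univ hl (.const 0) hF hβ hθ (0, x)]
  have h1 := integral_indicator_const (μ := M.P x) (Real.exp (-l * ε) * (1 - η)) hS
  rw [smul_eq_mul] at h1
  rw [← h1]
  refine integral_mono_ae ((integrable_const _).indicator hS)
    (M.integrable_stopped hl (isBoundedMeasurable_penalty (.const 0) hF hw β) hw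
      (hθ.measurable'.min (M.measurable_exit univ)) (0, x)) ?_
  filter_upwards [M.ae_notMem_pathExitTime hU x] with ω hω
  have h2 : min (M.exit U ω) (M.exit univ ω) = RCPath.exitTime U (M.path ω) :=
    min_eq_left (by rw [exit, exit, exitTime_univ]; exact le_top)
  simp only [h2]
  have h3 : 0 ≤ running l (fun r => 0 + β * max (1 - k r.2 - w β r) 0) 0
      (RCPath.exitTime U (M.path ω)) (M.path ω) := running_nonneg fun u _ => by
    rw [zero_add]
    exact mul_nonneg hβ.le (le_max_right _ _)
  refine le_trans ?_ (le_add_of_nonneg_left h3)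
  by_cases hle : M.exit U ω ≤ ε
  · rw [indicator_of_mem (show ω ∈ {ω | M.exit U ω ≤ ε} from hle)]
    obtain ⟨a, ha⟩ := WithTop.ne_top_iff_exists.1 (ne_top_of_le_ne_top WithTop.coe_ne_top hle)
    have ha' : RCPath.exitTime U (M.path ω) = a := ha.symm
    have haε : a ≤ ε := by
      rw [← ha] at hle
      exact_mod_cast hle
    rw [ha'] at hω ⊢
    have h4 := hω WithTop.coe_ne_top
    rw [WithTop.untopD_coe] at h4
    have h5 := hb a (haε.trans hε) (M.X a ω)
    rw [hkU _ h4] at h5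
    rw [terminal_coe, path_apply, zero_add]
    have h6 : (a : ℝ) ≤ ε := by exact_mod_cast haε
    have h7 : -l * (ε : ℝ) ≤ -l * a := by nlinarith
    exact mul_le_mul (Real.exp_le_exp.2 h7) (by linarith) (by linarith) (Real.exp_pos _).le
  · rw [indicator_of_notMem (show ω ∉ {ω | M.exit U ω ≤ ε} from hle)]
    generalize RCPath.exitTime U (M.path ω) = T
    cases T with
    | top => simp
    | coe a =>
      rw [terminal_coe]
      exact mul_nonneg (Real.exp_pos _).le (nonneg_barrier hl hk h hβ _)

/-- Compare with the optimal stopping value: while the path stays in `V`, stopping yields at most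
`δ`; afterwards it yields at most the discount factor at the exit from `V`. -/
lemma barrier_le (hA3 : M.StrongFeller) (hl : 0 < l) (hk0 : ∀ y, 0 ≤ k y) {V : Set E} {δ : ℝ}
    (hδ : 0 ≤ δ) (hV : ∀ y ∈ V, 1 - k y ≤ δ)
    (h : M.IsPenalizedFamily univ l (fun _ => 0) (fun q => 1 - k q.2) w) {β : ℝ} (hβ : 0 < β)
    (x : E) : w β (0, x) ≤
      δ + ∫ ω, terminal l (fun _ => 1) 0 (M.exit V ω) (M.path ω) ∂(M.P x) := by
  have hF := isBoundedMeasurable_one_sub k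
  have hFc : Continuous fun q : ℝ≥0 × E => 1 - k q.2 := by fun_prop
  refine (h.le_valueFunction isOpen_univ hl (.const 0) hF hFc.continuousOn hβ
    (continuousOn_barrier hA3 hl h hβ) (0, x)).trans (M.valueFunction_le fun τ hτ => ?_)
  have hi := (isBoundedMeasurable_terminal hl.le (.const 1 : IsBoundedMeasurable
    fun _ : ℝ≥0 × E => (1 : ℝ)) (measurable_const (a := 0))
    (M.measurable_exit V) M.measurable_path).integrable (M.P x)
  have hδi : δ + ∫ ω, terminal l (fun _ => 1) 0 (M.exit V ω) (M.path ω) ∂(M.P x) =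
      ∫ ω, (δ + terminal l (fun _ => 1) 0 (M.exit V ω) (M.path ω)) ∂(M.P x) := by
    rw [integral_add (integrable_const _) hi]
    simp
  rw [M.functional_eq isOpen_univ, hδi]
  refine integral_mono (M.integrable_stopped hl (.const 0) hF
    (hτ.measurable'.min (M.measurable_exit univ)) (0, x)) ((integrable_const _).add hi) fun ω => ?_
  have h2 : min (τ ω) (M.exit univ ω) = τ ω :=
    min_eq_left (by rw [exit, exitTime_univ]; exact le_top)
  have h3 : running l (fun _ : ℝ≥0 × E => 0) 0 (τ ω) (M.path ω) = 0 := by simp [running, rate]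
  have hT0 : ∀ T, 0 ≤ terminal l (fun _ : ℝ≥0 × E => 1) 0 T (M.path ω) := fun T => by
    cases T with
    | top => simp
    | coe a => rw [terminal_coe]; positivity
  simp only [h2, h3, zero_add]
  rcases eq_or_ne (τ ω) ⊤ with hτt | hτt
  · rw [hτt, terminal_top]
    exact add_nonneg hδ (hT0 _)
  obtain ⟨a, ha⟩ := WithTop.ne_top_iff_exists.1 hτt
  rw [← ha, terminal_coe]
  have hexp : Real.exp (-l * a) ≤ 1 := Real.exp_le_one_iff.2 (by
    have := mul_nonneg hl.le a.coe_nonneg; linarith)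
  by_cases hlt : a < RCPath.exitTime V (M.path ω)
  · have h4 := hV _ (mem_of_lt_exitTime hlt)
    have h5 := hT0 (RCPath.exitTime V (M.path ω))
    have h6 : Real.exp (-l * a) * (1 - k (M.path ω a)) ≤ 1 * δ :=
      (mul_le_mul_of_nonneg_left h4 (Real.exp_pos _).le).trans
        (mul_le_mul_of_nonneg_right hexp hδ)
    linarith
  · obtain ⟨b, hb⟩ := WithTop.ne_top_iff_exists.1
      (ne_top_of_le_ne_top WithTop.coe_ne_top (not_lt.1 hlt))
    have hba : (b : ℝ) ≤ a := by
      have := not_lt.1 hlt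
      rw [← hb] at this
      exact_mod_cast this
    have hb' : M.exit V ω = b := hb.symm
    rw [hb', terminal_coe, mul_one]
    have h4 : Real.exp (-l * a) ≤ Real.exp (-l * b) := Real.exp_le_exp.2 (by nlinarith)
    have h5 : Real.exp (-l * a) * (1 - k (M.path ω a)) ≤ Real.exp (-l * a) * 1 :=
      mul_le_mul_of_nonneg_left (by linarith [hk0 (M.path ω a)]) (Real.exp_pos _).le
    linarith

end IsPenalizedFamily

end Barrier

/-- A weak and strong Feller process does not leave an open set quickly, locally uniformly. -/
lemma noQuickExit (hweak : M.WeakFeller) (hA3 : M.StrongFeller) {U : Set E} (hU : IsOpen U) :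
    M.NoQuickExit U := by
  intro x₀ hx₀ η hη
  obtain ⟨k', hk1, hk0, hks, hkI⟩ := exists_continuous_one_zero_of_isCompact
    (isCompact_singleton (x := x₀)) hU.isClosed_compl (by simpa using hx₀)
  set k : C₀(E, ℝ) := ⟨k', hks.is_zero_at_infty⟩
  have hkx₀ : k x₀ = 1 := hk1 (mem_singleton x₀)
  have hkU : ∀ y, y ∉ U → k y = 0 := fun y hy => hk0 hy
  -- The exit probability times (1/2)(1/2), from the discount and from `1 - 1 / 2`, will be below `2
  -- * δ`. The probability is thus below `8 * δ`, less than `η`.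
  set δ := η / 12 with hδ
  have hδ0 : 0 < δ := by positivity
  set V : Set E := {y | 1 - k y < δ} with hV
  have hVo : IsOpen V := isOpen_lt (by fun_prop) continuous_const
  have hx₀V : x₀ ∈ V := by simp [hV, hkx₀, hδ0]
  have hlim : Tendsto (fun l => ∫ ω, terminal l (fun _ => 1) 0 (M.exit V ω) (M.path ω) ∂(M.P x₀))
      atTop (𝓝 (∫ _, (0 : ℝ) ∂(M.P x₀))) := by
    refine tendsto_integral_filter_of_dominated_convergence (fun _ => 1)
      (Eventually.of_forall fun l => (measurable_terminal measurable_const measurable_const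
        (M.measurable_exit V) M.measurable_path).aestronglyMeasurable) ?_ (integrable_const _) ?_
    · filter_upwards [eventually_ge_atTop 0] with l hl
      exact Eventually.of_forall fun ω => abs_terminal_le hl zero_le_one (by simp) _ _ _
    · filter_upwards [M.start x₀] with ω hω
      exact tendsto_terminal_atTop _ _ (exitTime_pos hVo (by rwa [path_apply, hω])) _
  rw [integral_zero] at hlim
  -- The discount rate is chosen from the behaviour at `x₀` alone; continuity of the penalized
  -- solution then gives the estimate nearby.
  obtain ⟨l, hlδ, hl⟩ := ((hlim.eventually_lt_const hδ0).and (eventually_gt_atTop 0)).exists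
  obtain ⟨w, h⟩ := M.exists_isPenalizedFamily hl (f := fun _ => 0) (.const 0)
    (isBoundedMeasurable_one_sub k) univ
  obtain ⟨β, hβ, hb⟩ := h.exists_barrier_le hweak hA3 hl (fun y => (hkI y).1)
    (η := 1 / 2) (by norm_num)
  have hw0 : w β (0, x₀) < 2 * δ := by
    have := h.barrier_le hA3 hl (fun y => (hkI y).1) hδ0.le
      (fun y (hy : y ∈ V) => le_of_lt hy) hβ x₀
    linarith
  have hwx : ∀ᶠ x in 𝓝 x₀, w β (0, x) < 2 * δ := by
    have h1 : Continuous (w β) := by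
      have := h.continuousOn_barrier hA3 hl hβ
      rwa [univ_prod_univ, continuousOn_univ] at this
    exact (h1.comp (by fun_prop : Continuous fun x : E => ((0 : ℝ≥0), x))).continuousAt.eventually_lt
      continuousAt_const hw0
  obtain ⟨ε, hε0, hε1, hεl⟩ : ∃ ε : ℝ≥0, 0 < ε ∧ ε ≤ 1 ∧ 1 / 2 ≤ Real.exp (-l * ε) := by
    have h1 : Tendsto (fun ε : ℝ≥0 => Real.exp (-l * ε)) (𝓝[>] 0) (𝓝 1) := by
      have h2 : Continuous fun ε : ℝ≥0 => Real.exp (-l * ε) := by fun_prop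
      simpa using (h2.tendsto 0).mono_left nhdsWithin_le_nhds
    obtain ⟨ε, h2, h3, h4⟩ := ((h1.eventually_const_le (by norm_num : (1 / 2 : ℝ) < 1)).and
      (((eventually_le_nhds (one_pos : (0 : ℝ≥0) < 1)).filter_mono nhdsWithin_le_nhds).and
        self_mem_nhdsWithin)).exists
    exact ⟨ε, h4, h3, h2⟩
  refine ⟨ε, hε0, hwx.mono fun x hx => ?_⟩
  have h1 := h.measure_exit_le hl (fun y => (hkI y).2) hU hkU hβ (by norm_num) hb hε1 x
  have h2 : 0 ≤ (M.P x).real {ω | M.exit U ω ≤ ε} := measureReal_nonneg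
  nlinarith

end StandardMarkovProcess

end

/-! ### ### Dependence on the initial time and local comparison -/

noncomputable section

/-- Uniform continuity in time along compact time intervals. -/
lemma ContinuousInTimeUniformlyOnCompacts.eventually_abs_sub_le {E : Type*} [TopologicalSpace E]
    {g : ℝ≥0 × E → ℝ} (hg : ContinuousInTimeUniformlyOnCompacts g) {K : Set E} (hK : IsCompact K)
    (t A : ℝ≥0) {η : ℝ} (hη : 0 < η) :
    ∀ᶠ t' in 𝓝 t, ∀ a ∈ Icc 0 A, ∀ y ∈ K, |g (t' + a, y) - g (t + a, y)| < η := by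
  refine isCompact_Icc.eventually_forall_of_forall_eventually fun a _ => ?_
  have h1 := Metric.tendstoUniformlyOn_iff.1 (hg K hK (t + a)) (η / 2) (half_pos hη)
  have h2 : Tendsto (fun z : ℝ≥0 × ℝ≥0 => z.1 + z.2) (𝓝 (t, a)) (𝓝 (t + a)) :=
    continuous_add.tendsto (t, a)
  have h3 : Tendsto (fun z : ℝ≥0 × ℝ≥0 => t + z.2) (𝓝 (t, a)) (𝓝 (t + a)) :=
    ((continuous_const_add t).comp continuous_snd).tendsto (t, a)
  filter_upwards [h2.eventually h1, h3.eventually h1] with z hz1 hz2 y hy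
  have h4 := hz1 y hy
  have h5 := hz2 y hy
  rw [Real.dist_eq, abs_lt] at h4 h5
  rw [abs_lt]
  constructor <;> linarith

/-- A function with one-sided limits is bounded on compact intervals. -/
lemma isBounded_image_Icc {E : Type*} [MetricSpace E] {p : ℝ≥0 → E}
    (hr : ∀ t, ∃ y, Tendsto p (𝓝[>] t) (𝓝 y)) (hl : ∀ t, ∃ y, Tendsto p (𝓝[<] t) (𝓝 y))
    (A : ℝ≥0) : Bornology.IsBounded (p '' Icc 0 A) := by
  refine isCompact_Icc.induction_on (p := fun S => Bornology.IsBounded (p '' S)) (by simp)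
    (fun S T hST hT => hT.subset (image_mono hST))
    (fun S T hS hT => by rw [image_union]; exact hS.union hT) fun t _ => ?_
  obtain ⟨y, hy⟩ := hr t
  obtain ⟨z, hz⟩ := hl t
  refine ⟨p ⁻¹' (Metric.ball y 1 ∪ Metric.ball z 1 ∪ {p t}), mem_nhdsWithin_of_mem_nhds ?_, ?_⟩
  · have h1 := eventually_nhdsWithin_iff.1 (hy.eventually (Metric.ball_mem_nhds y one_pos))
    have h2 := eventually_nhdsWithin_iff.1 (hz.eventually (Metric.ball_mem_nhds z one_pos))
    filter_upwards [h1, h2] with u hu1 hu2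
    rcases lt_trichotomy u t with h | h | h
    · exact Or.inl (Or.inr (hu2 h))
    · exact Or.inr (by rw [h]; rfl)
    · exact Or.inl (Or.inl (hu1 h))
  · exact ((Metric.isBounded_ball.union Metric.isBounded_ball).union
      Bornology.isBounded_singleton).subset (image_preimage_subset _ _)

namespace StandardMarkovProcess

set_option linter.unusedSectionVars false

open RCPath

variable {E Ω : Type*} [MetricSpace E] [ProperSpace E] [MeasurableSpace E]
  [BorelSpace E] [mΩ : MeasurableSpace Ω] {M : StandardMarkovProcess E Ω}
  {O : Set E} {α : ℝ} {f F : ℝ≥0 × E → ℝ}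

/-- Terminal rewards at arbitrary times depend continuously on the initial time. -/
lemma tendsto_terminal_sub (hα : 0 < α) (hF : IsBoundedMeasurable F)
    (hFt : ContinuousInTimeUniformlyOnCompacts F) {s : ℕ → ℝ≥0} {t : ℝ≥0}
    (hs : Tendsto s atTop (𝓝 t)) (T : ℕ → WithTop ℝ≥0) (ω : Ω) :
    Tendsto (fun n => terminal α F (s n) (T n) (M.path ω) - terminal α F t (T n) (M.path ω)) atTop
      (𝓝 0) := by
  obtain ⟨D, hD0, hD⟩ := hF.exists_bound
  rw [Metric.tendsto_atTop']
  intro η hη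
  -- After `A` discounting makes the difference small. Before `A` the path lies in a compact set,
  -- where `F` is uniformly continuous in time. Neither estimate involves `T n`, which may be
  -- arbitrary.
  obtain ⟨A, hA⟩ : ∃ A : ℝ≥0, Real.exp (-α * A) * (2 * D) < η := by
    have h1 : Tendsto (fun A : ℝ≥0 => Real.exp (-α * A) * (2 * D)) atTop (𝓝 (0 * (2 * D))) := by
      refine (Real.tendsto_exp_atBot.comp ?_).mul_const _
      exact (NNReal.tendsto_coe_atTop.2 tendsto_id).const_mul_atTop_of_neg (by linarith)
    rw [zero_mul] at h1
    exact (h1.eventually_lt_const hη).exists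
  have hK : IsCompact (closure ((fun u => M.X u ω) '' Icc 0 A)) :=
    (isBounded_image_Icc (fun t => ⟨_, M.right_continuous ω t⟩) (M.left_limits ω)
      A).isCompact_closure
  obtain ⟨N, hN⟩ := eventually_atTop.1 (hs.eventually (hFt.eventually_abs_sub_le hK t A hη))
  refine ⟨N, fun n hn => ?_⟩
  rw [Real.dist_eq, sub_zero]
  generalize T n = b
  cases b with
  | top => simpa using hη
  | coe a =>
    rw [terminal_coe, terminal_coe, ← mul_sub, abs_mul, abs_of_pos (Real.exp_pos _), path_apply]
    by_cases ha : a ≤ A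
    · have h1 := hN n hn.le a ⟨zero_le, ha⟩ (M.X a ω)
        (subset_closure ⟨a, ⟨zero_le, ha⟩, rfl⟩)
      have h2 : Real.exp (-α * a) ≤ 1 := Real.exp_le_one_iff.2 (by
        have := mul_nonneg hα.le a.coe_nonneg; linarith)
      calc _ ≤ 1 * |F (s n + a, M.X a ω) - F (t + a, M.X a ω)| :=
            mul_le_mul_of_nonneg_right h2 (abs_nonneg _)
        _ < η := by rwa [one_mul]
    · have h1 : (A : ℝ) ≤ a := by exact_mod_cast (not_le.1 ha).le
      have h2 : Real.exp (-α * a) ≤ Real.exp (-α * A) := Real.exp_le_exp.2 (by nlinarith)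
      refine lt_of_le_of_lt ?_ hA
      refine mul_le_mul h2 ((abs_sub _ _).trans ?_) (abs_nonneg _) (Real.exp_pos _).le
      linarith [hD (s n + a, M.X a ω), hD (t + a, M.X a ω)]

omit [ProperSpace E] in
lemma tendsto_running_sub (hα : 0 < α) (hf : IsBoundedMeasurable f)
    (hft : ∀ y, Continuous fun r => f (r, y)) {s : ℕ → ℝ≥0} {t : ℝ≥0}
    (hs : Tendsto s atTop (𝓝 t)) (T : ℕ → WithTop ℝ≥0) (p : RCPath E) :
    Tendsto (fun n => running α f (s n) (T n) p - running α f t (T n) p) atTop (𝓝 0) := by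
  obtain ⟨C, hC0, hC⟩ := hf.exists_bound
  set g : ℕ → ℝ≥0 × E → ℝ := fun n r => |f (s n + r.1, r.2) - f (t + r.1, r.2)| with hg
  have hm : ∀ t : ℝ≥0, Measurable fun r : ℝ≥0 × E => f (t + r.1, r.2) := fun t =>
    hf.1.comp ((measurable_fst.const_add t).prodMk measurable_snd)
  have hgm : ∀ n, Measurable (g n) := fun n => ((hm _).sub (hm _)).abs
  have hgC : ∀ n r, |g n r| ≤ 2 * C := fun n r => by
    rw [hg, abs_abs]
    refine (abs_sub _ _).trans ?_
    linarith [hC (s n + r.1, r.2), hC (t + r.1, r.2)]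
  have h1 : Tendsto (fun n => running α (g n) 0 ⊤ p) atTop
      (𝓝 (running α (fun _ => (0 : ℝ)) 0 ⊤ p)) :=
    tendsto_running hα hgm hgC (s := fun _ => 0) fun u _ => by
      have h2 : Tendsto (fun n => f (s n + (0 + u), p u)) atTop (𝓝 (f (t + (0 + u), p u))) :=
        ((hft (p u)).tendsto _).comp (hs.add_const _)
      simpa using (h2.sub_const (f (t + (0 + u), p u))).abs
  have h0 : running α (fun _ : ℝ≥0 × E => (0 : ℝ)) 0 ⊤ p = 0 := by simp [running, rate]
  rw [h0] at h1
  refine squeeze_zero_norm (fun n => ?_) h1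
  have hgb : IsBoundedMeasurable (g n) := ⟨hgm n, _, hgC n⟩
  rw [running, running, running, ← integral_sub
    (integrableOn_rate hα hf _ _ (before_subset_Ici _))
    (integrableOn_rate hα hf _ _ (before_subset_Ici _))]
  refine (norm_integral_le_of_norm_le (integrableOn_rate hα hgb 0 p (before_subset_Ici (T n)))
    (Eventually.of_forall fun u => ?_)).trans (setIntegral_mono_set
      (integrableOn_rate hα hgb 0 p (before_subset_Ici ⊤)) (Eventually.of_forall fun u =>
        mul_nonneg (Real.exp_pos _).le (abs_nonneg _)) (before_mono le_top).eventuallyLE)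
  rw [Real.norm_eq_abs, rate, rate, rate, ← mul_sub, abs_mul, abs_of_pos (Real.exp_pos _), hg,
    zero_add]

/-- Upper semicontinuity in time of the value function. -/
lemma eventually_valueFunction_lt (hO : IsOpen O) (hα : 0 < α)
    (hf : IsBoundedMeasurable f) (hF : IsBoundedMeasurable F)
    (hft : ∀ y, Continuous fun r => f (r, y)) (hFt : ContinuousInTimeUniformlyOnCompacts F)
    {s : ℕ → ℝ≥0} {t : ℝ≥0} (hs : Tendsto s atTop (𝓝 t)) (x : E) {η : ℝ} (hη : 0 < η) :
    ∀ᶠ n in atTop, M.valueFunction O α f F (s n, x) < M.valueFunction O α f F (t, x) + η := by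
  -- Nearly optimal stopping times for the initial time `s n` serve as competitors at the initial
  -- time `t`.
  have h : ∀ n, ∃ τ, IsStoppingTime M.filtration τ ∧
      M.valueFunction O α f F (s n, x) - η / 2 < M.functional O α f F (s n, x) τ := by
    intro n
    by_contra! hcon
    have := M.valueFunction_le hcon
    linarith
  choose τ hτ hlt using h
  obtain ⟨C, hC0, hC⟩ := hf.exists_bound
  obtain ⟨D, hD0, hD⟩ := hF.exists_bound
  have hmin := fun n => (hτ n).measurable'.min (M.measurable_exit O)
  have hlim : Tendsto (fun n => M.functional O α f F (s n, x) (τ n) -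
      M.functional O α f F (t, x) (τ n)) atTop (𝓝 (∫ _, (0 : ℝ) ∂(M.P x))) := by
    have h1 : ∀ n, M.functional O α f F (s n, x) (τ n) - M.functional O α f F (t, x) (τ n) =
        ∫ ω, ((running α f (s n) (min (τ n ω) (M.exit O ω)) (M.path ω) -
          running α f t (min (τ n ω) (M.exit O ω)) (M.path ω)) +
          (terminal α F (s n) (min (τ n ω) (M.exit O ω)) (M.path ω) -
          terminal α F t (min (τ n ω) (M.exit O ω)) (M.path ω))) ∂(M.P x) := by
      intro n
      rw [M.functional_eq hO, M.functional_eq hO, ← integral_sub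
        (M.integrable_stopped hα hf hF (hmin n) (s n, x))
        (M.integrable_stopped hα hf hF (hmin n) (t, x))]
      refine integral_congr_ae (Eventually.of_forall fun ω => ?_)
      simp only
      ring
    simp_rw [h1]
    refine tendsto_integral_of_dominated_convergence (fun _ => 2 * (C / α) + 2 * D) (fun n => ?_)
      (integrable_const _) (fun n => Eventually.of_forall fun ω => ?_)
      (Eventually.of_forall fun ω => ?_)
    · exact (((measurable_running hf.1 measurable_const (hmin n) M.measurable_path).sub
        (measurable_running hf.1 measurable_const (hmin n) M.measurable_path)).add
        ((measurable_terminal hF.1 measurable_const (hmin n) M.measurable_path).sub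
        (measurable_terminal hF.1 measurable_const (hmin n)
          M.measurable_path))).aestronglyMeasurable
    · refine (abs_add_le _ _).trans (add_le_add ((abs_sub _ _).trans ?_) ((abs_sub _ _).trans ?_))
      · rw [two_mul]
        exact add_le_add (abs_running_le hα hC0 hC _ _ _) (abs_running_le hα hC0 hC _ _ _)
      · rw [two_mul]
        exact add_le_add (abs_terminal_le hα.le hD0 hD _ _ _) (abs_terminal_le hα.le hD0 hD _ _ _)
    · simpa using (tendsto_running_sub hα hf hft hs (fun n => min (τ n ω) (M.exit O ω))
        (M.path ω)).add (tendsto_terminal_sub hα hF hFt hs (fun n => min (τ n ω) (M.exit O ω)) ω)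
  rw [integral_zero] at hlim
  filter_upwards [hlim.eventually_lt_const (half_pos hη)] with n hn
  have h1 := hlt n
  have h2 := M.functional_le_valueFunction hO hα hf hF (t, x) (hτ n)
  linarith

namespace IsPenalizedFamily

variable {w : ℝ → ℝ≥0 × E → ℝ}

/-- From above by the value function, from below by `F` minus the uniform bound on the penalty. -/
lemma exists_bound (h : M.IsPenalizedFamily O α f F w) (hO : IsOpen O) (hα : 0 < α)
    (hf : IsBoundedMeasurable f) (hF : IsBoundedMeasurable F)
    (hFc : ContinuousOn F (univ ×ˢ O)) (hwc : ∀ β, 0 < β → ContinuousOn (w β) (univ ×ˢ O)) :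
    ∃ B, 0 ≤ B ∧ (∀ β, 0 < β → ∀ q, |w β q| ≤ B) ∧ ∀ q, |M.valueFunction O α f F q| ≤ B := by
  obtain ⟨K, hK0, hK⟩ := h.exists_penalty_bound hα hf hF
  obtain ⟨C, hC0, hC⟩ := hf.exists_bound
  obtain ⟨D, hD0, hD⟩ := hF.exists_bound
  have h1 : ∀ β, 0 < β → ∀ q, |w β q| ≤ max (C / α + D) (D + K) := by
    intro β hβ q
    have h2 := h.le_valueFunction hO hα hf hF hFc hβ (hwc β hβ) q
    have h3 : M.valueFunction O α f F q ≤ C / α + D := M.valueFunction_le fun τ _ =>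
      (le_abs_self _).trans (M.abs_functional_le hO hα hC0 hC hD0 hD q τ)
    have h4 := (le_max_left _ _).trans ((le_abs_self _).trans (hK β hβ q))
    have h5 := (abs_le.1 (hD q)).1
    have h6 := le_max_left (C / α + D) (D + K)
    have h7 := le_max_right (C / α + D) (D + K)
    exact abs_le.2 ⟨by linarith, by linarith⟩
  refine ⟨_, by positivity, h1, fun q => le_of_tendsto
    (h.tendsto_valueFunction hO hα hf hF hFc hwc q).abs ?_⟩
  filter_upwards [eventually_gt_atTop 0] with β hβ using h1 β hβ q

/-- Comparison of penalized solutions on a set where the obstacle is almost respected. -/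
lemma sub_le_of_obstacle_le (h : M.IsPenalizedFamily O α f F w) (hO : IsOpen O) (hα : 0 < α)
    (hf : IsBoundedMeasurable f) (hF : IsBoundedMeasurable F)
    (hFc : ContinuousOn F (univ ×ˢ O)) (hwc : ∀ β, 0 < β → ContinuousOn (w β) (univ ×ˢ O))
    {β β' : ℝ} (hβ : 0 < β) (hββ' : β ≤ β') {U : Set E} (hUO : U ⊆ O) {s ε : ℝ≥0} {η B : ℝ}
    (hη : 0 ≤ η) (hFU : ∀ r : ℝ≥0, r ≤ ε → ∀ y ∈ U, F (s + r, y) ≤ w β (s + r, y) + η)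
    (hB : ∀ q, |w β' q - w β q| ≤ B) (x : E) :
    w β' (s, x) - w β (s, x) ≤ η + B * (M.P x).real {ω | M.exit U ω ≤ ε} +
      ∫ ω, O.indicator (fun y => w β' (s + ε, y) - w β (s + ε, y)) (M.X ε ω) ∂(M.P x) := by
  have hβ' := hβ.trans_le hββ'
  have hw := h.isBoundedMeasurable β hβ
  have hw' := h.isBoundedMeasurable β' hβ'
  have hg := isBoundedMeasurable_penalty hf hF hw β
  have hg' := isBoundedMeasurable_penalty hf hF hw' β'
  have hmono : ∀ q, 0 ≤ w β' q - w β q := fun q => sub_nonneg.2 (h.monotoneOn hα hf hF hβ hββ' q)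
  have hB0 : 0 ≤ B := (abs_nonneg _).trans (hB (0, x))
  obtain ⟨τ, hτ, hτlt, hτeq⟩ := M.exists_isStoppingTime_obstacle hO hFc (hwc β' hβ') s
  -- Before `θ` the solution for `β'` pays no penalty, while that for `β` has a nonnegative one, so
  -- only the terminal terms count. The difference is at most `B` if `U` is left by `ε`. At an
  -- obstacle time before `ε` it is at most `η`, since then w β' ≤ F ≤ w β + η. At time `ε` it is
  -- the indicator term.
  set θ : Ω → WithTop ℝ≥0 := fun ω => min (τ ω) (min (M.exit U ω) ε) with hθd
  have hθ : IsStoppingTime M.filtration θ :=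
    hτ.min ((M.isStoppingTime_exit U).min (isStoppingTime_const M.filtration ε))
  have hmin := hθ.measurable'.min (M.measurable_exit O)
  have hS : MeasurableSet {ω | M.exit U ω ≤ ε} := M.measurable_exit U measurableSet_Iic
  have hi3 : Integrable ({ω | M.exit U ω ≤ ε}.indicator fun _ => B) (M.P x) :=
    (integrable_const _).indicator hS
  have hi4 : Integrable (fun ω => O.indicator (fun y => w β' (s + ε, y) - w β (s + ε, y))
      (M.X ε ω)) (M.P x) := by
    have h1 : Measurable (O.indicator fun y => w β' (s + ε, y) - w β (s + ε, y)) :=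
      Measurable.indicator ((hw'.1.comp measurable_prodMk_left).sub
        (hw.1.comp measurable_prodMk_left)) hO.measurableSet
    refine Integrable.of_bound (h1.comp (M.measurable_X ε)).aestronglyMeasurable B
      (Eventually.of_forall fun ω => ?_)
    by_cases hX : M.X ε ω ∈ O
    · rw [indicator_of_mem hX]
      exact hB _
    · rw [indicator_of_notMem hX]
      simpa using hB0
  have hrhs : η + B * (M.P x).real {ω | M.exit U ω ≤ ε} +
      ∫ ω, O.indicator (fun y => w β' (s + ε, y) - w β (s + ε, y)) (M.X ε ω) ∂(M.P x) =
      ∫ ω, ((η + {ω | M.exit U ω ≤ ε}.indicator (fun _ => B) ω) +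
        O.indicator (fun y => w β' (s + ε, y) - w β (s + ε, y)) (M.X ε ω)) ∂(M.P x) := by
    have hi5 : Integrable (fun ω => η + {ω | M.exit U ω ≤ ε}.indicator (fun _ => B) ω) (M.P x) :=
      (integrable_const η).add hi3
    rw [integral_add hi5 hi4, integral_add (integrable_const _) hi3, integral_indicator_const _ hS]
    simp [mul_comm]
  rw [hrhs, h.eq_stopped hO hα hf hF hβ' hθ (s, x), h.eq_stopped hO hα hf hF hβ hθ (s, x),
    ← integral_sub (M.integrable_stopped hα hg' hw' hmin (s, x))
      (M.integrable_stopped hα hg hw hmin (s, x))]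
  refine integral_mono ((M.integrable_stopped hα hg' hw' hmin (s, x)).sub
    (M.integrable_stopped hα hg hw hmin (s, x))) (((integrable_const _).add hi3).add hi4)
    fun ω => ?_
  have hUO' : RCPath.exitTime U (M.path ω) ≤ RCPath.exitTime O (M.path ω) :=
    exitTime_mono hUO _
  have h1 : min (θ ω) (M.exit O ω) = θ ω :=
    min_eq_left ((min_le_right _ _).trans ((min_le_left _ _).trans hUO'))
  simp only [h1]
  have hrun : running α (fun r => f r + β' * max (F r - w β' r) 0) s (θ ω) (M.path ω) ≤
      running α (fun r => f r + β * max (F r - w β r) 0) s (θ ω) (M.path ω) := by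
    refine running_mono hα hg' hg fun u hu => ?_
    have h2 := hτlt ω u (hu.trans_le (min_le_left _ _)) (mem_of_lt_exitTime
      ((hu.trans_le ((min_le_right _ _).trans (min_le_left _ _))).trans_le hUO'))
    rw [path_apply, max_eq_right (sub_nonpos.2 h2), mul_zero]
    gcongr
    exact mul_nonneg hβ.le (le_max_right _ _)
  have hind : 0 ≤ O.indicator (fun y => w β' (s + ε, y) - w β (s + ε, y)) (M.X ε ω) :=
    indicator_nonneg (fun y _ => hmono _) _
  have hexp : ∀ a : ℝ≥0, Real.exp (-α * a) ≤ 1 := fun a => Real.exp_le_one_iff.2 (by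
    have := mul_nonneg hα.le a.coe_nonneg; linarith)
  have hdiff : ∀ a : ℝ≥0, terminal α (w β') s a (M.path ω) - terminal α (w β) s a (M.path ω) ≤
      w β' (s + a, M.X a ω) - w β (s + a, M.X a ω) := fun a => by
    rw [terminal_coe, terminal_coe, ← mul_sub, path_apply]
    exact mul_le_of_le_one_left (hmono _) (hexp a)
  suffices hterm : terminal α (w β') s (θ ω) (M.path ω) - terminal α (w β) s (θ ω) (M.path ω) ≤
      (η + {ω | M.exit U ω ≤ ε}.indicator (fun _ => B) ω) +
        O.indicator (fun y => w β' (s + ε, y) - w β (s + ε, y)) (M.X ε ω) by linarith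
  obtain ⟨a, ha⟩ := WithTop.ne_top_iff_exists.1 (ne_top_of_le_ne_top (WithTop.coe_ne_top (a := ε))
    ((min_le_right (τ ω) (min (M.exit U ω) ε)).trans (min_le_right _ _)))
  have haθ : θ ω = a := ha.symm
  rw [haθ]
  refine (hdiff a).trans ?_
  by_cases hle : M.exit U ω ≤ ε
  · rw [indicator_of_mem (show ω ∈ {ω | M.exit U ω ≤ ε} from hle)]
    have := (le_abs_self _).trans (hB (s + a, M.X a ω))
    linarith
  rw [indicator_of_notMem (show ω ∉ {ω | M.exit U ω ≤ ε} from hle), add_zero]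
  have hlt : (ε : WithTop ℝ≥0) < RCPath.exitTime U (M.path ω) := not_le.1 hle
  have hθ2 : θ ω = min (τ ω) ε := by
    simp only [hθd]
    rw [min_eq_right hlt.le]
  by_cases hτε : τ ω < ε
  · have hτa : τ ω = a := by rw [← haθ, hθ2, min_eq_left hτε.le]
    have haε : a ≤ ε := by
      rw [hτa] at hτε
      exact_mod_cast hτε.le
    have haU : M.X a ω ∈ U := mem_of_lt_exitTime ((hτa ▸ hτε).trans hlt)
    have h2 := hτeq ω a hτa (hUO haU)
    have h3 := hFU a haε _ haU
    linarith
  · have haε : a = ε := by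
      rw [min_eq_right (not_lt.1 hτε), haθ] at hθ2
      exact_mod_cast hθ2
    subst haε
    have haU : M.X a ω ∈ U := mem_of_lt_exitTime hlt
    rw [indicator_of_mem (hUO haU)]
    linarith

end IsPenalizedFamily

end StandardMarkovProcess

end

/-! ### ### Uniform convergence on compact sets -/

noncomputable section

namespace StandardMarkovProcess

set_option linter.unusedSectionVars false

open RCPath

variable {E Ω : Type*} [MetricSpace E] [ProperSpace E] [MeasurableSpace E]
  [BorelSpace E] [mΩ : MeasurableSpace Ω] {M : StandardMarkovProcess E Ω}
  {O : Set E} {α : ℝ} {f F : ℝ≥0 × E → ℝ}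

namespace IsPenalizedFamily

variable {w : ℝ → ℝ≥0 × E → ℝ}

lemma measurable_valueFunction (h : M.IsPenalizedFamily O α f F w) (hO : IsOpen O) (hα : 0 < α)
    (hf : IsBoundedMeasurable f) (hF : IsBoundedMeasurable F)
    (hFc : ContinuousOn F (univ ×ˢ O)) (hwc : ∀ β, 0 < β → ContinuousOn (w β) (univ ×ˢ O)) :
    Measurable (M.valueFunction O α f F) :=
  measurable_of_tendsto_metrizable (f := fun n : ℕ => w ((n : ℝ) + 1))
    (fun n => (h.isBoundedMeasurable _ (by positivity)).1) (tendsto_pi_nhds.2 fun q =>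
      (h.tendsto_valueFunction hO hα hf hF hFc hwc q).comp
        (tendsto_atTop_add_const_right _ _ tendsto_natCast_atTop_atTop))

/-- Let the larger parameter tend to infinity in the comparison of two penalized solutions; the
majorant `K` does not depend on it, so the integral bound survives the limit. -/
lemma valueFunction_sub_le (h : M.IsPenalizedFamily O α f F w) (hO : IsOpen O) (hα : 0 < α)
    (hf : IsBoundedMeasurable f) (hF : IsBoundedMeasurable F)
    (hFc : ContinuousOn F (univ ×ˢ O)) (hwc : ∀ β, 0 < β → ContinuousOn (w β) (univ ×ˢ O))
    {β : ℝ} (hβ : 0 < β) {U : Set E} (hUO : U ⊆ O) {s ε : ℝ≥0} {η B : ℝ}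
    (hη : 0 ≤ η) (hFU : ∀ r : ℝ≥0, r ≤ ε → ∀ y ∈ U, F (s + r, y) ≤ w β (s + r, y) + η)
    (hB : ∀ β, 0 < β → ∀ q, |w β q| ≤ B) {K : E → ℝ} (hK : IsBoundedMeasurable K)
    (hVK : ∀ y ∈ O, M.valueFunction O α f F (s + ε, y) - w β (s + ε, y) ≤ K y)
    (hK0 : ∀ y, 0 ≤ K y) (x : E) :
    M.valueFunction O α f F (s, x) - w β (s, x) ≤
      η + 2 * B * (M.P x).real {ω | M.exit U ω ≤ ε} + ∫ ω, K (M.X ε ω) ∂(M.P x) := by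
  refine le_of_tendsto ((h.tendsto_valueFunction hO hα hf hF hFc hwc (s, x)).sub_const _) ?_
  filter_upwards [eventually_ge_atTop β] with β' hβ'
  have hβ'0 := hβ.trans_le hβ'
  have hw := h.isBoundedMeasurable β hβ
  have hw' := h.isBoundedMeasurable β' hβ'0
  refine (h.sub_le_of_obstacle_le hO hα hf hF hFc hwc hβ hβ' hUO hη hFU (B := 2 * B)
    (fun q => (abs_sub _ _).trans (by linarith [hB β hβ q, hB β' hβ'0 q])) x).trans ?_
  refine add_le_add le_rfl (integral_mono_of_nonneg (Eventually.of_forall fun ω => ?_)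
    ((hK.comp (M.measurable_X ε)).integrable _) (Eventually.of_forall fun ω => ?_))
  · exact indicator_nonneg (fun y _ => sub_nonneg.2 (h.monotoneOn hα hf hF hβ hβ' _)) _
  · beta_reduce
    by_cases hX : M.X ε ω ∈ O
    · rw [indicator_of_mem hX]
      refine le_trans ?_ (hVK _ hX)
      exact sub_le_sub_right (h.le_valueFunction hO hα hf hF hFc hβ'0 (hwc β' hβ'0) _) _
    · rw [indicator_of_notMem hX]
      exact hK0 _

/-- Along sequences of times, penalized solutions approximate the value function. -/
lemma tendsto_sub_time (h : M.IsPenalizedFamily O α f F w) (hO : IsOpen O) (hα : 0 < α)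
    (hf : IsBoundedMeasurable f) (hF : IsBoundedMeasurable F)
    (hft : ∀ y, Continuous fun r => f (r, y)) (hFt : ContinuousInTimeUniformlyOnCompacts F)
    (hFc : ContinuousOn F (univ ×ˢ O)) (hwc : ∀ β, 0 < β → ContinuousOn (w β) (univ ×ˢ O))
    {b : ℕ → ℝ} (hb0 : ∀ n, 0 < b n) (hb : Tendsto b atTop atTop) {t : ℕ → ℝ≥0} {t₀ : ℝ≥0}
    (ht : Tendsto t atTop (𝓝 t₀)) {y : E} (hy : y ∈ O) :
    Tendsto (fun n => M.valueFunction O α f F (t n, y) - w (b n) (t n, y)) atTop (𝓝 0) := by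
  refine tendsto_order.2 ⟨fun c hc => Eventually.of_forall fun n => hc.trans_le (sub_nonneg.2
    (h.le_valueFunction hO hα hf hF hFc (hb0 n) (hwc _ (hb0 n)) _)), fun c hc => ?_⟩
  have hc3 : 0 < c / 3 := by positivity
  -- A single `β`, good at the limit time, is enough: it is continuous in time, the value function
  -- is upper semicontinuous in time, and larger parameters only increase the solution. Each step
  -- costs `c / 3`.
  obtain ⟨β, hβV, hβ⟩ := (((h.tendsto_valueFunction hO hα hf hF hFc hwc (t₀, y)).eventually_const_lt
    (sub_lt_self _ hc3)).and (eventually_gt_atTop 0)).exists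
  have h1 : Tendsto (fun n => w β (t n, y)) atTop (𝓝 (w β (t₀, y))) :=
    ((hwc β hβ).continuousAt ((isOpen_univ.prod hO).mem_nhds ⟨trivial, hy⟩)).tendsto.comp
      (ht.prodMk_nhds tendsto_const_nhds)
  filter_upwards [eventually_valueFunction_lt (M := M) hO hα hf hF hft hFt ht y hc3,
    h1.eventually_const_lt (sub_lt_self _ hc3), hb.eventually_ge_atTop β] with n hn1 hn2 hn3
  have := h.monotoneOn hα hf hF hβ hn3 (t n, y)
  linarith

/-- Continuous convergence of the penalized solutions to the value function. -/
lemma tendsto_sub_seq (h : M.IsPenalizedFamily O α f F w) (hweak : M.WeakFeller)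
    (hA3 : M.StrongFeller) (hO : IsOpen O) (hα : 0 < α)
    (hf : IsBoundedMeasurable f) (hF : IsBoundedMeasurable F)
    (hft : ∀ y, Continuous fun r => f (r, y)) (hFt : ContinuousInTimeUniformlyOnCompacts F)
    (hFc : ContinuousOn F (univ ×ˢ O)) (hwc : ∀ β, 0 < β → ContinuousOn (w β) (univ ×ˢ O))
    {b : ℕ → ℝ} (hb0 : ∀ n, 0 < b n) (hb : Tendsto b atTop atTop) {q : ℕ → ℝ≥0 × E}
    {q₀ : ℝ≥0 × E} (hq : Tendsto q atTop (𝓝 q₀)) (hq₀ : q₀.2 ∈ O) :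
    Tendsto (fun n => M.valueFunction O α f F (q n) - w (b n) (q n)) atTop (𝓝 0) := by
  refine tendsto_order.2 ⟨fun c hc => Eventually.of_forall fun n => hc.trans_le (sub_nonneg.2
    (h.le_valueFunction hO hα hf hF hFc (hb0 n) (hwc _ (hb0 n)) _)), fun c hc => ?_⟩
  obtain ⟨B, hB0, hB, hBV⟩ := h.exists_bound hO hα hf hF hFc hwc
  have hs : Tendsto (fun n => (q n).1) atTop (𝓝 q₀.1) := (continuous_fst.tendsto _).comp hq
  have hx : Tendsto (fun n => (q n).2) atTop (𝓝 q₀.2) := (continuous_snd.tendsto _).comp hq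
  -- The three error terms are η, 2Bη and η, which add up to c/2.
  set η := c / 2 / (2 * B + 2) with hηd
  have hη : 0 < η := by positivity
  obtain ⟨ρ, hρ, hρO⟩ := Metric.nhds_basis_closedBall.mem_iff.1 (hO.mem_nhds hq₀)
  set U := Metric.ball q₀.2 ρ with hU
  have hUO : U ⊆ O := Metric.ball_subset_closedBall.trans hρO
  -- The horizon `q₀.1 + 2` leaves 1 for the approximating initial times and 1 for the elapsed time,
  -- which is at most `ε ≤ 1`.
  have hcpt := h.eventually_le_add hO hα hf hF hFc hwc
    ((isCompact_Icc (a := (0 : ℝ≥0)) (b := q₀.1 + 2)).prod (isCompact_closedBall q₀.2 ρ))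
    (prod_mono (subset_univ _) hρO) hη
  obtain ⟨ε₀, hε₀, hexit⟩ := M.noQuickExit hweak hA3 Metric.isOpen_ball q₀.2
    (Metric.mem_ball_self hρ) η hη
  set ε := min ε₀ 1 with hε
  have hε0 : 0 < ε := lt_min hε₀ one_pos
  set D : ℕ → E → ℝ := fun n => O.indicator fun y =>
    M.valueFunction O α f F ((q n).1 + ε, y) - w (b n) ((q n).1 + ε, y) with hD
  have hVm := h.measurable_valueFunction hO hα hf hF hFc hwc
  have hDm : ∀ n, Measurable (D n) := fun n =>
    Measurable.indicator ((hVm.comp measurable_prodMk_left).sub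
      ((h.isBoundedMeasurable _ (hb0 n)).1.comp measurable_prodMk_left)) hO.measurableSet
  have hD0 : ∀ n y, 0 ≤ D n y := fun n y => indicator_nonneg (fun y _ => sub_nonneg.2
    (h.le_valueFunction hO hα hf hF hFc (hb0 n) (hwc _ (hb0 n)) _)) _
  have hDB : ∀ n y, |D n y| ≤ 2 * B := fun n y => by
    by_cases hy : y ∈ O
    · simp only [hD]
      rw [indicator_of_mem hy]
      refine (abs_sub _ _).trans ?_
      linarith [hB _ (hb0 n) ((q n).1 + ε, y), hBV ((q n).1 + ε, y)]
    · simp only [hD]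
      rw [indicator_of_notMem hy, abs_zero]
      positivity
  have hDlim : ∀ y, Tendsto (fun n => D n y) atTop (𝓝 0) := fun y => by
    by_cases hy : y ∈ O
    · simp only [hD, indicator_of_mem hy]
      exact h.tendsto_sub_time hO hα hf hF hft hFt hFc hwc hb0 hb (hs.add_const ε) hy
    · simp only [hD, indicator_of_notMem hy]
      exact tendsto_const_nhds
  -- `K N` dominates every difference with index at least `N` and is bounded and measurable. By the
  -- strong Feller property its expectation at time `ε` is continuous in the starting point, so
  -- smallness at `q₀.2` carries over to the moving points.
  set K : ℕ → E → ℝ := fun N y => tailSup (fun n => D n y) N with hK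
  have hKm : ∀ N, IsBoundedMeasurable (K N) := fun N => IsBoundedMeasurable.tailSup hDm hDB N
  have hDK : ∀ {N n : ℕ}, N ≤ n → ∀ y, D n y ≤ K N y := fun hn y =>
    le_tailSup (a := fun n => D n y) (fun n => (le_abs_self _).trans (hDB n y)) hn
  have hK0 : ∀ N y, 0 ≤ K N y := fun N y => (hD0 N y).trans (hDK le_rfl y)
  have hKlim : Tendsto (fun N => ∫ ω, K N (M.X ε ω) ∂(M.P q₀.2)) atTop
      (𝓝 (∫ _, (0 : ℝ) ∂(M.P q₀.2))) := by
    refine tendsto_integral_of_dominated_convergence (fun _ => 2 * B)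
      (fun N => ((hKm N).1.comp (M.measurable_X ε)).aestronglyMeasurable) (integrable_const _)
      (fun N => Eventually.of_forall fun ω => ?_) (Eventually.of_forall fun ω =>
        tendsto_tailSup (fun n => hD0 n _) (hDlim _))
    rw [Real.norm_eq_abs, abs_of_nonneg (hK0 N _)]
    exact tailSup_le N fun n _ => (le_abs_self _).trans (hDB n _)
  rw [integral_zero] at hKlim
  obtain ⟨N, hN⟩ := (hKlim.eventually_lt_const hη).exists
  have hKN := ((hA3 ε hε0 _ (hKm N).1 (hKm N).2).tendsto q₀.2).comp hx
  filter_upwards [hKN.eventually_lt_const hN, hx.eventually hexit, hb.eventually hcpt,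
    eventually_ge_atTop N, hs.eventually_lt_const (lt_add_one q₀.1)] with n hn1 hn2 hn3 hn4 hn5
  have h1 := h.valueFunction_sub_le hO hα hf hF hFc hwc (hb0 n) hUO (s := (q n).1) (ε := ε) hη.le
    (fun r hr y hy => hn3 _ ⟨⟨zero_le, by
      calc (q n).1 + r ≤ q₀.1 + 1 + 1 := add_le_add hn5.le (hr.trans (min_le_right _ _))
        _ = q₀.1 + 2 := by rw [add_assoc, one_add_one_eq_two]⟩,
      Metric.ball_subset_closedBall hy⟩) hB (hKm N) (fun y hy => by
        refine le_trans (le_of_eq ?_) (hDK hn4 y)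
        exact (indicator_of_mem hy fun y =>
          M.valueFunction O α f F ((q n).1 + ε, y) - w (b n) ((q n).1 + ε, y)).symm)
      (hK0 N) (q n).2
  have h2 : (M.P (q n).2).real {ω | M.exit U ω ≤ ε} ≤ η :=
    (measureReal_mono fun ω (hω : M.exit U ω ≤ ε) =>
      show M.exit U ω ≤ ε₀ from hω.trans (WithTop.coe_le_coe.2 (min_le_left _ _))).trans hn2
  have h3 : 2 * B * (M.P (q n).2).real {ω | M.exit U ω ≤ ε} ≤ 2 * B * η :=
    mul_le_mul_of_nonneg_left h2 (by positivity)
  have h4 : η * (2 * B + 2) = c / 2 := div_mul_cancel₀ _ (by positivity)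
  have h5 : ∫ ω, K N (M.X ε ω) ∂(M.P (q n).2) < η := hn1
  refine h1.trans_lt ?_
  linarith

lemma tendstoUniformlyOn (h : M.IsPenalizedFamily O α f F w) (hweak : M.WeakFeller)
    (hA3 : M.StrongFeller) (hO : IsOpen O) (hα : 0 < α)
    (hf : IsBoundedMeasurable f) (hF : IsBoundedMeasurable F)
    (hft : ∀ y, Continuous fun r => f (r, y)) (hFt : ContinuousInTimeUniformlyOnCompacts F)
    (hFc : ContinuousOn F (univ ×ˢ O)) (hwc : ∀ β, 0 < β → ContinuousOn (w β) (univ ×ˢ O))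
    {K : Set (ℝ≥0 × E)} (hK : IsCompact K) (hKO : K ⊆ univ ×ˢ O) :
    TendstoUniformlyOn w (M.valueFunction O α f F) atTop K := by
  rw [← tendstoLocallyUniformlyOn_iff_tendstoUniformlyOn_of_compact hK,
    Metric.tendstoLocallyUniformlyOn_iff]
  intro η hη q₀ hq₀
  -- The joint limit in parameter and point is exactly local uniformity, and it can be tested along
  -- sequences. The parameters are replaced by their maximum with 1 to keep all of them positive.
  have key : Tendsto (fun z : ℝ × (ℝ≥0 × E) => M.valueFunction O α f F z.2 - w z.1 z.2)
      (atTop ×ˢ 𝓝 q₀) (𝓝 0) := by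
    refine tendsto_of_seq_tendsto fun z hz => ?_
    have h1 : Tendsto (fun n => (z n).1) atTop atTop := tendsto_fst.comp hz
    have h2 : Tendsto (fun n => (z n).2) atTop (𝓝 q₀) := tendsto_snd.comp hz
    have h3 := h.tendsto_sub_seq hweak hA3 hO hα hf hF hft hFt hFc hwc
      (b := fun n => max (z n).1 1) (fun n => lt_max_of_lt_right one_pos)
      (tendsto_atTop_mono (fun n => le_max_left _ _) h1) h2 (hKO hq₀).2
    refine h3.congr' ?_
    filter_upwards [h1.eventually_ge_atTop 1] with n hn
    rw [max_eq_left hn]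
    rfl
  obtain ⟨pa, hpa, pb, hpb, hp⟩ := eventually_prod_iff.1
    (key.eventually (Metric.ball_mem_nhds 0 hη))
  refine ⟨{q | pb q}, mem_nhdsWithin_of_mem_nhds hpb, hpa.mono fun β hβ q hq => ?_⟩
  have := hp hβ hq
  rw [Real.dist_eq, sub_zero] at this
  rwa [Real.dist_eq]

end IsPenalizedFamily

end StandardMarkovProcess

end

theorem mainTheorem9 {E Ω : Type*} [MetricSpace E] [ProperSpace E] [MeasurableSpace E]
    [BorelSpace E] [MeasurableSpace Ω] (M : StandardMarkovProcess E Ω) (hweak : M.WeakFeller)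
    (O : Set E) (hO : IsOpen O) (α : ℝ) (hα : 0 < α) (f F : ℝ≥0 × E → ℝ)
    (hf : Measurable f) (hf_bdd : IsBoundedFunction f)
    (hf_time : ContinuousInTimeUniformlyOnCompacts f)
    (hF : Measurable F) (hF_bdd : IsBoundedFunction F)
    (hF_time : ContinuousInTimeUniformlyOnCompacts F)
    (hF_cont : ContinuousOn F (univ ×ˢ O))
    (hA1 : M.StoppedFeller O) (hA3 : M.StrongFeller) :
    (∀ β : ℝ, 0 < β → ∃! w : ℝ≥0 × E → ℝ, M.IsPenalizedSolution O α f F β w) ∧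
    ∀ w : ℝ → ℝ≥0 × E → ℝ, (∀ β : ℝ, 0 < β → M.IsPenalizedSolution O α f F β (w β)) →
      (∀ β : ℝ, 0 < β → ContinuousOn (w β) (univ ×ˢ O)) ∧
      (∀ β₁ β₂ : ℝ, 0 < β₁ → β₁ ≤ β₂ → ∀ p, w β₁ p ≤ w β₂ p) ∧
      (∀ p, Tendsto (fun β => w β p) atTop (𝓝 (M.valueFunction O α f F p))) ∧
      (∀ K : Set (ℝ≥0 × E), IsCompact K → K ⊆ univ ×ˢ O →
        TendstoUniformlyOn w (M.valueFunction O α f F) atTop K) := by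
  have hf' : IsBoundedMeasurable f := ⟨hf, hf_bdd⟩
  have hF' : IsBoundedMeasurable F := ⟨hF, hF_bdd⟩
  have hexit := M.noQuickExit hweak hA3 hO
  refine ⟨fun β hβ => ?_, fun w hw => ?_⟩
  · obtain ⟨w, hw, h, -⟩ := M.exists_penalized_fixedPoint (O := O) hα hβ hf' hF'
    have h' := (M.penalized_iff hα hβ hf' hF' hw).2 h
    refine ⟨w, (M.isPenalizedSolution_iff hO).2 ⟨hw, h'⟩, fun v hv => ?_⟩
    obtain ⟨hvm, hv'⟩ := (M.isPenalizedSolution_iff hO).1 hv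
    exact M.penalized_unique hα hβ hf' hF' hvm hw hv' h'
  · have h : M.IsPenalizedFamily O α f F w :=
      ⟨fun β hβ => ((M.isPenalizedSolution_iff hO).1 (hw β hβ)).1,
        fun β hβ => ((M.isPenalizedSolution_iff hO).1 (hw β hβ)).2⟩
    have hwc : ∀ β, 0 < β → ContinuousOn (w β) (univ ×ˢ O) := fun β hβ =>
      M.continuousOn_penalized hO hA3 hexit hα hβ hf' hF' hf_time.continuous hF_time.continuous
        (h.isBoundedMeasurable β hβ) (h.eq_value β hβ)
    exact ⟨hwc, fun β₁ β₂ hβ₁ hβ p => h.monotoneOn hα hf' hF' hβ₁ hβ p,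
      h.tendsto_valueFunction hO hα hf' hF' hF_cont hwc,
      fun K hK hKO => h.tendstoUniformlyOn hweak hA3 hO hα hf' hF' hf_time.continuous hF_time
        hF_cont hwc hK hKO⟩
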